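/- Let $d\in\mathbb N$, $T>0$. Notation: $B(x,R)$ is the closed ball; $\mathcal P(K)$ is the set of Borel probability measures on $\mathbb R^d$ concentrated on $K$; $\mathcal P_c(\mathbb R^d)$ is the set of those with compact support; $\Gamma(\mu,\nu)$ is the set of transport plans between $\mu$ and $\nu$; $W_p$ is the $p$-Wasserstein distance; $\Gamma_o(\mu,\nu)$ is the set of $2$-optimal plans; and $W_{2,\gamma}(\mu,\nu):=\big(\int|x-y|^2\,d\gamma(x,y)\big)^{1/2}$ for $\gamma\in\Gamma(\mu,\nu)$. A map $\phi:\mathcal P_c(\mathbb R^d)\to\mathbb R$ is *locally differentiable* at $\mu$ with Wasserstein gradient $\nabla\phi(\mu)=\xi$ if $\xi$ belongs to the $L^2(\mu)$-closure of $\{\nabla\psi:\psi\in C_c^\infty(\mathbb R^d)\}$ and, for every $R>0$ and every $\nu\in\mathcal P\big(\bigcup_{x\in\operatorname{supp}\mu}B(x,R)\big)$, $$\phi(\nu)-\phi(\mu)\ \ge\ \inf_{\gamma\in\Gamma_o(\mu,\nu)}\int\langle\xi(x),y-x\rangle\,d\gamma(x,y)+o_R(W_2(\mu,\nu)),$$ and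 the same holds with $(\phi,\xi)$ replaced by $(-\phi,-\xi)$. For vector-valued $\phi$, $D_\mu\phi$ is the matrix field whose rows are the gradients of the components. Let $v:[0,T]\times\mathcal P_c(\mathbb R^d)\times\mathbb R^d\to\mathbb R^d$ satisfy (CE): (i) $t\mapsto v(t,\mu,x)$ is measurable for all $(\mu,x)$, and there is a nonnegative $m\in L^1(0,T)$ such that for a.e. $t$ and all $(\mu,x)$, $|v(t,\mu,x)|\le m(t)\big(1+|x|+\int|y|\,d\mu(y)\big)$; and for every ball $B=B(0,R)$, $R>0$: (ii) there are nonnegative $l_B,L_B\in L^1(0,T)$ such that, for a.e. $t$, all $\mu,\nu\in\mathcal P(B)$ and all $x,y\in B$, $|v(t,\mu,x)-v(t,\mu,y)|\le l_B(t)|x-y|$ and $|v(t,\mu,x)-v(t,\nu,x)|\le L_B(t)W_1(\mu,\nu)$; (iii) for a.e. $t$ and all $\mu\in\mathcal P_c(\mathbb R^d)$, $x\mapsto v(t,\mu,x)$ is differentiable, and $(\mu,x)\in\mathcal P(B)\times B\mapsto D_xv(t,\mu,x)$ is continuous, with $W_1$ on $\mathcal P(B)$; (iv) for a.e. $t$ and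 all $x$, $\mu\mapsto v(t,\mu,x)$ is locally differentiable at every $\mu\in\mathcal P_c(\mathbb R^d)$, and $(\mu,x,y)\in\mathcal P(B)\times B\times B\mapsto D_\mu v(t,\mu,x)(y)$ is continuous, with $W_1$ on $\mathcal P(B)$. Let $r>0$ and $K=B(0,r)$. Then the following hold. (1) For all $\tau\in[0,T]$ and $\mu\in\mathcal P(K)$ there is a unique $\Phi_{(\tau,\cdot)}[\mu]\in C^0([0,T]\times K,\mathbb R^d)$ with $$\Phi_{(\tau,t)}[\mu](x)=x+\int_\tau^t v\big(s,\Phi_{(\tau,s)}[\mu]_\#\mu,\Phi_{(\tau,s)}[\mu](x)\big)\,ds\qquad((t,x)\in[0,T]\times K),$$ and $\Phi_{(\tau,t)}[\mu]$ is differentiable on $K$ for every $t\in[0,T]$. (2) For all $\tau\in[0,T]$, $\mu,\nu\in\mathcal P(K)$ and $\gamma\in\Gamma(\mu,\nu)$, writing $\mu(t)=\Phi_{(\tau,t)}[\mu]_\#\mu$, there is a unique $w_\gamma\in C^0([0,T]\times K,\mathbb R^d)$ solving (in integrated form) $w_\gamma(\tau,x)=0$ and $$\begin{aligned}\partial_t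 w_\gamma(t,x)&=D_xv\big(t,\mu(t),\Phi_{(\tau,t)}[\mu](x)\big)w_\gamma(t,x)\\&\quad+\int D_\mu v\big(t,\mu(t),\Phi_{(\tau,t)}[\mu](x)\big)\big(\Phi_{(\tau,t)}[\mu](y)\big)\Big(D_x\Phi_{(\tau,t)}[\mu](y)(z-y)+w_\gamma(t,y)\Big)\,d\gamma(y,z).\end{aligned}$$ Moreover $w_\gamma$ is the derivative of $\mu\mapsto\Phi_{(\tau,\cdot)}[\mu]$ at $\mu$ in the direction $\gamma$: with $\mu_h:=((1-h)\pi^1+h\pi^2)_\#\gamma$, where $\pi^1,\pi^2$ are the two coordinate projections, $\frac1h\big(\Phi_{(\tau,\cdot)}[\mu_h]-\Phi_{(\tau,\cdot)}[\mu]\big)\to w_\gamma$ uniformly on $[0,T]\times K$ as $h\to0^+$. (3) There is a constant $C_K>0$, independent of $\tau,\mu,\nu,\gamma$, with $\|w_\gamma\|_{C^0([0,T]\times K)}\le C_K\,W_{2,\gamma}(\mu,\nu)$. (4) $\Phi_{(\tau,t)}[\nu]=\Phi_{(\tau,t)}[\mu]+w_\gamma(t,\cdot)+o_K(W_{2,\gamma}(\mu,\nu))$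 uniformly on $K$, in the sense that for every $\varepsilon>0$ there is $\delta>0$ such that for all $\tau,t\in[0,T]$, $\mu,\nu\in\mathcal P(K)$ and $\gamma\in\Gamma(\mu,\nu)$ with $W_{2,\gamma}(\mu,\nu)\le\delta$, $$\sup_{x\in K}\big|\Phi_{(\tau,t)}[\nu](x)-\Phi_{(\tau,t)}[\mu](x)-w_\gamma(t,x)\big|\le\varepsilon\,W_{2,\gamma}(\mu,\nu).$$ -/

import Mathlib

open MeasureTheory Set Filter Topology

namespace NonlocalFlow

noncomputable section

/-- The Euclidean space `ℝ^d`. -/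
abbrev Space (d : ℕ) : Type := EuclideanSpace ℝ (Fin d)

variable {d : ℕ}

/-! ### Measures, transport plans and Wasserstein distances -/

/-- `𝒫(K)`: the Borel probability measures on `ℝ^d` that are concentrated on `K`. -/
def probOn (K : Set (Space d)) : Set (Measure (Space d)) :=
  {μ | IsProbabilityMeasure μ ∧ μ Kᶜ = 0}

/-- `𝒫_c(ℝ^d)`: the Borel probability measures with compact support. -/
def compactlySupported (d : ℕ) : Set (Measure (Space d)) :=
  {μ | IsProbabilityMeasure μ ∧ IsCompact μ.support}

/-- The first moment `∫ |x| dμ(x)`. -/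
def firstMoment (μ : Measure (Space d)) : ℝ := ∫ x, ‖x‖ ∂μ

/-- `Γ(μ,ν)`: the transport plans between `μ` and `ν`. -/
def plans (μ ν : Measure (Space d)) : Set (Measure (Space d × Space d)) :=
  {γ | IsProbabilityMeasure γ ∧ γ.map Prod.fst = μ ∧ γ.map Prod.snd = ν}

/-- `(∫ |x - y|^p dγ(x,y))^{1/p}`, as an extended nonnegative real. -/
def planECost (p : ℝ) (γ : Measure (Space d × Space d)) : ENNReal :=
  (∫⁻ z, ‖z.1 - z.2‖ₑ ^ p ∂γ) ^ (1 / p)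

/-- `W_{p,γ}(μ,ν) = (∫ |x - y|^p dγ(x,y))^{1/p}` for a plan `γ` between `μ` and `ν`. -/
def planCost (p : ℝ) (γ : Measure (Space d × Space d)) : ℝ := (planECost p γ).toReal

/-- The `p`-Wasserstein distance (finite on measures with finite `p`-th moment). -/
def wasserstein (p : ℝ) (μ ν : Measure (Space d)) : ℝ :=
  (⨅ γ ∈ plans μ ν, planECost p γ).toReal

/-- `Γ_o(μ,ν)`: the `p`-optimal transport plans. -/
def optimalPlans (p : ℝ) (μ ν : Measure (Space d)) : Set (Measure (Space d × Space d)) :=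
  {γ | γ ∈ plans μ ν ∧ ∀ γ' ∈ plans μ ν, planECost p γ ≤ planECost p γ'}

/-! ### Localised Wasserstein differentials on compactly supported measures -/

/-- The closed `R`-fattening of the support of `μ`. -/
def fattening (μ : Measure (Space d)) (R : ℝ) : Set (Space d) :=
  ⋃ x ∈ μ.support, Metric.closedBall x R

/-- The localised classical Fréchet subdifferential: `ξ ∈ L²(μ)` and, for every `R > 0`,
`φ(ν) - φ(μ) ≥ inf_{γ ∈ Γ_o(μ,ν)} ∫ ⟨ξ(x), y - x⟩ dγ(x,y) + o_R(W₂(μ,ν))`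
for `ν ∈ 𝒫(B_R(μ))`. -/
def IsSubgradient (φ : Measure (Space d) → ℝ) (μ : Measure (Space d))
    (ξ : Space d → Space d) : Prop :=
  MemLp ξ 2 μ ∧
  ∀ R > 0, ∀ ε > 0, ∃ δ > 0, ∀ ν ∈ probOn (fattening μ R), wasserstein 2 μ ν ≤ δ →
    sInf ((fun γ : Measure (Space d × Space d) => ∫ z, inner ℝ (ξ z.1) (z.2 - z.1) ∂γ) ''
        optimalPlans 2 μ ν) - ε * wasserstein 2 μ ν ≤ φ ν - φ μ

/-- The localised classical Fréchet superdifferential. -/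
def IsSupergradient (φ : Measure (Space d) → ℝ) (μ : Measure (Space d))
    (ξ : Space d → Space d) : Prop :=
  IsSubgradient (fun ν => -φ ν) μ (fun x => -ξ x)

/-- The analytical tangent space `Tan_μ 𝒫₂(ℝ^d)`: the closure in `L²(μ)` of the gradients of
smooth compactly supported functions. -/
def IsTangent (μ : Measure (Space d)) (ξ : Space d → Space d) : Prop :=
  MemLp ξ 2 μ ∧
  ∀ ε : ENNReal, 0 < ε → ∃ ψ : Space d → ℝ, ContDiff ℝ (⊤ : ℕ∞) ψ ∧ HasCompactSupport ψ ∧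
    eLpNorm (fun x => ξ x - gradient ψ x) 2 μ ≤ ε

/-- `ξ` is (a representative of) the Wasserstein gradient of `φ` at `μ`: the tangent field
that is both a localised sub- and supergradient. It is unique as an element of `L²(μ)`. -/
def IsWassersteinGradient (φ : Measure (Space d) → ℝ) (μ : Measure (Space d))
    (ξ : Space d → Space d) : Prop :=
  IsTangent μ ξ ∧ IsSubgradient φ μ ξ ∧ IsSupergradient φ μ ξ

/-- The `i`-th row of (the matrix of) a linear map `A`, that is, the vector representing
`h ↦ (A h)_i`. -/
def row (A : Space d →L[ℝ] Space d) (i : Fin d) : Space d :=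
  ContinuousLinearMap.adjoint A (EuclideanSpace.single i 1)

/-- `D` is the differential at `μ` of the vector-valued map `φ`: its rows are the Wasserstein
gradients of the components of `φ`. -/
def IsWassersteinDifferential (φ : Measure (Space d) → Space d) (μ : Measure (Space d))
    (D : Space d → Space d →L[ℝ] Space d) : Prop :=
  ∀ i : Fin d, IsWassersteinGradient (fun ν => φ ν i) μ (fun y => row (D y) i)

/-! ### Hypotheses on the non-local velocity field -/

/-- The standing hypotheses (CE) on a non-local velocity field `v(t, μ, x)`, `t ∈ [0,T]`, where
`Dv t μ x y` is `D_μ v(t, μ, x)(y)`. Continuity in the measure is with respect to `W₁`. -/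
structure HypCE (T : ℝ) (v : ℝ → Measure (Space d) → Space d → Space d)
    (Dv : ℝ → Measure (Space d) → Space d → Space d → Space d →L[ℝ] Space d) : Prop where
  measurable : ∀ μ ∈ compactlySupported d, ∀ x : Space d,
    AEStronglyMeasurable (fun t => v t μ x) (volume.restrict (Icc 0 T))
  sublinear : ∃ m : ℝ → ℝ, IntegrableOn m (Icc 0 T) ∧ (∀ t, 0 ≤ m t) ∧
    ∀ᵐ t ∂(volume.restrict (Icc 0 T)), ∀ μ ∈ compactlySupported d, ∀ x : Space d,
      ‖v t μ x‖ ≤ m t * (1 + ‖x‖ + firstMoment μ)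
  lipschitz : ∀ R > 0, ∃ l L : ℝ → ℝ, IntegrableOn l (Icc 0 T) ∧ (∀ t, 0 ≤ l t) ∧
    IntegrableOn L (Icc 0 T) ∧ (∀ t, 0 ≤ L t) ∧
    ∀ᵐ t ∂(volume.restrict (Icc 0 T)),
      ∀ μ ∈ probOn (Metric.closedBall (0 : Space d) R),
      ∀ ν ∈ probOn (Metric.closedBall (0 : Space d) R),
      ∀ x ∈ Metric.closedBall (0 : Space d) R, ∀ y ∈ Metric.closedBall (0 : Space d) R,
        ‖v t μ x - v t μ y‖ ≤ l t * ‖x - y‖ ∧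
        ‖v t μ x - v t ν x‖ ≤ L t * wasserstein 1 μ ν
  differentiable_space : ∀ᵐ t ∂(volume.restrict (Icc 0 T)),
    ∀ μ ∈ compactlySupported d, Differentiable ℝ (v t μ)
  continuous_space : ∀ R > 0, ∀ᵐ t ∂(volume.restrict (Icc 0 T)),
    ∀ μ ∈ probOn (Metric.closedBall (0 : Space d) R),
    ∀ x ∈ Metric.closedBall (0 : Space d) R,
    ∀ ε > 0, ∃ δ > 0, ∀ ν ∈ probOn (Metric.closedBall (0 : Space d) R),
      ∀ y ∈ Metric.closedBall (0 : Space d) R,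
      wasserstein 1 μ ν < δ → ‖y - x‖ < δ →
        ‖fderiv ℝ (v t ν) y - fderiv ℝ (v t μ) x‖ < ε
  differentiable_measure : ∀ᵐ t ∂(volume.restrict (Icc 0 T)),
    ∀ μ ∈ compactlySupported d, ∀ x : Space d,
      IsWassersteinDifferential (fun ν => v t ν x) μ (Dv t μ x)
  continuous_measure : ∀ R > 0, ∀ᵐ t ∂(volume.restrict (Icc 0 T)),
    ∀ μ ∈ probOn (Metric.closedBall (0 : Space d) R),
    ∀ x ∈ Metric.closedBall (0 : Space d) R, ∀ y ∈ Metric.closedBall (0 : Space d) R,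
    ∀ ε > 0, ∃ δ > 0, ∀ ν ∈ probOn (Metric.closedBall (0 : Space d) R),
      ∀ x' ∈ Metric.closedBall (0 : Space d) R, ∀ y' ∈ Metric.closedBall (0 : Space d) R,
      wasserstein 1 μ ν < δ → ‖x' - x‖ < δ → ‖y' - y‖ < δ →
        ‖Dv t ν x' y' - Dv t μ x y‖ < ε

/-! ### Non-local flows and their linearisation -/

/-- `Φ t x` is the non-local flow `Φ_{(τ,t)}[μ](x)` on `[0,T] × K`: it is continuous there and
solves `Φ(t,x) = x + ∫_τ^t v(s, Φ(s,·)_# μ, Φ(s,x)) ds`. -/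
structure IsNonlocalFlow (T : ℝ) (v : ℝ → Measure (Space d) → Space d → Space d)
    (K : Set (Space d)) (τ : ℝ) (μ : Measure (Space d)) (Φ : ℝ → Space d → Space d) : Prop where
  continuousOn : ContinuousOn (fun p : ℝ × Space d => Φ p.1 p.2) (Icc 0 T ×ˢ K)
  integrable : ∀ x ∈ K, IntervalIntegrable (fun s => v s (μ.map (Φ s)) (Φ s x)) volume 0 T
  eq_integral : ∀ t ∈ Icc 0 T, ∀ x ∈ K,
    Φ t x = x + ∫ s in τ..t, v s (μ.map (Φ s)) (Φ s x)

/-- The integrand of the non-local term of the linearised problem, as a function of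
`(y, z)`, with `μ(s) = Φ(s,·)_# μ`:
`D_μ v(s, μ(s), Φ(s,x))(Φ(s,y)) (D_x Φ(s,y)(z - y) + w(s,y))`. -/
def nonlocalIntegrand
    (Dv : ℝ → Measure (Space d) → Space d → Space d → Space d →L[ℝ] Space d)
    (K : Set (Space d)) (μ : Measure (Space d)) (Φ w : ℝ → Space d → Space d)
    (s : ℝ) (x : Space d) (p : Space d × Space d) : Space d :=
  Dv s (μ.map (Φ s)) (Φ s x) (Φ s p.1) (fderivWithin ℝ (Φ s) K p.1 (p.2 - p.1) + w s p.1)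

/-- The right-hand side of the linearised problem along the plan `γ`. -/
def linearisedRHS (v : ℝ → Measure (Space d) → Space d → Space d)
    (Dv : ℝ → Measure (Space d) → Space d → Space d → Space d →L[ℝ] Space d)
    (K : Set (Space d)) (μ : Measure (Space d)) (γ : Measure (Space d × Space d))
    (Φ w : ℝ → Space d → Space d) (s : ℝ) (x : Space d) : Space d :=
  fderiv ℝ (v s (μ.map (Φ s))) (Φ s x) (w s x) +
    ∫ p, nonlocalIntegrand Dv K μ Φ w s x p ∂γ

/-- `w ∈ C⁰([0,T] × K, ℝ^d)` is a (Carathéodory) solution of the linearised Cauchy problem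
`∂_t w(t,x) = linearisedRHS(t,x)`, `w(τ,x) = 0`, along the plan `γ`, where `Φ t = Φ_{(τ,t)}[μ]`. -/
structure IsLinearisedSolution (T : ℝ) (v : ℝ → Measure (Space d) → Space d → Space d)
    (Dv : ℝ → Measure (Space d) → Space d → Space d → Space d →L[ℝ] Space d)
    (K : Set (Space d)) (τ : ℝ) (μ : Measure (Space d)) (γ : Measure (Space d × Space d))
    (Φ w : ℝ → Space d → Space d) : Prop where
  continuousOn : ContinuousOn (fun p : ℝ × Space d => w p.1 p.2) (Icc 0 T ×ˢ K)
  integrable_plan : ∀ x ∈ K, ∀ᵐ s ∂(volume.restrict (Icc 0 T)),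
    Integrable (nonlocalIntegrand Dv K μ Φ w s x) γ
  integrable : ∀ x ∈ K, IntervalIntegrable (fun s => linearisedRHS v Dv K μ γ Φ w s x) volume 0 T
  eq_integral : ∀ t ∈ Icc 0 T, ∀ x ∈ K, w t x = ∫ s in τ..t, linearisedRHS v Dv K μ γ Φ w s x

/-- The measure `((1-h) π¹ + h π²)_# γ` at parameter `h` of the interpolation along `γ`. -/
def interpolate (γ : Measure (Space d × Space d)) (h : ℝ) : Measure (Space d) :=
  γ.map (fun p => (1 - h) • p.1 + h • p.2)

end

end NonlocalFlow

open NonlocalFlow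

namespace NonlocalFlow

variable {d : ℕ}

/-! ### Integral inequalities of Grönwall type with an integrable rate -/

/-! Every assertion is a stability statement for a Volterra equation whose rate is merely integrable
in time. For such a rate there is an exponential weight under which the Volterra operator halves
suprema, whatever the base point (`exists_isVolterraWeight`). This yields existence by contraction
(`exists_volterra_solution`) and a Grönwall bound with a constant independent of `τ` and of the
measures (`Frame.norm_le`). The flow itself is built from a truncated velocity, and the sublinear
growth bound shows afterwards that the truncation is never active (`HypCE.exists_flow`).

The infinitesimal core is a Taylor expansion of the velocity at a fixed time, uniform over all
measures on a ball and all couplings (`FrozenField.taylor`), whereas the hypothesis only speaks of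
optimal plans and a remainder depending on the base measure. The passage to arbitrary plans uses
tangency: the gradient of a test function acts on a plan through its marginals alone, up to a
quadratic error, so all plans give the same first order term up to `ε` times the larger cost
(`IsTangent.exists_approx`, `IsSubgradient.le_of_plan`). With plans written as pairs of random
vectors, the velocity becomes differentiable along segments `X + t (Y - X)`, and the mean value
inequality reduces a uniform remainder to uniform continuity of the differential. The latter is weak
compactness of the set of plans on a ball, once `W₁` is known to be weakly continuous there
(`eventually_exists_plan_lintegral_edist_le`, `uniform_of_wasserstein_continuous`).

For the flows, a plan between the two initial measures places both transported measures on one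
probability space (`FlowCoupling`). The error `Ψ - Φ - w` then solves a linear Volterra equation
with two sources: the Taylor remainder of the velocity, and the error of replacing `Ψ(z) - Ψ(y)` by
the space derivative of `Φ` applied to `z - y`. For almost every time the remainders are small
relative to the cost or to `|z - y|`; dominated convergence made uniform over all couplings
(`exists_integral_le_mul_of_dominated`) and Grönwall turn this into the uniform expansion
`Frame.norm_flow_expansion_le`. Directional differentiability is a special case: interpolating a
plan at parameter `h` multiplies both its cost and its linearised solution by `h`. -/

/-- `lam` is an exponential weight for which the Volterra operator with kernel `k` halves weighted
suprema, whatever the base point. -/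
def IsVolterraWeight (T : ℝ) (k : ℝ → ℝ) (lam : ℝ) : Prop :=
  0 ≤ lam ∧ ∀ τ ∈ Icc 0 T, ∀ t ∈ Icc 0 T,
    ∫ s in uIoc τ t, k s * Real.exp (lam * |s - τ|) ≤ Real.exp (lam * |t - τ|) / 2

lemma setIntegral_uIoc_exp_le {lam : ℝ} (hl : 0 < lam) (τ t : ℝ) :
    ∫ s in uIoc τ t, Real.exp (lam * |s - τ|) ≤ Real.exp (lam * |t - τ|) / lam := by
  rcases le_total τ t with h | h
  · rw [uIoc_of_le h, ← intervalIntegral.integral_of_le h]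
    have h1 : ∫ s in τ..t, Real.exp (lam * |s - τ|)
        = ∫ s in τ..t, Real.exp (lam * (s - τ)) := by
      refine intervalIntegral.integral_congr fun s hs => ?_
      rw [uIcc_of_le h] at hs
      rw [abs_of_nonneg (by linarith [hs.1])]
    have h2 : ∫ s in τ..t, Real.exp (lam * (s - τ))
        = Real.exp (lam * (t - τ)) / lam - Real.exp (lam * (τ - τ)) / lam := by
      refine intervalIntegral.integral_eq_sub_of_hasDerivAt
        (f := fun s => Real.exp (lam * (s - τ)) / lam) (fun s _ => ?_)
        (Continuous.intervalIntegrable (by fun_prop) _ _)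
      have := ((((hasDerivAt_id s).sub_const τ).const_mul lam).exp).div_const lam
      simpa [hl.ne'] using this
    rw [h1, h2, abs_of_nonneg (by linarith)]
    simp; positivity
  · rw [uIoc_of_ge h, ← intervalIntegral.integral_of_le h]
    have h1 : ∫ s in t..τ, Real.exp (lam * |s - τ|)
        = ∫ s in t..τ, Real.exp (lam * (τ - s)) := by
      refine intervalIntegral.integral_congr fun s hs => ?_
      rw [uIcc_of_le h] at hs
      rw [abs_of_nonpos (by linarith [hs.2]), neg_sub]
    have h2 : ∫ s in t..τ, Real.exp (lam * (τ - s))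
        = -Real.exp (lam * (τ - τ)) / lam - -Real.exp (lam * (τ - t)) / lam := by
      refine intervalIntegral.integral_eq_sub_of_hasDerivAt
        (f := fun s => -Real.exp (lam * (τ - s)) / lam) (fun s _ => ?_)
        (Continuous.intervalIntegrable (by fun_prop) _ _)
      have := ((((hasDerivAt_id s).const_sub τ).const_mul lam).exp).neg.div_const lam
      simpa [hl.ne'] using this
    rw [h1, h2, abs_of_nonpos (by linarith), neg_sub]
    have : 0 < 1 / lam := by positivity
    simp [neg_div]; positivity

lemma uIoc_subset_Icc_of_mem {a b τ t : ℝ} (hτ : τ ∈ Icc a b) (ht : t ∈ Icc a b) :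
    uIoc τ t ⊆ Icc a b :=
  uIoc_subset_uIcc.trans (uIcc_subset_Icc hτ ht)

/-- Split `k ≤ max (k - N) 0 + N`. The excess has integral below `1/4` once `N` is large, by
dominated convergence, and against the constant part the exponential contributes at most `N / lam`
times its value at the endpoint. -/
lemma exists_isVolterraWeight {T : ℝ} {k : ℝ → ℝ} (hk : IntegrableOn k (Icc 0 T)) :
    ∃ lam, IsVolterraWeight T k lam := by
  have hlim : Tendsto (fun n : ℕ => ∫ s in Icc 0 T, max (k s - n) 0) atTop (𝓝 (∫ _ in Icc 0 T, 0)) := by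
    refine tendsto_integral_of_dominated_convergence (fun s => ‖k s‖) (fun n => ?_) hk.norm
      (fun n => ?_) ?_
    · exact ((hk.sub (integrable_const _)).pos_part).aestronglyMeasurable
    · refine Eventually.of_forall fun s => ?_
      rw [Real.norm_of_nonneg (le_max_right _ _)]
      have : (0:ℝ) ≤ n := n.cast_nonneg
      exact max_le (by linarith [Real.le_norm_self (k s)]) (norm_nonneg _)
    · refine Eventually.of_forall fun s => ?_
      obtain ⟨N, hN⟩ := exists_nat_ge (k s)
      refine tendsto_const_nhds.congr' ?_
      filter_upwards [eventually_ge_atTop N] with n hn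
      have : (N:ℝ) ≤ n := by exact_mod_cast hn
      rw [max_eq_right (by linarith)]
  simp only [integral_zero] at hlim
  obtain ⟨N, hN⟩ := ((hlim.eventually (gt_mem_nhds (show (0:ℝ) < 1/4 by norm_num))).exists)
  -- The factor `4` gives `N / lam ≤ 1/4`, so the two parts add up to `1/2`; the `+ 1` keeps `lam`
  -- positive when `N = 0`.
  refine ⟨4 * (N + 1), by positivity, fun τ hτ t ht => ?_⟩
  set lam : ℝ := 4 * (N + 1) with hlam
  have hlpos : 0 < lam := by positivity
  have hsub := uIoc_subset_Icc_of_mem hτ ht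
  have hp : IntegrableOn (fun s => max (k s - N) 0) (Icc 0 T) :=
    (hk.sub (integrable_const _)).pos_part
  have hfin : IsFiniteMeasure (volume.restrict (uIoc τ t)) :=
    ⟨by rw [Measure.restrict_apply_univ]; exact (measure_mono hsub).trans_lt (by simp)⟩
  have hexp : IntegrableOn (fun s => Real.exp (lam * |s - τ|)) (uIoc τ t) :=
    (Continuous.integrableOn_Icc (f := fun s => Real.exp (lam * |s - τ|)) (a := 0) (b := T)
      (by fun_prop)).mono_set hsub
  have hle : ∀ s ∈ uIoc τ t, Real.exp (lam * |s - τ|) ≤ Real.exp (lam * |t - τ|) := by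
    intro s hs
    refine Real.exp_le_exp.2 (mul_le_mul_of_nonneg_left ?_ hlpos.le)
    rcases le_total τ t with h | h
    · rw [uIoc_of_le h] at hs
      rw [abs_of_nonneg (by linarith [hs.1]), abs_of_nonneg (by linarith)]
      linarith [hs.2]
    · rw [uIoc_of_ge h] at hs
      rw [abs_of_nonpos (by linarith [hs.2]), abs_of_nonpos (by linarith)]
      linarith [hs.1]
  calc ∫ s in uIoc τ t, k s * Real.exp (lam * |s - τ|)
      ≤ ∫ s in uIoc τ t, (max (k s - N) 0 * Real.exp (lam * |t - τ|)
          + N * Real.exp (lam * |s - τ|)) := by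
        refine setIntegral_mono_on ?_ ?_ measurableSet_uIoc fun s hs => ?_
        · exact (hk.mul_continuousOn (g' := fun s => Real.exp (lam * |s - τ|)) (by fun_prop)
            isCompact_Icc).mono_set hsub
        · exact ((hp.mono_set hsub).mul_const _).add (hexp.const_mul _)
        · have h1 : k s ≤ max (k s - N) 0 + N := by linarith [le_max_left (k s - N) 0]
          calc k s * Real.exp (lam * |s - τ|)
              ≤ (max (k s - N) 0 + N) * Real.exp (lam * |s - τ|) := by gcongr
            _ = max (k s - N) 0 * Real.exp (lam * |s - τ|) + N * Real.exp (lam * |s - τ|) := by ring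
            _ ≤ _ := by gcongr ?_ * ?_ + _; exacts [hle s hs]
    _ = (∫ s in uIoc τ t, max (k s - N) 0) * Real.exp (lam * |t - τ|)
          + N * ∫ s in uIoc τ t, Real.exp (lam * |s - τ|) := by
        rw [integral_add ((hp.mono_set hsub).mul_const _) (hexp.const_mul _), integral_mul_const,
          integral_const_mul]
    _ ≤ 1/4 * Real.exp (lam * |t - τ|) + N * (Real.exp (lam * |t - τ|) / lam) := by
        gcongr
        · refine le_trans ?_ hN.le
          exact setIntegral_mono_set hp (Eventually.of_forall fun s => le_max_right _ _)
            hsub.eventuallyLE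
        · exact setIntegral_uIoc_exp_le hlpos τ t
    _ ≤ Real.exp (lam * |t - τ|) / 2 := by
        have h1 : (N:ℝ) / lam ≤ 1/4 := by
          rw [div_le_iff₀ hlpos, hlam]; linarith
        have h2 : (N:ℝ) * (Real.exp (lam * |t - τ|) / lam) = N / lam * Real.exp (lam * |t - τ|) := by
          ring
        rw [h2]
        nlinarith [Real.exp_pos (lam * |t - τ|)]

/-! ### Volterra equations with an integrable rate: Grönwall bound and existence. -/

section Volterra

variable {E : Type*} [NormedAddCommGroup E] [NormedSpace ℝ E] {T : ℝ} {k : ℝ → ℝ} {lam τ : ℝ}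

lemma integrableOn_mul_exp (hk : IntegrableOn k (Icc 0 T)) :
    IntegrableOn (fun s => k s * Real.exp (lam * |s - τ|)) (Icc 0 T) :=
  hk.mul_continuousOn (g' := fun s => Real.exp (lam * |s - τ|)) (by fun_prop) isCompact_Icc

/-- The part of the integrand governed by `k` returns half of the weighted bound `M`, by the choice
of `lam`; the source `f`, being nonnegative, is simply integrated over the whole interval. -/
lemma IsVolterraWeight.norm_integral_le (hw : IsVolterraWeight T k lam)
    (hk : IntegrableOn k (Icc 0 T)) (hτ : τ ∈ Icc 0 T) {t : ℝ} (ht : t ∈ Icc 0 T) {G : ℝ → E}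
    {f : ℝ → ℝ} (hf : IntegrableOn f (Icc 0 T)) (hf0 : ∀ s, 0 ≤ f s) {M : ℝ} (hM : 0 ≤ M)
    (hG : ∀ᵐ s ∂(volume.restrict (Icc 0 T)),
      ‖G s‖ ≤ k s * (M * Real.exp (lam * |s - τ|)) + f s) :
    ‖∫ s in τ..t, G s‖ ≤ M / 2 * Real.exp (lam * |t - τ|) + ∫ s in Icc 0 T, f s := by
  have hsub := uIoc_subset_Icc_of_mem hτ ht
  have hke : IntegrableOn (fun s => M * (k s * Real.exp (lam * |s - τ|))) (uIoc τ t) :=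
    IntegrableOn.mono_set (Integrable.const_mul (integrableOn_mul_exp hk) M) hsub
  rw [intervalIntegral.norm_intervalIntegral_eq]
  calc ‖∫ s in uIoc τ t, G s‖
      ≤ ∫ s in uIoc τ t, (M * (k s * Real.exp (lam * |s - τ|)) + f s) := by
        refine norm_integral_le_of_norm_le (hke.add (hf.mono_set hsub)) ?_
        filter_upwards [ae_restrict_of_ae_restrict_of_subset hsub hG] with s hs
        linarith
    _ = M * (∫ s in uIoc τ t, k s * Real.exp (lam * |s - τ|)) + ∫ s in uIoc τ t, f s := by
        rw [integral_add hke (hf.mono_set hsub), integral_const_mul]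
    _ ≤ M * (Real.exp (lam * |t - τ|) / 2) + ∫ s in Icc 0 T, f s := by
        gcongr
        · exact hw.2 τ hτ t ht
        · exact Eventually.of_forall hf0
    _ = _ := by ring

/-- A Grönwall inequality for families of solutions of Volterra equations. -/
theorem IsVolterraWeight.norm_le (hw : IsVolterraWeight T k lam) {Q : Type*}
    (hk : IntegrableOn k (Icc 0 T)) (hτ : τ ∈ Icc 0 T) {e : ℝ → Q → E} {c : Q → E} {F : ℝ → Q → E}
    {f : Q → ℝ → ℝ} {A : ℝ} (hbdd : ∃ M, ∀ t ∈ Icc 0 T, ∀ q, ‖e t q‖ ≤ M)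
    (heq : ∀ t ∈ Icc 0 T, ∀ q, e t q = c q + ∫ s in τ..t, F s q)
    (hf : ∀ q, IntegrableOn (f q) (Icc 0 T)) (hf0 : ∀ q s, 0 ≤ f q s)
    (hA : ∀ q, ‖c q‖ + ∫ s in Icc 0 T, f q s ≤ A)
    (hF : ∀ q, ∀ᵐ s ∂(volume.restrict (Icc 0 T)), ∀ N, (∀ q', ‖e s q'‖ ≤ N) →
      ‖F s q‖ ≤ k s * N + f q s) :
    ∀ t ∈ Icc 0 T, ∀ q, ‖e t q‖ ≤ 2 * A * Real.exp (lam * |t - τ|) := by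
  intro t ht q
  have hA0 : 0 ≤ A :=
    le_trans (add_nonneg (norm_nonneg _) (integral_nonneg (hf0 q))) (hA q)
  have one_le (t : ℝ) : 1 ≤ Real.exp (lam * |t - τ|) :=
    Real.one_le_exp (mul_nonneg hw.1 (abs_nonneg _))
  -- The equation improves a weighted bound `M` to `A + M / 2`, because the weight is at least `1`
  -- and absorbs `A`. Iterating from any finite bound converges to the fixed point `2 * A`.
  have step : ∀ M, 0 ≤ M → (∀ t ∈ Icc 0 T, ∀ q, ‖e t q‖ ≤ M * Real.exp (lam * |t - τ|)) →
      ∀ t ∈ Icc 0 T, ∀ q, ‖e t q‖ ≤ (A + M / 2) * Real.exp (lam * |t - τ|) := by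
    intro M hM he t ht q
    rw [heq t ht q]
    have h1 := hw.norm_integral_le (G := fun s => F s q) hk hτ ht (hf q) (hf0 q) hM (by
      filter_upwards [hF q, ae_restrict_mem measurableSet_Icc] with s hs hsT
      exact hs _ (he s hsT))
    calc ‖c q + ∫ s in τ..t, F s q‖ ≤ ‖c q‖ + ‖∫ s in τ..t, F s q‖ := norm_add_le _ _
      _ ≤ A * 1 + M / 2 * Real.exp (lam * |t - τ|) := by linarith [hA q]
      _ ≤ A * Real.exp (lam * |t - τ|) + M / 2 * Real.exp (lam * |t - τ|) := by
        gcongr; exact one_le t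
      _ = _ := by ring
  obtain ⟨M, hM⟩ := hbdd
  have hM0 : 0 ≤ M := (norm_nonneg _).trans (hM t ht q)
  have key : ∀ n : ℕ, ∀ t ∈ Icc 0 T, ∀ q,
      ‖e t q‖ ≤ (2 * A + M / 2 ^ n) * Real.exp (lam * |t - τ|) := by
    intro n
    induction n with
    | zero =>
      intro t ht q
      refine (hM t ht q).trans ?_
      have := one_le t
      simp only [pow_zero, div_one]
      nlinarith
    | succ n ih =>
      intro t ht q
      convert step _ (by positivity) ih t ht q using 2
      field_simp
      ring
  have hlim : Tendsto (fun n : ℕ => (2 * A + M / 2 ^ n) * Real.exp (lam * |t - τ|)) atTop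
      (𝓝 ((2 * A + 0) * Real.exp (lam * |t - τ|))) := by
    refine (tendsto_const_nhds.add ?_).mul_const _
    refine tendsto_const_nhds.div_atTop (tendsto_pow_atTop_atTop_of_one_lt (by norm_num))
  rw [add_zero] at hlim
  exact ge_of_tendsto' hlim fun n => key n t ht q

variable {Q : Type*} [TopologicalSpace Q] [CompactSpace Q] [FirstCountableTopology Q]

/-- Existence for Volterra equations whose integrand depends on a time slice of the unknown and is
Lipschitz in it, at an integrable rate. -/
theorem exists_volterra_solution [CompleteSpace E] (hτ : τ ∈ Icc 0 T) (c : C(Q, E))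
    (F : ℝ → C(Q, E) → Q → E) {g : ℝ → ℝ} (hk : IntegrableOn k (Icc 0 T))
    (hg : IntegrableOn g (Icc 0 T))
    (hlip : ∀ᵐ s ∂(volume.restrict (Icc 0 T)), ∀ u w q, ‖F s u q - F s w q‖ ≤ k s * ‖u - w‖)
    (hbd : ∀ᵐ s ∂(volume.restrict (Icc 0 T)), ∀ u q, ‖F s u q‖ ≤ g s * (1 + ‖u‖))
    (hcont : ∀ᵐ s ∂(volume.restrict (Icc 0 T)), ∀ u, Continuous (F s u))
    (hmeas : ∀ u : ℝ → C(Q, E), Continuous u → ∀ q,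
      AEStronglyMeasurable (fun s => F s (u s) q) (volume.restrict (Icc 0 T))) :
    ∃ u : ℝ → C(Q, E), Continuous u ∧ (∀ q, IntegrableOn (fun s => F s (u s) q) (Icc 0 T)) ∧
      ∀ t ∈ Icc 0 T, ∀ q, u t q = c q + ∫ s in τ..t, F s (u s) q := by
  have hT : 0 ≤ T := hτ.1.trans hτ.2
  have hgu (u : ℝ → C(Q, E)) (hu : Continuous u) :
      IntegrableOn (fun s => g s * (1 + ‖u s‖)) (Icc 0 T) :=
    hg.mul_continuousOn (by fun_prop) isCompact_Icc
  have hint (u : ℝ → C(Q, E)) (hu : Continuous u) (q : Q) :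
      IntegrableOn (fun s => F s (u s) q) (Icc 0 T) :=
    (hgu u hu).mono' (hmeas u hu q) (hbd.mono fun s hs => hs _ _)
  have hint' (u : ℝ → C(Q, E)) (hu : Continuous u) (q : Q) {a b : ℝ} (ha : a ∈ Icc 0 T)
      (hb : b ∈ Icc 0 T) : IntervalIntegrable (fun s => F s (u s) q) volume a b :=
    intervalIntegrable_iff.2 ((hint u hu q).mono_set (uIoc_subset_Icc_of_mem ha hb))
  -- the Volterra operator on continuous curves
  have hVcont (u : ℝ → C(Q, E)) (hu : Continuous u) (t : ℝ) (ht : t ∈ Icc 0 T) :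
      Continuous (fun q => c q + ∫ s in τ..t, F s (u s) q) := by
    refine c.continuous.add ?_
    have hsub := uIoc_subset_Icc_of_mem hτ ht
    refine intervalIntegral.continuous_of_dominated_interval
      (bound := fun s => g s * (1 + ‖u s‖))
      (fun q => (hmeas u hu q).mono_measure (Measure.restrict_mono hsub le_rfl))
      (fun q => ?_) (intervalIntegrable_iff.2 ((hgu u hu).mono_set hsub)) ?_
    · rw [← ae_restrict_iff' measurableSet_uIoc]
      exact ae_restrict_of_ae_restrict_of_subset hsub (hbd.mono fun s hs => hs _ _)
    · rw [← ae_restrict_iff' measurableSet_uIoc]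
      exact ae_restrict_of_ae_restrict_of_subset hsub (hcont.mono fun s hs => hs _)
  let V (u : ℝ → C(Q, E)) (hu : Continuous u) (t : Icc (0:ℝ) T) : C(Q, E) :=
    ⟨fun q => c q + ∫ s in τ..t, F s (u s) q, hVcont u hu t t.2⟩
  -- Continuity in time for the sup norm: time increments are bounded, uniformly in `q`, by those of
  -- the primitive of `g s * (1 + ‖u s‖)`.
  have hVc (u : ℝ → C(Q, E)) (hu : Continuous u) : Continuous (V u hu) := by
    have hprim : Continuous fun t : Icc (0:ℝ) T => ∫ s in (0:ℝ)..t, g s * (1 + ‖u s‖) :=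
      continuousOn_iff_continuous_domRestrict.1
        (intervalIntegral.continuousOn_primitive_interval' (b₁ := 0) (b₂ := T) (a := 0)
          (intervalIntegrable_iff.2 ((hgu u hu).mono_set
            (uIoc_subset_Icc_of_mem ⟨le_rfl, hT⟩ ⟨hT, le_rfl⟩))) (by simp) |>.mono
            (by rw [uIcc_of_le hT]))
    rw [continuous_iff_continuousAt]
    intro t0
    have hz : Tendsto (fun t : Icc (0:ℝ) T => |(∫ s in (0:ℝ)..t, g s * (1 + ‖u s‖))
        - ∫ s in (0:ℝ)..t0, g s * (1 + ‖u s‖)|) (𝓝 t0) (𝓝 0) := by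
      have := ((hprim.sub continuous_const).abs (f := fun t : Icc (0:ℝ) T => (∫ s in (0:ℝ)..t, g s * (1 + ‖u s‖))
        - ∫ s in (0:ℝ)..t0, g s * (1 + ‖u s‖))).tendsto t0
      simpa using this
    rw [ContinuousAt, tendsto_iff_norm_sub_tendsto_zero]
    refine squeeze_zero (fun _ => norm_nonneg _) (fun t => ?_) hz
    have h0 : (0:ℝ) ∈ Icc 0 T := ⟨le_rfl, hT⟩
    have hgi {a b : ℝ} (ha : a ∈ Icc 0 T) (hb : b ∈ Icc 0 T) :
        IntervalIntegrable (fun s => g s * (1 + ‖u s‖)) volume a b :=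
      intervalIntegrable_iff.2 ((hgu u hu).mono_set (uIoc_subset_Icc_of_mem ha hb))
    rw [ContinuousMap.norm_le _ (abs_nonneg _)]
    intro q
    have h1 : (V u hu t - V u hu t0) q = ∫ s in (t0:ℝ)..t, F s (u s) q := by
      simp only [V, ContinuousMap.sub_apply, ContinuousMap.coe_mk, add_sub_add_left_eq_sub]
      exact intervalIntegral.integral_interval_sub_left (hint' u hu q hτ t.2) (hint' u hu q hτ t0.2)
    rw [h1, intervalIntegral.integral_interval_sub_left (hgi h0 t.2) (hgi h0 t0.2)]
    refine intervalIntegral.norm_integral_le_abs_of_norm_le ?_ (hgi t0.2 t.2)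
    exact ae_restrict_of_ae_restrict_of_subset (uIoc_subset_Icc_of_mem t0.2 t.2)
      (hbd.mono fun s hs => hs _ _)
  obtain ⟨lam, hw⟩ := exists_isVolterraWeight hk
  -- the operator conjugated by the exponential weight
  let ext (u : C(Icc (0:ℝ) T, C(Q, E))) (s : ℝ) : C(Q, E) :=
    Real.exp (lam * |s - τ|) • u (projIcc 0 T hT s)
  have hext (u) : Continuous (ext u) := by
    have := u.continuous.comp (continuous_projIcc (h := hT))
    exact Continuous.smul (f := fun s : ℝ => Real.exp (lam * |s - τ|)) (by fun_prop) this
  let S (u : C(Icc (0:ℝ) T, C(Q, E))) : C(Icc (0:ℝ) T, C(Q, E)) :=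
    ⟨fun t => Real.exp (-(lam * |(t:ℝ) - τ|)) • V (ext u) (hext u) t,
      Continuous.smul (f := fun t : Icc (0:ℝ) T => Real.exp (-(lam * |(t:ℝ) - τ|))) (by fun_prop)
        (hVc (ext u) (hext u))⟩
  have hS : ContractingWith (1/2) S := by
    refine ⟨by norm_num, LipschitzWith.of_dist_le_mul fun u w => ?_⟩
    rw [dist_eq_norm, dist_eq_norm]
    rw [ContinuousMap.norm_le _ (by positivity)]
    intro t
    rw [ContinuousMap.norm_le _ (by positivity)]
    intro q
    have h1 : (S u - S w) t q = Real.exp (-(lam * |(t:ℝ) - τ|)) •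
        ∫ s in τ..t, (F s (ext u s) q - F s (ext w s) q) := by
      rw [intervalIntegral.integral_sub (hint' _ (hext u) q hτ t.2) (hint' _ (hext w) q hτ t.2)]
      simp [S, V, ← smul_sub]
    have h2 := hw.norm_integral_le (G := fun s => F s (ext u s) q - F s (ext w s) q) hk hτ t.2
      (f := fun _ => 0) (integrable_zero _ _ _) (fun _ => le_rfl) (norm_nonneg (u - w)) (by
        filter_upwards [hlip, ae_restrict_mem measurableSet_Icc] with s hs hsT
        refine (hs _ _ q).trans ?_
        rw [add_zero]
        by_cases hks : 0 ≤ k s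
        · refine mul_le_mul_of_nonneg_left ?_ hks
          simp only [ext, ← smul_sub, norm_smul, Real.norm_eq_abs, Real.abs_exp]
          rw [mul_comm]
          gcongr
          exact (u - w).norm_coe_le_norm _
        -- The rate is not assumed nonnegative. Where `k s < 0` the Lipschitz bound forces all
        -- elements of `C(Q, E)` to coincide, and the estimate is trivial.
        · have hz : ∀ u w, ‖F s u q - F s w q‖ ≤ 0 ∧ ‖u - w‖ = 0 := fun u w => by
            have := hs u w q
            have h3 : ‖u - w‖ = 0 := by
              by_contra hne
              have hpos : 0 < ‖u - w‖ := lt_of_le_of_ne (norm_nonneg _) (Ne.symm hne)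
              nlinarith [norm_nonneg (F s u q - F s w q)]
            exact ⟨by simpa [h3] using this, h3⟩
          have h4 : ‖u - w‖ = 0 := by
            refine le_antisymm ?_ (norm_nonneg _)
            rw [ContinuousMap.norm_le _ le_rfl]
            intro t'
            exact (hz (u t') (w t')).2.le
          simp [h4, (hz (ext u s) (ext w s)).2])
    rw [h1, norm_smul, Real.norm_eq_abs, Real.abs_exp]
    simp only [integral_zero, add_zero] at h2
    calc Real.exp (-(lam * |(t:ℝ) - τ|)) * ‖∫ s in τ..t, (F s (ext u s) q - F s (ext w s) q)‖
        ≤ Real.exp (-(lam * |(t:ℝ) - τ|)) * (‖u - w‖ / 2 * Real.exp (lam * |(t:ℝ) - τ|)) := by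
          gcongr
      _ = ‖u - w‖ / 2 * (Real.exp (-(lam * |(t:ℝ) - τ|)) * Real.exp (lam * |(t:ℝ) - τ|)) := by ring
      _ = _ := by rw [← Real.exp_add]; simp; ring
  obtain ⟨u, hu, -⟩ := hS.exists_fixedPoint 0 (by simp)
  refine ⟨ext u, hext u, hint _ (hext u), fun t ht q => ?_⟩
  have h1 : u ⟨t, ht⟩ = Real.exp (-(lam * |t - τ|)) • V (ext u) (hext u) ⟨t, ht⟩ := by
    conv_lhs => rw [← hu]
    rfl
  have h2 : ext u t = V (ext u) (hext u) ⟨t, ht⟩ := by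
    have : ext u t = Real.exp (lam * |t - τ|) • u ⟨t, ht⟩ := by
      simp only [ext, projIcc_of_mem hT ht]
    rw [this, h1, smul_smul, ← Real.exp_add]
    simp
  rw [h2]
  rfl

end Volterra

/-- Dominated convergence, uniformly over a family of parameters. -/
theorem exists_integral_le_of_dominated {α P : Type*} [MeasurableSpace α] {m : Measure α}
    (size : P → ℝ) (f : P → α → ℝ) {g : α → ℝ} (hg : Integrable g m)
    (hf : ∀ p, AEStronglyMeasurable (f p) m) (hfg : ∀ p, ∀ᵐ s ∂m, |f p s| ≤ g s)
    (hlim : ∀ᵐ s ∂m, ∀ ε > 0, ∃ δ > 0, ∀ p, size p ≤ δ → |f p s| ≤ ε) :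
    ∀ ε > 0, ∃ δ > 0, ∀ p, size p ≤ δ → ∫ s, |f p s| ∂m ≤ ε := by
  intro ε hε
  -- If uniformity failed for `ε`, there would be parameters of size tending to zero with integrals
  -- above `ε`; ordinary dominated convergence along that sequence is the contradiction. No
  -- structure on `P` is needed.
  by_contra! hcon
  choose p hp hpε using fun n : ℕ => hcon (1 / ((n : ℝ) + 1)) (by positivity)
  have hlim0 : Tendsto (fun n => ∫ s, |f (p n) s| ∂m) atTop (𝓝 (∫ _, (0 : ℝ) ∂m)) := by
    refine tendsto_integral_of_dominated_convergence g (fun n => (hf (p n)).norm) hg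
      (fun n => by simpa using hfg (p n)) ?_
    filter_upwards [hlim] with s hs
    rw [Metric.tendsto_atTop]
    intro η hη
    obtain ⟨δ, hδ, h⟩ := hs (η / 2) (by positivity)
    obtain ⟨N, hN⟩ := exists_nat_one_div_lt hδ
    refine ⟨N, fun n hn => ?_⟩
    have h1 : 1 / ((n : ℝ) + 1) ≤ 1 / ((N : ℝ) + 1) := by gcongr
    have := h (p n) ((hp n).trans (h1.trans hN.le))
    rw [Real.dist_eq, sub_zero, abs_abs]
    linarith
  rw [integral_zero] at hlim0
  obtain ⟨n, hn⟩ := (hlim0.eventually (gt_mem_nhds hε)).exists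
  exact absurd hn (not_lt.2 (hpε n).le)

/-! ### Weak convergence on a compact metric space and transport plans -/

section WeakTopology

variable {X : Type*} [MetricSpace X] [CompactSpace X]

/-- Normalised bumps `(ε - dist x a)₊` centred on a finite `ε`-net; the normalising sum is positive
because the balls cover. -/
lemma exists_partition_subordinate_balls {ε : ℝ} (hε : 0 < ε) :
    ∃ (t : Finset X) (χ : X → C(X, NNReal)), (∀ x, ∑ a ∈ t, χ a x = 1) ∧
      ∀ a x, χ a x ≠ 0 → dist x a < ε := by
  obtain ⟨t, -, htf, ht⟩ := finite_cover_balls_of_compact (isCompact_univ (X := X)) hε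
  have hpos (x : X) : ∑ a ∈ htf.toFinset, Real.toNNReal (ε - dist x a) ≠ 0 := by
    obtain ⟨a, hat, hxa⟩ := mem_iUnion₂.1 (ht (mem_univ x))
    have : 0 < Real.toNNReal (ε - dist x a) := by
      simpa using Metric.mem_ball.1 hxa
    refine (lt_of_lt_of_le this ?_).ne'
    exact Finset.single_le_sum (f := fun a => Real.toNNReal (ε - dist x a))
      (fun _ _ => zero_le) (by simpa using hat)
  refine ⟨htf.toFinset, fun a => ⟨fun x => Real.toNNReal (ε - dist x a) /
    ∑ b ∈ htf.toFinset, Real.toNNReal (ε - dist x b), ?_⟩, fun x => ?_, fun a x hax => ?_⟩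
  · refine Continuous.div₀ (by fun_prop) ?_ hpos
    exact continuous_finsetSum _ fun b _ => by fun_prop
  · simp only [ContinuousMap.coe_mk]
    rw [← Finset.sum_div, div_self (hpos x)]
  · by_contra hcon
    apply hax
    simp only [ContinuousMap.coe_mk, div_eq_zero_iff]
    left
    rw [Real.toNNReal_eq_zero]
    linarith

variable [MeasurableSpace X] [BorelSpace X]

/-- Probability measures which are weakly close to `μ₀` are coupled to it at a small cost. -/
theorem eventually_exists_plan_lintegral_edist_le (μ₀ : ProbabilityMeasure X) {ε : ENNReal}
    (hε : 0 < ε) (hε' : ε ≠ ⊤) :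
    ∀ᶠ μ : ProbabilityMeasure X in 𝓝 μ₀, ∃ γ : Measure (X × X), γ.map Prod.fst = μ₀ ∧
      γ.map Prod.snd = μ ∧ ∫⁻ z, edist z.1 z.2 ∂γ ≤ ε := by
  classical
  set D : ENNReal := Metric.ediam (univ : Set X) with hD
  have hDtop : D ≠ ⊤ := isCompact_univ.isBounded.ediam_ne_top
  obtain ⟨t, χ, hsum, hχ⟩ := exists_partition_subordinate_balls (X := X) (ε := ε.toReal / 4)
    (by have := ENNReal.toReal_pos hε.ne' hε'; positivity)
  have hε4 : ENNReal.ofReal (ε.toReal / 4) = ε / 4 := by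
    rw [ENNReal.ofReal_div_of_pos (by norm_num), ENNReal.ofReal_toReal hε']; norm_num
  have hsum' (x : X) : ∑ a ∈ t, (χ a x : ENNReal) = 1 := by exact_mod_cast hsum x
  have hmχ (a : X) : Measurable fun x => (χ a x : ENNReal) :=
    (χ a).continuous.measurable.coe_nnreal_ennreal
  -- a fraction `c < 1` close to `1`
  obtain ⟨c, hc0, hc1, hcD⟩ : ∃ c : ENNReal, 0 < c ∧ c < 1 ∧ D * (1 - c) ≤ ε / 2 := by
    have hlim : Tendsto (fun c : ENNReal => D * (1 - c)) (𝓝[<] 1) (𝓝 (D * (1 - 1))) :=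
      ENNReal.Tendsto.const_mul (((ENNReal.continuous_sub_left ENNReal.one_ne_top).tendsto 1).mono_left
        nhdsWithin_le_nhds) (Or.inr hDtop)
    rw [tsub_self, mul_zero] at hlim
    have h1 := hlim.eventually (ge_mem_nhds (ENNReal.half_pos hε.ne'))
    have h2 : ∀ᶠ c : ENNReal in 𝓝[<] 1, 0 < c :=
      nhdsWithin_le_nhds (lt_mem_nhds (by norm_num))
    have : (𝓝[<] (1 : ENNReal)).NeBot := nhdsLT_neBot_of_exists_lt ⟨0, by norm_num⟩
    obtain ⟨c, h3, h4, h5⟩ := (h1.and (h2.and self_mem_nhdsWithin)).exists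
    exact ⟨c, h4, h5, h3⟩
  set p : X → ENNReal := fun a => ∫⁻ x, χ a x ∂(μ₀ : Measure X) with hp
  have hple (μ : ProbabilityMeasure X) (a : X) (ha : a ∈ t) : ∫⁻ x, χ a x ∂(μ : Measure X) ≤ 1 := by
    calc ∫⁻ x, χ a x ∂(μ : Measure X) ≤ ∫⁻ _, 1 ∂(μ : Measure X) := by
          refine lintegral_mono fun x => ?_
          rw [← hsum' x]
          exact Finset.single_le_sum (f := fun a => (χ a x : ENNReal)) (fun _ _ => zero_le) ha
      _ = 1 := by simp
  -- Only finitely many cell masses are involved, each of them weakly continuous, and strict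
  -- inequality is an open condition. It guarantees that `μ` has enough mass in each cell to receive
  -- the fraction `c` of the mass of `μ₀`.
  have hev : ∀ᶠ μ : ProbabilityMeasure X in 𝓝 μ₀,
      ∀ a ∈ t, p a ≠ 0 → c * p a < ∫⁻ x, χ a x ∂(μ : Measure X) := by
    rw [Filter.eventually_all_finset]
    intro a ha
    by_cases h0 : p a = 0
    · exact Eventually.of_forall fun μ h => absurd h0 h
    · have hcont := (ProbabilityMeasure.continuous_lintegral_continuousMap (χ a)).tendsto μ₀
      have hlt : c * p a < p a := by
        calc c * p a < 1 * p a :=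
              ENNReal.mul_lt_mul_left h0 ((hple μ₀ a ha).trans_lt ENNReal.one_lt_top).ne hc1
          _ = p a := one_mul _
      filter_upwards [hcont.eventually (lt_mem_nhds hlt)] with μ hμ _ using hμ
  filter_upwards [hev] with μ hμ
  set q : X → ENNReal := fun a => ∫⁻ x, χ a x ∂(μ : Measure X) with hq
  -- Cells without `μ₀`-mass are dropped: the strict inequality is not available there, hence
  -- neither is `q a ≠ 0`, which the division by `q a` requires.
  set t' : Finset X := t.filter fun a => p a ≠ 0 with ht'
  have ht't {a : X} (ha : a ∈ t') : a ∈ t ∧ p a ≠ 0 := by simpa [ht'] using ha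
  have hq0 {a : X} (ha : a ∈ t') : q a ≠ 0 :=
    (lt_of_le_of_lt zero_le (hμ a (ht't ha).1 (ht't ha).2)).ne'
  have hqt {a : X} (ha : a ∈ t') : q a ≠ ⊤ :=
    ((hple μ a (ht't ha).1).trans_lt ENNReal.one_lt_top).ne
  have hcpq {a : X} (ha : a ∈ t') : c / q a * p a ≤ 1 := by
    rw [mul_comm, ← mul_div_assoc, mul_comm]
    exact ENNReal.div_le_of_le_mul (by rw [one_mul]; exact (hμ a (ht't ha).1 (ht't ha).2).le)
  -- the part of `μ` that is not matched cell by cell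
  set b : X → ENNReal := fun y => ∑ a ∈ t', c / q a * p a * χ a y with hb
  have hb1 (y : X) : b y ≤ 1 := by
    calc b y ≤ ∑ a ∈ t', 1 * (χ a y : ENNReal) := by
          refine Finset.sum_le_sum fun a ha => ?_
          gcongr
          exact hcpq ha
      _ ≤ ∑ a ∈ t, (χ a y : ENNReal) := by
          simp only [one_mul]
          exact Finset.sum_le_sum_of_subset (Finset.filter_subset _ _)
      _ = 1 := hsum' y
  have hmb : Measurable b := Finset.measurable_sum _ fun a _ => (hmχ a).const_mul _
  have hsump : ∑ a ∈ t', p a = 1 := by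
    rw [ht', Finset.sum_filter_ne_zero, hp, ← lintegral_finsetSum _ fun a _ => hmχ a]
    simp [hsum']
  have hbint : ∫⁻ y, b y ∂(μ : Measure X) = c := by
    rw [hb, lintegral_finsetSum _ fun a _ => (hmχ a).const_mul _]
    calc ∑ a ∈ t', ∫⁻ y, c / q a * p a * χ a y ∂(μ : Measure X) = ∑ a ∈ t', c * p a := by
          refine Finset.sum_congr rfl fun a ha => ?_
          rw [lintegral_const_mul _ (hmχ a), mul_right_comm]
          change c / q a * q a * p a = _
          rw [ENNReal.div_mul_cancel (hq0 ha) (hqt ha)]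
      _ = c := by rw [← Finset.mul_sum, hsump, mul_one]
  have hgint : ∫⁻ y, (1 - b y) ∂(μ : Measure X) = 1 - c := by
    rw [lintegral_sub hmb (by rw [hbint]; exact (hc1.trans ENNReal.one_lt_top).ne)
      (Eventually.of_forall hb1), hbint]
    simp
  -- Density of the plan with respect to `μ₀ ⊗ μ`. Within each cell a fraction `c` of `μ₀` is
  -- coupled independently to mass of `μ` in the same cell; the rest of `μ`, with density `1 - b`
  -- and mass `1 - c`, is coupled independently to the remaining `(1 - c) μ₀`.
  set k : X × X → ENNReal :=
    fun z => ∑ a ∈ t', c / q a * (χ a z.1 * χ a z.2) + (1 - b z.2) with hk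
  have hmk1 (a : X) : Measurable fun z : X × X => c / q a * (χ a z.1 * χ a z.2 : ENNReal) :=
    (((hmχ a).comp measurable_fst).mul ((hmχ a).comp measurable_snd)).const_mul _
  have hmk2 : Measurable fun z : X × X => 1 - b z.2 :=
    measurable_const.sub (hmb.comp measurable_snd)
  have hmk : Measurable k := (Finset.measurable_sum _ fun a _ => hmk1 a).add hmk2
  have hleft : ∀ᵐ x ∂(μ₀ : Measure X), ∫⁻ y, k (x, y) ∂(μ : Measure X) = 1 := by
    have hz : ∀ᵐ x ∂(μ₀ : Measure X), ∀ a ∈ t, p a = 0 → (χ a x : ENNReal) = 0 := by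
      rw [Filter.eventually_all_finset]
      intro a _
      by_cases h0 : p a = 0
      · filter_upwards [(lintegral_eq_zero_iff (hmχ a)).1 h0] with x hx _ using hx
      · exact Eventually.of_forall fun x h => absurd h h0
    filter_upwards [hz] with x hx
    have h1 : ∑ a ∈ t', (χ a x : ENNReal) = 1 := by
      rw [← hsum' x]
      refine Finset.sum_subset (Finset.filter_subset _ _) fun a ha hat => ?_
      refine hx a ha ?_
      by_contra h0
      exact hat (by simp [ht', ha, h0])
    simp only [hk]
    rw [lintegral_add_right (g := fun y => 1 - b y) _ (measurable_const.sub hmb), hgint,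
      lintegral_finsetSum _ fun a _ => ((hmχ a).const_mul _).const_mul _]
    have h2 : ∑ a ∈ t', ∫⁻ y, c / q a * (χ a x * χ a y) ∂(μ : Measure X) = c := by
      calc _ = ∑ a ∈ t', c * χ a x := by
            refine Finset.sum_congr rfl fun a ha => ?_
            rw [lintegral_const_mul _ ((hmχ a).const_mul _), lintegral_const_mul _ (hmχ a)]
            change c / q a * (_ * q a) = _
            rw [mul_left_comm, ENNReal.div_mul_cancel (hq0 ha) (hqt ha), mul_comm]
        _ = c := by rw [← Finset.mul_sum, h1, mul_one]
    rw [h2, add_tsub_cancel_of_le hc1.le]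
  have hright (y : X) : ∫⁻ x, k (x, y) ∂(μ₀ : Measure X) = 1 := by
    simp only [hk]
    rw [lintegral_add_right _ measurable_const,
      lintegral_finsetSum _ fun a _ => ((hmχ a).mul_const _).const_mul _]
    have h2 : ∑ a ∈ t', ∫⁻ x, c / q a * (χ a x * χ a y) ∂(μ₀ : Measure X) = b y := by
      refine Finset.sum_congr rfl fun a ha => ?_
      rw [lintegral_const_mul _ ((hmχ a).mul_const _), lintegral_mul_const _ (hmχ a), mul_assoc]
    rw [h2]
    simp [add_tsub_cancel_of_le (hb1 y)]
  refine ⟨((μ₀ : Measure X).prod μ).withDensity k, ?_, ?_, ?_⟩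
  · ext s hs
    rw [Measure.map_apply measurable_fst hs, withDensity_apply _ (measurable_fst hs)]
    rw [show (Prod.fst ⁻¹' s : Set (X × X)) = s ×ˢ univ by ext; simp]
    rw [← Measure.prod_restrict, lintegral_prod _ hmk.aemeasurable, Measure.restrict_univ]
    rw [lintegral_congr_ae (ae_restrict_of_ae hleft)]
    simp
  · ext s hs
    rw [Measure.map_apply measurable_snd hs, withDensity_apply _ (measurable_snd hs)]
    rw [show (Prod.snd ⁻¹' s : Set (X × X)) = univ ×ˢ s by ext; simp]
    rw [← Measure.prod_restrict, lintegral_prod_symm _ hmk.aemeasurable, Measure.restrict_univ]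
    simp [hright]
  · have hmd : Measurable fun z : X × X => edist z.1 z.2 := measurable_edist
    rw [lintegral_withDensity_eq_lintegral_mul _ hmk hmd]
    -- Points of a common cell are at distance at most `ε/4 + ε/4`. The unmatched mass may travel
    -- the whole diameter `D`, but `c` was chosen so that this costs at most `ε/2`.
    have hpt (z : X × X) : (k * fun z : X × X => edist z.1 z.2) z ≤
        (∑ a ∈ t', c / q a * (χ a z.1 * χ a z.2)) * (ε / 2) + (1 - b z.2) * D := by
      simp only [hk, Pi.mul_apply]
      rw [add_mul, Finset.sum_mul, Finset.sum_mul]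
      refine add_le_add (Finset.sum_le_sum fun a ha => ?_) ?_
      · by_cases h1 : χ a z.1 = 0
        · simp [h1]
        by_cases h2 : χ a z.2 = 0
        · simp [h2]
        gcongr
        calc edist z.1 z.2 ≤ edist z.1 a + edist z.2 a := edist_triangle_right _ _ _
          _ ≤ ε / 4 + ε / 4 := by
            gcongr
            · rw [edist_dist, ← hε4]; exact ENNReal.ofReal_le_ofReal (hχ a _ h1).le
            · rw [edist_dist, ← hε4]; exact ENNReal.ofReal_le_ofReal (hχ a _ h2).le
          _ = ε / 2 := by
            rw [← two_mul, ← mul_div_assoc, mul_comm, mul_div_assoc, ENNReal.div_eq_inv_mul (a := ε)]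
            rw [mul_comm]
            congr 1
            rw [ENNReal.div_eq_inv_mul, show (4 : ENNReal) = 2 * 2 by norm_num,
              ENNReal.mul_inv (by simp) (by simp), mul_assoc, ENNReal.inv_mul_cancel (by simp) (by simp),
              mul_one]
      · gcongr
        exact Metric.edist_le_ediam_of_mem (mem_univ _) (mem_univ _)
    have hkint : ∫⁻ z, (∑ a ∈ t', c / q a * (χ a z.1 * χ a z.2)) ∂((μ₀ : Measure X).prod μ) ≤ 1 := by
      calc _ ≤ ∫⁻ z, k z ∂((μ₀ : Measure X).prod μ) := lintegral_mono fun z => le_self_add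
        _ = 1 := by
          rw [lintegral_prod_symm _ hmk.aemeasurable]
          simp [hright]
    calc _ ≤ ∫⁻ z, ((∑ a ∈ t', c / q a * (χ a z.1 * χ a z.2)) * (ε / 2) + (1 - b z.2) * D)
          ∂((μ₀ : Measure X).prod μ) := lintegral_mono hpt
      _ = (∫⁻ z, (∑ a ∈ t', c / q a * (χ a z.1 * χ a z.2)) ∂((μ₀ : Measure X).prod μ)) * (ε / 2)
          + (1 - c) * D := by
        rw [lintegral_add_right _ (hmk2.mul_const _), lintegral_mul_const _ hmk2,
          lintegral_mul_const _ (Finset.measurable_sum _ fun a _ => hmk1 a)]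
        congr 2
        rw [lintegral_prod_symm _ hmk2.aemeasurable]
        simp [hgint]
      _ ≤ 1 * (ε / 2) + ε / 2 := by
        gcongr
        rw [mul_comm]; exact hcD
      _ = ε := by rw [one_mul, ENNReal.add_halves]

end WeakTopology

/-! ### Transport plans given by pairs of random vectors -/

section Plans

variable {Ω : Type*} [MeasurableSpace Ω] {P : Measure Ω} {X Y : Ω → Space d}

lemma map_mem_probOn [IsProbabilityMeasure P] (hX : AEMeasurable X P) {R : ℝ}
    (hXR : ∀ᵐ ω ∂P, ‖X ω‖ ≤ R) : P.map X ∈ probOn (Metric.closedBall (0 : Space d) R) := by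
  refine ⟨Measure.isProbabilityMeasure_map hX, ?_⟩
  rw [Measure.map_apply_of_aemeasurable hX Metric.isClosed_closedBall.measurableSet.compl]
  rw [ae_iff] at hXR
  convert hXR using 3
  ext; simp

lemma ae_norm_le_of_mem_probOn {μ : Measure (Space d)} {R : ℝ}
    (hμ : μ ∈ probOn (Metric.closedBall (0 : Space d) R)) : ∀ᵐ x ∂μ, ‖x‖ ≤ R := by
  rw [ae_iff]
  convert hμ.2 using 2
  ext; simp

lemma ae_mem_of_mem_probOn {μ : Measure (Space d)} {K : Set (Space d)} (hμ : μ ∈ probOn K) :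
    ∀ᵐ x ∂μ, x ∈ K := by
  rw [ae_iff]
  exact hμ.2

lemma probOn_mono {K K' : Set (Space d)} (h : K ⊆ K') : probOn K ⊆ probOn K' := fun _ hμ =>
  ⟨hμ.1, measure_mono_null (compl_subset_compl.2 h) hμ.2⟩

lemma probOn_closedBall_subset_compactlySupported {R : ℝ} :
    probOn (Metric.closedBall (0 : Space d) R) ⊆ compactlySupported d := fun _ hμ =>
  ⟨hμ.1, (isCompact_closedBall (0 : Space d) R).of_isClosed_subset Measure.isClosed_support
    (Measure.support_subset_of_isClosed Metric.isClosed_closedBall (mem_ae_iff.2 hμ.2))⟩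

lemma map_prodMk_mem_plans [IsProbabilityMeasure P] (hX : AEMeasurable X P)
    (hY : AEMeasurable Y P) :
    P.map (fun ω => (X ω, Y ω)) ∈ plans (P.map X) (P.map Y) := by
  refine ⟨Measure.isProbabilityMeasure_map (hX.prodMk hY), ?_, ?_⟩
  · rw [AEMeasurable.map_map_of_aemeasurable measurable_fst.aemeasurable (hX.prodMk hY)]; rfl
  · rw [AEMeasurable.map_map_of_aemeasurable measurable_snd.aemeasurable (hX.prodMk hY)]; rfl

lemma planECost_map_prodMk (p : ℝ) (hX : AEMeasurable X P) (hY : AEMeasurable Y P) :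
    planECost p (P.map (fun ω => (X ω, Y ω))) = (∫⁻ ω, ‖X ω - Y ω‖ₑ ^ p ∂P) ^ (1 / p) := by
  rw [planECost, lintegral_map' (by fun_prop) (hX.prodMk hY)]

lemma planECost_one (γ : Measure (Space d × Space d)) :
    planECost 1 γ = ∫⁻ z, ‖z.1 - z.2‖ₑ ∂γ := by
  simp [planECost]

lemma planCost_one (γ : Measure (Space d × Space d)) :
    planCost 1 γ = ∫ z, ‖z.1 - z.2‖ ∂γ := by
  rw [planCost, planECost_one, integral_norm_eq_lintegral_enorm (by fun_prop)]

lemma planCost_two (γ : Measure (Space d × Space d)) :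
    planCost 2 γ = Real.sqrt (∫ z, ‖z.1 - z.2‖ ^ 2 ∂γ) := by
  rw [planCost, planECost, integral_eq_lintegral_of_nonneg_ae
    (Eventually.of_forall fun z => by positivity) (by fun_prop), Real.sqrt_eq_rpow,
    ← ENNReal.toReal_rpow]
  congr 3
  funext z
  rw [ENNReal.ofReal_pow (norm_nonneg _), ofReal_norm]
  exact_mod_cast ENNReal.rpow_natCast _ 2

lemma planCost_nonneg (p : ℝ) (γ : Measure (Space d × Space d)) : 0 ≤ planCost p γ :=
  ENNReal.toReal_nonneg

lemma wasserstein_le_planCost {p : ℝ} {μ ν : Measure (Space d)} {γ : Measure (Space d × Space d)}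
    (hγ : γ ∈ plans μ ν) (hfin : planECost p γ ≠ ⊤) : wasserstein p μ ν ≤ planCost p γ :=
  ENNReal.toReal_mono hfin (iInf₂_le γ hγ)

lemma planCost_eq_wasserstein {p : ℝ} {μ ν : Measure (Space d)} {γ : Measure (Space d × Space d)}
    (hγ : γ ∈ optimalPlans p μ ν) : planCost p γ = wasserstein p μ ν := by
  rw [planCost, wasserstein]
  congr 1
  exact le_antisymm (le_iInf₂ hγ.2) (iInf₂_le γ hγ.1)

lemma planECost_ne_top [IsFiniteMeasure P] {p : ℝ} (hp : 0 < p) {R : ℝ} (hX : AEMeasurable X P)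
    (hY : AEMeasurable Y P) (hXY : ∀ᵐ ω ∂P, ‖X ω - Y ω‖ ≤ R) :
    planECost p (P.map (fun ω => (X ω, Y ω))) ≠ ⊤ := by
  rw [planECost_map_prodMk p hX hY]
  refine ENNReal.rpow_ne_top_of_nonneg (by positivity) ?_
  have : ∫⁻ ω, ‖X ω - Y ω‖ₑ ^ p ∂P ≤ ∫⁻ _, ENNReal.ofReal R ^ p ∂P := by
    refine lintegral_mono_ae ?_
    filter_upwards [hXY] with ω hω
    gcongr
    rw [← ofReal_norm]
    exact ENNReal.ofReal_le_ofReal hω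
  refine ne_top_of_le_ne_top ?_ this
  rw [lintegral_const]
  exact ENNReal.mul_ne_top (ENNReal.rpow_ne_top_of_nonneg hp.le ENNReal.ofReal_ne_top)
    (measure_ne_top _ _)

lemma planCost_one_map_prodMk (hX : AEMeasurable X P) (hY : AEMeasurable Y P) :
    planCost 1 (P.map (fun ω => (X ω, Y ω))) = ∫ ω, ‖X ω - Y ω‖ ∂P := by
  rw [planCost_one, integral_map (hX.prodMk hY) (by fun_prop)]

lemma planCost_two_map_prodMk (hX : AEMeasurable X P) (hY : AEMeasurable Y P) :
    planCost 2 (P.map (fun ω => (X ω, Y ω))) = Real.sqrt (∫ ω, ‖X ω - Y ω‖ ^ 2 ∂P) := by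
  rw [planCost_two, integral_map (hX.prodMk hY) (by fun_prop)]

lemma wasserstein_one_map_le [IsProbabilityMeasure P] {R : ℝ} (hX : AEMeasurable X P)
    (hY : AEMeasurable Y P) (hXY : ∀ᵐ ω ∂P, ‖X ω - Y ω‖ ≤ R) :
    wasserstein 1 (P.map X) (P.map Y) ≤ ∫ ω, ‖X ω - Y ω‖ ∂P := by
  rw [← planCost_one_map_prodMk hX hY]
  exact wasserstein_le_planCost (map_prodMk_mem_plans hX hY)
    (planECost_ne_top one_pos hX hY hXY)

/-- The Cauchy–Schwarz inequality in integral form. -/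
lemma integral_norm_mul_norm_le {E F : Type*} [NormedAddCommGroup E] [NormedAddCommGroup F]
    {f : Ω → E} {g : Ω → F} (hf : MemLp f 2 P) (hg : MemLp g 2 P) :
    ∫ ω, ‖f ω‖ * ‖g ω‖ ∂P ≤ Real.sqrt (∫ ω, ‖f ω‖ ^ 2 ∂P) * Real.sqrt (∫ ω, ‖g ω‖ ^ 2 ∂P) := by
  have h := integral_mul_norm_le_Lp_mul_Lq (μ := P) (f := fun ω => ‖f ω‖) (g := fun ω => ‖g ω‖)
    Real.HolderConjugate.two_two (by simpa using hf.norm) (by simpa using hg.norm)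
  simpa [Real.sqrt_eq_rpow] using h

lemma integral_norm_le_sqrt [IsProbabilityMeasure P] {E : Type*} [NormedAddCommGroup E]
    {f : Ω → E} (hf : MemLp f 2 P) :
    ∫ ω, ‖f ω‖ ∂P ≤ Real.sqrt (∫ ω, ‖f ω‖ ^ 2 ∂P) := by
  simpa using integral_norm_mul_norm_le hf (memLp_const (1 : ℝ))

lemma memLp_of_ae_bound [IsFiniteMeasure P] (p : ENNReal) {R : ℝ} (hX : AEMeasurable X P)
    (hXR : ∀ᵐ ω ∂P, ‖X ω‖ ≤ R) : MemLp X p P :=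
  MemLp.of_bound hX.aestronglyMeasurable R hXR

end Plans

/-! ### Measures on a closed ball as measures on a compact space -/

section Ball

/-- The closed ball of radius `R` as a compact metric space. -/
abbrev Ball (d : ℕ) (R : ℝ) : Type := Metric.closedBall (0 : Space d) R

instance instCompactSpaceBall (R : ℝ) : CompactSpace (Ball d R) :=
  isCompact_iff_compactSpace.1 (isCompact_closedBall _ _)

lemma measurableEmbedding_ballVal (R : ℝ) :
    MeasurableEmbedding (Subtype.val : Ball d R → Space d) :=
  MeasurableEmbedding.subtype_coe Metric.isClosed_closedBall.measurableSet

lemma exists_probabilityMeasure_map_eq {α β : Type*} [MeasurableSpace α] [MeasurableSpace β]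
    {i : α → β} (hi : MeasurableEmbedding i) {μ : Measure β} [IsProbabilityMeasure μ]
    (hμ : ∀ᵐ x ∂μ, x ∈ range i) : ∃ μ' : ProbabilityMeasure α, (μ' : Measure α).map i = μ := by
  have h : (μ.comap i).map i = μ := by
    rw [hi.map_comap, Measure.restrict_eq_self_of_ae_mem hμ]
  refine ⟨⟨μ.comap i, ⟨?_⟩⟩, h⟩
  have : (μ.comap i).map i univ = 1 := by rw [h]; exact measure_univ
  rwa [Measure.map_apply hi.measurable MeasurableSet.univ, preimage_univ] at this

lemma map_val_mem_probOn {R : ℝ} (μ : ProbabilityMeasure (Ball d R)) :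
    (μ : Measure (Ball d R)).map Subtype.val ∈ probOn (Metric.closedBall (0 : Space d) R) :=
  map_mem_probOn measurable_subtype_coe.aemeasurable
    (Eventually.of_forall fun x => mem_closedBall_zero_iff.1 x.2)

lemma exists_probabilityMeasure_ball {R : ℝ} {μ : Measure (Space d)}
    (hμ : μ ∈ probOn (Metric.closedBall (0 : Space d) R)) :
    ∃ μ' : ProbabilityMeasure (Ball d R), (μ' : Measure (Ball d R)).map Subtype.val = μ := by
  have := hμ.1
  refine exists_probabilityMeasure_map_eq (measurableEmbedding_ballVal R) ?_
  filter_upwards [ae_mem_of_mem_probOn hμ] with x hx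
  exact ⟨⟨x, hx⟩, rfl⟩

lemma exists_probabilityMeasure_ball_prod {R : ℝ} {γ : Measure (Space d × Space d)}
    [IsProbabilityMeasure γ] (hγ : ∀ᵐ z ∂γ, ‖z.1‖ ≤ R ∧ ‖z.2‖ ≤ R) :
    ∃ γ' : ProbabilityMeasure (Ball d R × Ball d R),
      (γ' : Measure (Ball d R × Ball d R)).map (Prod.map Subtype.val Subtype.val) = γ := by
  refine exists_probabilityMeasure_map_eq
    ((measurableEmbedding_ballVal R).prodMap (measurableEmbedding_ballVal R)) ?_
  filter_upwards [hγ] with z hz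
  exact ⟨(⟨z.1, by simpa using hz.1⟩, ⟨z.2, by simpa using hz.2⟩), rfl⟩

lemma ae_norm_le_of_mem_plans {R : ℝ} {μ ν : Measure (Space d)} {γ : Measure (Space d × Space d)}
    (hμ : μ ∈ probOn (Metric.closedBall (0 : Space d) R))
    (hν : ν ∈ probOn (Metric.closedBall (0 : Space d) R)) (hγ : γ ∈ plans μ ν) :
    ∀ᵐ z ∂γ, ‖z.1‖ ≤ R ∧ ‖z.2‖ ≤ R := by
  have h1 := ae_norm_le_of_mem_probOn hμ
  have h2 := ae_norm_le_of_mem_probOn hν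
  rw [← hγ.2.1] at h1
  rw [← hγ.2.2] at h2
  exact (ae_of_ae_map measurable_fst.aemeasurable h1).and
    (ae_of_ae_map measurable_snd.aemeasurable h2)

/-- The `W₁` distance is continuous for the weak convergence of measures on a ball. -/
lemma eventually_wasserstein_one_lt {R : ℝ} (μ₀ : ProbabilityMeasure (Ball d R)) {ε : ℝ}
    (hε : 0 < ε) :
    ∀ᶠ μ : ProbabilityMeasure (Ball d R) in 𝓝 μ₀,
      wasserstein 1 ((μ₀ : Measure (Ball d R)).map Subtype.val)
        ((μ : Measure (Ball d R)).map Subtype.val) < ε := by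
  filter_upwards [eventually_exists_plan_lintegral_edist_le μ₀
    (ε := ENNReal.ofReal (ε / 2)) (by simpa using hε) ENNReal.ofReal_ne_top] with μ hμ
  obtain ⟨γ, h1, h2, h3⟩ := hμ
  have hγ : IsProbabilityMeasure γ := ⟨by
    rw [← preimage_univ (f := Prod.fst), ← Measure.map_apply measurable_fst MeasurableSet.univ, h1]
    exact measure_univ⟩
  have hm1 : AEMeasurable (fun z : Ball d R × Ball d R => (z.1 : Space d)) γ :=
    (measurable_subtype_coe.comp measurable_fst).aemeasurable
  have hm2 : AEMeasurable (fun z : Ball d R × Ball d R => (z.2 : Space d)) γ :=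
    (measurable_subtype_coe.comp measurable_snd).aemeasurable
  have hcost := planECost_one (γ.map (fun z : Ball d R × Ball d R => ((z.1 : Space d), (z.2 : Space d))))
  rw [lintegral_map' (by fun_prop) (hm1.prodMk hm2)] at hcost
  have hle : planECost 1 (γ.map (fun z : Ball d R × Ball d R => ((z.1 : Space d), (z.2 : Space d))))
      ≤ ENNReal.ofReal (ε / 2) := by
    rw [hcost]
    refine le_trans (le_of_eq ?_) h3
    refine lintegral_congr fun z => ?_
    rw [← edist_eq_enorm_sub]
    rfl
  have hplan := map_prodMk_mem_plans hm1 hm2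
  have e1 : γ.map (fun z : Ball d R × Ball d R => (z.1 : Space d)) =
      (μ₀ : Measure (Ball d R)).map Subtype.val := by
    rw [← h1, Measure.map_map measurable_subtype_coe measurable_fst]; rfl
  have e2 : γ.map (fun z : Ball d R × Ball d R => (z.2 : Space d)) =
      (μ : Measure (Ball d R)).map Subtype.val := by
    rw [← h2, Measure.map_map measurable_subtype_coe measurable_snd]; rfl
  rw [e1, e2] at hplan
  calc _ ≤ planCost 1 _ := wasserstein_le_planCost hplan (ne_top_of_le_ne_top ENNReal.ofReal_ne_top hle)
    _ ≤ ε / 2 := ENNReal.toReal_le_of_le_ofReal (by positivity) hle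
    _ < ε := by linarith

/-- Compactly supported probability measures are joined by an optimal plan. -/
theorem optimalPlans_nonempty {R : ℝ} {μ ν : Measure (Space d)}
    (hμ : μ ∈ probOn (Metric.closedBall (0 : Space d) R))
    (hν : ν ∈ probOn (Metric.closedBall (0 : Space d) R)) : (optimalPlans 2 μ ν).Nonempty := by
  obtain ⟨μ', rfl⟩ := exists_probabilityMeasure_ball hμ
  obtain ⟨ν', rfl⟩ := exists_probabilityMeasure_ball hν
  set S : Set (ProbabilityMeasure (Ball d R × Ball d R)) :=
    {γ | γ.map (f := Prod.fst) measurable_fst.aemeasurable = μ' ∧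
      γ.map (f := Prod.snd) measurable_snd.aemeasurable = ν'} with hS
  have hval : Measurable (Subtype.val : Ball d R → Space d) := measurable_subtype_coe
  have hpm : Measurable (Prod.map Subtype.val Subtype.val :
      Ball d R × Ball d R → Space d × Space d) := hval.prodMap hval
  -- The direct method: measures on the compact product form a weakly compact space, the marginal
  -- constraints are closed, and the quadratic cost is weakly continuous.
  have hSc : IsCompact S := by
    refine IsClosed.isCompact ?_
    exact (isClosed_singleton.preimage (ProbabilityMeasure.continuous_map continuous_fst)).inter
      (isClosed_singleton.preimage (ProbabilityMeasure.continuous_map continuous_snd))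
  have hSn : S.Nonempty := by
    refine ⟨⟨(μ' : Measure (Ball d R)).prod (ν' : Measure (Ball d R)), inferInstance⟩, Subtype.ext ?_, Subtype.ext ?_⟩
    · change ((μ' : Measure (Ball d R)).prod (ν' : Measure (Ball d R))).map Prod.fst = _
      simp
    · change ((μ' : Measure (Ball d R)).prod (ν' : Measure (Ball d R))).map Prod.snd = _
      simp
  let cost : C(Ball d R × Ball d R, NNReal) :=
    ⟨fun z => ‖(z.1 : Space d) - z.2‖₊ ^ 2, by fun_prop⟩
  obtain ⟨γ, hγS, hγ⟩ := hSc.exists_isMinOn hSn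
    (ProbabilityMeasure.continuous_lintegral_continuousMap cost).continuousOn
  have hcost (γ' : ProbabilityMeasure (Ball d R × Ball d R)) :
      planECost 2 ((γ' : Measure (Ball d R × Ball d R)).map (Prod.map Subtype.val Subtype.val))
        = (∫⁻ z, cost z ∂(γ' : Measure (Ball d R × Ball d R))) ^ (1 / 2 : ℝ) := by
    rw [planECost, lintegral_map (by fun_prop) hpm]
    congr 1
    refine lintegral_congr fun z => ?_
    simp [cost]
    rfl
  have hmarg (γ' : ProbabilityMeasure (Ball d R × Ball d R)) :
      ((γ' : Measure (Ball d R × Ball d R)).map (Prod.map Subtype.val Subtype.val)).map Prod.fst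
        = ((γ' : Measure (Ball d R × Ball d R)).map Prod.fst).map (Subtype.val : _ → Space d) ∧
      ((γ' : Measure (Ball d R × Ball d R)).map (Prod.map Subtype.val Subtype.val)).map Prod.snd
        = ((γ' : Measure (Ball d R × Ball d R)).map Prod.snd).map (Subtype.val : _ → Space d) := by
    constructor
    · rw [Measure.map_map measurable_fst hpm, Measure.map_map hval measurable_fst]; rfl
    · rw [Measure.map_map measurable_snd hpm, Measure.map_map hval measurable_snd]; rfl
  have hinj {α β : ProbabilityMeasure (Ball d R)}
      (h : (α : Measure (Ball d R)).map (Subtype.val : _ → Space d) =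
        (β : Measure (Ball d R)).map (Subtype.val : _ → Space d)) : α = β := by
    refine Subtype.ext ?_
    have h1 := congrArg (Measure.comap (Subtype.val : Ball d R → Space d)) h
    rwa [(measurableEmbedding_ballVal R).comap_map, (measurableEmbedding_ballVal R).comap_map] at h1
  refine ⟨(γ : Measure (Ball d R × Ball d R)).map (Prod.map Subtype.val Subtype.val),
    ⟨Measure.isProbabilityMeasure_map hpm.aemeasurable, ?_, ?_⟩, ?_⟩
  · rw [(hmarg γ).1, ← hγS.1]; rfl
  · rw [(hmarg γ).2, ← hγS.2]; rfl
  · intro γ' hγ'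
    have := hγ'.1
    obtain ⟨γ'', rfl⟩ := exists_probabilityMeasure_ball_prod (ae_norm_le_of_mem_plans hμ hν hγ')
    rw [hcost, hcost]
    refine ENNReal.rpow_le_rpow (hγ ⟨hinj ?_, hinj ?_⟩) (by norm_num)
    · rw [← hγ'.2.1, (hmarg γ'').1]; rfl
    · rw [← hγ'.2.2, (hmarg γ'').2]; rfl

lemma map_snd_eq_map_fst_of_integral_eq_zero {R : ℝ} (γ : ProbabilityMeasure (Ball d R × Ball d R))
    (h : ∫ z, ‖(z.1 : Space d) - z.2‖ ∂(γ : Measure (Ball d R × Ball d R)) = 0) :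
    (γ : Measure (Ball d R × Ball d R)).map Prod.snd =
      (γ : Measure (Ball d R × Ball d R)).map Prod.fst := by
  have hint : Integrable (fun z : Ball d R × Ball d R => ‖(z.1 : Space d) - z.2‖)
      (γ : Measure (Ball d R × Ball d R)) :=
    (BoundedContinuousFunction.mkOfCompact
      ⟨fun z : Ball d R × Ball d R => ‖(z.1 : Space d) - z.2‖, by fun_prop⟩).integrable _
  have hae := (integral_eq_zero_iff_of_nonneg
    (fun z : Ball d R × Ball d R => norm_nonneg ((z.1 : Space d) - z.2)) hint).1 h
  refine Measure.map_congr ?_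
  filter_upwards [hae] with p hp
  have : (p.1 : Space d) - p.2 = 0 := norm_eq_zero.1 hp
  exact Subtype.ext (sub_eq_zero.1 this).symm

/-- Applied with `c` a cost and `G` an oscillation. The cost has a positive minimum on the compact
set where the oscillation is at least `ε`, so a small cost forces a small oscillation. -/
lemma exists_pos_lt_of_isCompact {A : Type*} [TopologicalSpace A] [CompactSpace A] {c G : A → ℝ}
    (hc : Continuous c) (hG : Continuous G) {ε : ℝ} (h : ∀ q, ε ≤ G q → 0 < c q) :
    ∃ δ > 0, ∀ q, ε ≤ G q → δ < c q := by
  have hC : IsCompact {q | ε ≤ G q} := (isClosed_le continuous_const hG).isCompact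
  rcases Set.eq_empty_or_nonempty {q | ε ≤ G q} with he | hne
  · exact ⟨1, one_pos, fun q hq => absurd (show q ∈ {q | ε ≤ G q} from hq) (by simp [he])⟩
  · obtain ⟨q₀, hq₀, hmin⟩ := hC.exists_isMinOn hne hc.continuousOn
    have := h q₀ hq₀
    exact ⟨c q₀ / 2, by positivity, fun q hq => (half_lt_self this).trans_le (hmin hq)⟩

/-- A function of a measure on a ball and of a point of a compact space which is continuous for
`W₁` is bounded, and uniformly continuous with respect to the cost of plans. -/
theorem uniform_of_wasserstein_continuous {R : ℝ} {Z : Type*} [MetricSpace Z] [CompactSpace Z]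
    {E : Type*} [NormedAddCommGroup E] {f : Measure (Space d) → Z → E}
    (hf : ∀ μ ∈ probOn (Metric.closedBall (0 : Space d) R), ∀ z, ∀ ε > 0, ∃ δ > 0,
      ∀ ν ∈ probOn (Metric.closedBall (0 : Space d) R), ∀ z', wasserstein 1 μ ν < δ →
        dist z' z < δ → ‖f ν z' - f μ z‖ < ε) :
    (∀ ε > 0, ∃ δ > 0, ∀ γ : Measure (Space d × Space d), IsProbabilityMeasure γ →
      (∀ᵐ z ∂γ, ‖z.1‖ ≤ R ∧ ‖z.2‖ ≤ R) → ∀ z z', ∫ p, ‖p.1 - p.2‖ ∂γ ≤ δ → dist z z' ≤ δ →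
        ‖f (γ.map Prod.snd) z' - f (γ.map Prod.fst) z‖ ≤ ε) ∧
    ∃ M, ∀ μ ∈ probOn (Metric.closedBall (0 : Space d) R), ∀ z, ‖f μ z‖ ≤ M := by
  set g : ProbabilityMeasure (Ball d R) × Z → E :=
    fun q => f ((q.1 : Measure (Ball d R)).map Subtype.val) q.2 with hg
  -- Weak continuity of `W₁` on the ball makes `f` continuous on a compact space of measures and
  -- points.
  have hgc : Continuous g := by
    rw [continuous_iff_continuousAt]
    rintro ⟨μ, z⟩
    rw [ContinuousAt, Metric.tendsto_nhds]
    intro ε hε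
    obtain ⟨δ, hδ, h⟩ := hf _ (map_val_mem_probOn μ) z ε hε
    rw [nhds_prod_eq]
    filter_upwards [(eventually_wasserstein_one_lt μ hδ).prod_mk (Metric.ball_mem_nhds z hδ)]
      with q hq
    rw [dist_eq_norm]
    exact h _ (map_val_mem_probOn q.1) q.2 hq.1 hq.2
  have hval : Measurable (Subtype.val : Ball d R → Space d) := measurable_subtype_coe
  have hpm : Measurable (Prod.map Subtype.val Subtype.val :
      Ball d R × Ball d R → Space d × Space d) := hval.prodMap hval
  constructor
  · intro ε hε
    let cost : C(Ball d R × Ball d R, ℝ) := ⟨fun z => ‖(z.1 : Space d) - z.2‖, by fun_prop⟩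
    -- Compactness is used on the space of plans rather than of pairs of measures, so that the
    -- modulus is expressed by the cost of an arbitrary plan. This `c` vanishes only if the plan
    -- lives on the diagonal and the two points agree, and then `G` vanishes too.
    let c : ProbabilityMeasure (Ball d R × Ball d R) × Z × Z → ℝ :=
      fun q => ∫ z, cost z ∂(q.1 : Measure (Ball d R × Ball d R)) + dist q.2.1 q.2.2
    have hc : Continuous c :=
      ((ProbabilityMeasure.continuous_integral_continuousMap cost).comp continuous_fst).add
        (by fun_prop)
    let G : ProbabilityMeasure (Ball d R × Ball d R) × Z × Z → ℝ := fun q =>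
      ‖g (q.1.map (f := Prod.snd) measurable_snd.aemeasurable, q.2.2) -
        g (q.1.map (f := Prod.fst) measurable_fst.aemeasurable, q.2.1)‖
    have hG : Continuous G := by
      refine ((hgc.comp ?_).sub (hgc.comp ?_)).norm
      · exact ((ProbabilityMeasure.continuous_map continuous_snd).comp continuous_fst).prodMk
          (by fun_prop)
      · exact ((ProbabilityMeasure.continuous_map continuous_fst).comp continuous_fst).prodMk
          (by fun_prop)
    have hpos : ∀ q, ε ≤ G q → 0 < c q := by
      rintro ⟨γ, z, z'⟩ hq
      have hi : 0 ≤ ∫ z, cost z ∂(γ : Measure (Ball d R × Ball d R)) :=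
        integral_nonneg fun z => norm_nonneg ((z.1 : Space d) - z.2)
      refine lt_of_le_of_ne (add_nonneg hi dist_nonneg) fun h0 => ?_
      have hzz : dist z z' = 0 := le_antisymm (by simp only [c] at h0; linarith) dist_nonneg
      have hi0 : ∫ z, ‖(z.1 : Space d) - z.2‖ ∂(γ : Measure (Ball d R × Ball d R)) = 0 := by
        simp only [c] at h0
        exact le_antisymm (by simp only [cost, ContinuousMap.coe_mk] at h0; linarith) hi
      have hm' : γ.map (f := Prod.snd) measurable_snd.aemeasurable =
          γ.map (f := Prod.fst) measurable_fst.aemeasurable :=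
        Subtype.ext (map_snd_eq_map_fst_of_integral_eq_zero γ hi0)
      have : G (γ, z, z') = 0 := by
        simp only [G, hm', dist_eq_zero.1 hzz, sub_self, norm_zero]
      linarith
    obtain ⟨δ, hδ, h⟩ := exists_pos_lt_of_isCompact hc hG hpos
    refine ⟨δ / 2, by positivity, fun γ hγ hγR z z' h1 h2 => ?_⟩
    obtain ⟨γ', rfl⟩ := exists_probabilityMeasure_ball_prod hγR
    by_contra! hcon
    have hkey := h (γ', z, z') (by
      refine hcon.le.trans (le_of_eq ?_)
      simp only [G, hg]
      rw [Measure.map_map measurable_snd hpm, Measure.map_map measurable_fst hpm,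
        ProbabilityMeasure.toMeasure_map, ProbabilityMeasure.toMeasure_map,
        Measure.map_map hval measurable_snd, Measure.map_map hval measurable_fst]
      rfl)
    rw [integral_map hpm.aemeasurable (by fun_prop)] at h1
    have : c (γ', z, z') ≤ δ / 2 + δ / 2 := add_le_add h1 h2
    linarith
  · obtain ⟨M, hM⟩ := (isCompact_range hgc).isBounded.exists_norm_le
    refine ⟨M, fun μ hμ z => ?_⟩
    obtain ⟨μ', rfl⟩ := exists_probabilityMeasure_ball hμ
    exact hM _ ⟨(μ', z), rfl⟩

end Ball

/-! ### Wasserstein gradients along arbitrary plans -/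

section Gradient

lemma sqrt_integral_norm_sq_le_of_eLpNorm_le {α E : Type*} [MeasurableSpace α]
    [NormedAddCommGroup E] {μ : Measure α} {f : α → E} (hf : MemLp f 2 μ) {ε : ℝ} (hε : 0 ≤ ε)
    (h : eLpNorm f 2 μ ≤ ENNReal.ofReal ε) : Real.sqrt (∫ x, ‖f x‖ ^ 2 ∂μ) ≤ ε := by
  rw [hf.eLpNorm_eq_integral_rpow_norm two_ne_zero ENNReal.ofNat_ne_top,
    ENNReal.ofReal_le_ofReal_iff hε] at h
  simpa [Real.sqrt_eq_rpow] using h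

lemma integrable_inner_of_memLp {α E : Type*} [MeasurableSpace α] [NormedAddCommGroup E]
    [InnerProductSpace ℝ E] {μ : Measure α} {f g : α → E} (hf : MemLp f 2 μ) (hg : MemLp g 2 μ) :
    Integrable (fun x => inner ℝ (f x) (g x)) μ := by
  refine (hf.norm.integrable_mul hg.norm).mono (hf.1.inner hg.1) (Eventually.of_forall fun x => ?_)
  simpa using abs_real_inner_le_norm (f x) (g x)

lemma norm_integral_inner_le {α E : Type*} [MeasurableSpace α] [NormedAddCommGroup E]
    [InnerProductSpace ℝ E] {μ : Measure α} {f g : α → E} (hf : MemLp f 2 μ) (hg : MemLp g 2 μ) :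
    |∫ x, inner ℝ (f x) (g x) ∂μ| ≤
      Real.sqrt (∫ x, ‖f x‖ ^ 2 ∂μ) * Real.sqrt (∫ x, ‖g x‖ ^ 2 ∂μ) := by
  refine le_trans ?_ (integral_norm_mul_norm_le hf hg)
  rw [← Real.norm_eq_abs]
  refine norm_integral_le_of_norm_le (hf.norm.integrable_mul hg.norm)
    (Eventually.of_forall fun x => ?_)
  exact norm_inner_le_norm (𝕜 := ℝ) (f x) (g x)

/-- The second order Taylor estimate for a test function. -/
lemma exists_taylor_bound {ψ : Space d → ℝ} (hψ : ContDiff ℝ (⊤ : ℕ∞) ψ)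
    (hc : HasCompactSupport ψ) :
    ∃ C, 0 ≤ C ∧ ∀ x y, |ψ y - ψ x - inner ℝ (gradient ψ x) (y - x)| ≤ C * ‖y - x‖ ^ 2 := by
  have h1 : ContDiff ℝ 1 (fderiv ℝ ψ) := hψ.fderiv_right (by norm_cast)
  obtain ⟨C, hC⟩ := h1.lipschitzWith_of_hasCompactSupport (hc.fderiv (𝕜 := ℝ)) one_ne_zero
  refine ⟨C, C.2, fun x y => ?_⟩
  rw [inner_gradient_left]
  have hdiff : Differentiable ℝ ψ := hψ.differentiable (by norm_cast)
  have := (convex_segment x y).norm_image_sub_le_of_norm_fderiv_le' (f := ψ) (𝕜 := ℝ)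
    (φ := fderiv ℝ ψ x) (C := C * ‖y - x‖) (x := x) (y := y) (fun z _ => hdiff z) (fun z hz => ?_)
    (left_mem_segment ℝ x y) (right_mem_segment ℝ x y)
  · rw [pow_two, ← mul_assoc]; exact this
  · refine (hC.norm_sub_le z x).trans ?_
    gcongr
    exact norm_sub_le_of_mem_segment hz

lemma gradient_memLp {ψ : Space d → ℝ} (hψ : ContDiff ℝ (⊤ : ℕ∞) ψ)
    (hc : HasCompactSupport ψ) (μ : Measure (Space d)) [IsFiniteMeasure μ] :
    MemLp (gradient ψ) 2 μ := by
  have hcont : Continuous (fderiv ℝ ψ) := hψ.continuous_fderiv (by norm_cast)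
  have h1 : MemLp (fderiv ℝ ψ) 2 μ := hcont.memLp_of_hasCompactSupport (hc.fderiv (𝕜 := ℝ))
  have hg : Continuous (gradient ψ) :=
    (InnerProductSpace.toDual ℝ (Space d)).symm.continuous.comp hcont
  refine h1.mono hg.aestronglyMeasurable (Eventually.of_forall fun x => ?_)
  simp [gradient]

/-- The action of a tangent field on a plan depends only on the marginals, up to an error which is
small compared to the cost. -/
lemma IsTangent.exists_approx {μ : Measure (Space d)} {ξ : Space d → Space d}
    (hξ : IsTangent μ ξ) [IsProbabilityMeasure μ] {ε : ℝ} (hε : 0 < ε) :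
    ∃ (ψ : Space d → ℝ) (C : ℝ), 0 ≤ C ∧ ∀ (ν : Measure (Space d)), ∀ γ ∈ plans μ ν, ∀ H,
      (∀ᵐ z ∂γ, ‖z.2 - z.1‖ ≤ H) →
      |∫ z, inner ℝ (ξ z.1) (z.2 - z.1) ∂γ - (∫ y, ψ y ∂ν - ∫ x, ψ x ∂μ)| ≤
        ε * planCost 2 γ + C * planCost 2 γ ^ 2 := by
  obtain ⟨ψ, hψ, hc, hle⟩ := hξ.2 (ENNReal.ofReal ε) (by simpa using hε)
  obtain ⟨C, hC0, hC⟩ := exists_taylor_bound hψ hc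
  refine ⟨ψ, C, hC0, fun ν γ hγ H hH => ?_⟩
  have hγ1 := hγ.1
  have hν : IsProbabilityMeasure ν := by
    rw [← hγ.2.2]; exact Measure.isProbabilityMeasure_map measurable_snd.aemeasurable
  have hmp1 : MeasurePreserving Prod.fst γ μ := ⟨measurable_fst, hγ.2.1⟩
  have hmp2 : MeasurePreserving Prod.snd γ ν := ⟨measurable_snd, hγ.2.2⟩
  have hg := gradient_memLp hψ hc μ
  have hsub : MemLp (fun x => ξ x - gradient ψ x) 2 μ := hξ.1.sub hg
  have hdisp : MemLp (fun z : Space d × Space d => z.2 - z.1) 2 γ :=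
    memLp_of_ae_bound 2 (by fun_prop) hH
  have hcost : Real.sqrt (∫ z, ‖z.2 - z.1‖ ^ 2 ∂γ) = planCost 2 γ := by
    rw [planCost_two]; simp_rw [norm_sub_rev]
  have hcost2 : ∫ z, ‖z.2 - z.1‖ ^ 2 ∂γ = planCost 2 γ ^ 2 := by
    rw [← hcost, Real.sq_sqrt (integral_nonneg fun z => by positivity)]
  have hψi (ρ : Measure (Space d)) [IsFiniteMeasure ρ] : Integrable ψ ρ :=
    hψ.continuous.integrable_of_hasCompactSupport hc
  have i1 : Integrable (fun z : Space d × Space d => inner ℝ (ξ z.1 - gradient ψ z.1) (z.2 - z.1)) γ :=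
    integrable_inner_of_memLp (hsub.comp_measurePreserving hmp1) hdisp
  have i2 : Integrable (fun z : Space d × Space d => inner ℝ (gradient ψ z.1) (z.2 - z.1)) γ :=
    integrable_inner_of_memLp (hg.comp_measurePreserving hmp1) hdisp
  have i3 : Integrable (fun z : Space d × Space d => ψ z.1) γ := hmp1.integrable_comp_of_integrable (hψi μ)
  have i4 : Integrable (fun z : Space d × Space d => ψ z.2) γ := hmp2.integrable_comp_of_integrable (hψi ν)
  have e3 : ∫ x, ψ x ∂μ = ∫ z, ψ z.1 ∂γ := by
    rw [← hγ.2.1, integral_map measurable_fst.aemeasurable hψ.continuous.aestronglyMeasurable]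
  have e4 : ∫ y, ψ y ∂ν = ∫ z, ψ z.2 ∂γ := by
    rw [← hγ.2.2, integral_map measurable_snd.aemeasurable hψ.continuous.aestronglyMeasurable]
  -- The deviation consists of `ξ - ∇ψ`, which is small in `L²(μ)` and costs `ε` times the plan cost
  -- by Cauchy–Schwarz, and of the Taylor remainder of `ψ`, which is quadratic in the displacement.
  have esplit : ∫ z, inner ℝ (ξ z.1) (z.2 - z.1) ∂γ - (∫ y, ψ y ∂ν - ∫ x, ψ x ∂μ)
      = ∫ z, inner ℝ (ξ z.1 - gradient ψ z.1) (z.2 - z.1) ∂γ -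
        ∫ z, (ψ z.2 - ψ z.1 - inner ℝ (gradient ψ z.1) (z.2 - z.1)) ∂γ := by
    have : ∫ z, inner ℝ (ξ z.1) (z.2 - z.1) ∂γ =
        ∫ z, inner ℝ (ξ z.1 - gradient ψ z.1) (z.2 - z.1) ∂γ +
          ∫ z, inner ℝ (gradient ψ z.1) (z.2 - z.1) ∂γ := by
      rw [← integral_add i1 i2]
      refine integral_congr_ae (Eventually.of_forall fun z => ?_)
      simp only
      rw [← inner_add_left, sub_add_cancel]
    have h' : ∫ z, (ψ z.2 - ψ z.1 - inner ℝ (gradient ψ z.1) (z.2 - z.1)) ∂γ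
        = (∫ z, ψ z.2 ∂γ - ∫ z, ψ z.1 ∂γ) - ∫ z, inner ℝ (gradient ψ z.1) (z.2 - z.1) ∂γ := by
      rw [integral_sub (f := fun z : Space d × Space d => ψ z.2 - ψ z.1) (i4.sub i3) i2,
          integral_sub i4 i3]
    rw [this, e3, e4, h']
    ring
  rw [esplit]
  refine (abs_sub _ _).trans (add_le_add ?_ ?_)
  · refine (norm_integral_inner_le (hsub.comp_measurePreserving hmp1) hdisp).trans ?_
    rw [hcost]
    refine mul_le_mul_of_nonneg_right ?_ (planCost_nonneg _ _)
    refine sqrt_integral_norm_sq_le_of_eLpNorm_le (hsub.comp_measurePreserving hmp1) hε.le ?_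
    rw [eLpNorm_comp_measurePreserving hsub.1 hmp1]
    exact hle
  · rw [← hcost2, ← integral_const_mul]
    rw [← Real.norm_eq_abs]
    refine norm_integral_le_of_norm_le (g := fun z : Space d × Space d => C * ‖z.2 - z.1‖ ^ 2) ?_
      (Eventually.of_forall fun z => hC z.1 z.2)
    exact (hdisp.integrable_norm_pow two_ne_zero).const_mul C

/-- The support is compact, so the union of closed balls is the closed thickening; in particular it
is measurable. -/
lemma fattening_eq_cthickening {R₀ R : ℝ} {μ : Measure (Space d)}
    (hμ : μ ∈ probOn (Metric.closedBall (0 : Space d) R₀)) (hR : 0 ≤ R) :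
    fattening μ R = Metric.cthickening R μ.support :=
  ((probOn_closedBall_subset_compactlySupported hμ).2.cthickening_eq_biUnion_closedBall hR).symm

lemma fattening_subset {R₀ R : ℝ} {μ : Measure (Space d)}
    (hμ : μ ∈ probOn (Metric.closedBall (0 : Space d) R₀)) :
    fattening μ R ⊆ Metric.closedBall (0 : Space d) (R₀ + R) := by
  intro y hy
  obtain ⟨x, hx, hxy⟩ := mem_iUnion₂.1 hy
  have h1 : x ∈ Metric.closedBall (0 : Space d) R₀ :=
    Measure.support_subset_of_isClosed Metric.isClosed_closedBall (mem_ae_iff.2 hμ.2) hx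
  rw [mem_closedBall_zero_iff] at h1 ⊢
  have h2 : ‖y - x‖ ≤ R := by simpa [dist_eq_norm] using hxy
  calc ‖y‖ = ‖x + (y - x)‖ := by congr 1; abel
    _ ≤ _ := (norm_add_le _ _).trans (add_le_add h1 h2)

/-- A subgradient which is tangent gives a lower bound along every plan. -/
lemma IsSubgradient.le_of_plan {φ : Measure (Space d) → ℝ} {μ : Measure (Space d)}
    {ξ : Space d → Space d} (hφ : IsSubgradient φ μ ξ) (hξ : IsTangent μ ξ) {R₀ : ℝ}
    (hμ : μ ∈ probOn (Metric.closedBall (0 : Space d) R₀)) {R : ℝ} (hR : 0 < R)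
    {ε : ℝ} (hε : 0 < ε) :
    ∃ δ > 0, ∀ ν ∈ probOn (fattening μ R), ∀ γ ∈ plans μ ν, planCost 2 γ ≤ δ →
      ∫ z, inner ℝ (ξ z.1) (z.2 - z.1) ∂γ - ε * planCost 2 γ ≤ φ ν - φ μ := by
  have := hμ.1
  obtain ⟨ψ, C, hC, hψ⟩ := hξ.exists_approx (ε := ε / 8) (by positivity)
  obtain ⟨δ, hδ, h⟩ := hφ.2 R hR (ε / 2) (by positivity)
  -- The second bound makes `C * c ≤ ε / 8`, so each of the two plans compared below deviates by at
  -- most `ε / 4 * c`. Together they use `ε / 2`, the other half being the subgradient remainder.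
  refine ⟨min δ (ε / (8 * (C + 1))), by positivity, fun ν hν γ hγ hc => ?_⟩
  have hν' := probOn_mono (fattening_subset hμ) hν
  have hμ' := probOn_mono (Metric.closedBall_subset_closedBall (by linarith : R₀ ≤ R₀ + R)) hμ
  have hbd : ∀ γ' ∈ plans μ ν, ∀ᵐ z ∂γ', ‖z.2 - z.1‖ ≤ 2 * (R₀ + R) := fun γ' hγ' => by
    filter_upwards [ae_norm_le_of_mem_plans hμ' hν' hγ'] with z hz
    exact (norm_sub_le _ _).trans (by linarith [hz.1, hz.2])
  have hfin : ∀ γ' ∈ plans μ ν, planECost 2 γ' ≠ ⊤ := fun γ' hγ' => by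
    have := hγ'.1
    have := planECost_ne_top (p := 2) (by norm_num) (X := fun z => z.1) (Y := fun z => z.2)
      (P := γ') (R := 2 * (R₀ + R)) (by fun_prop) (by fun_prop)
      ((hbd γ' hγ').mono fun z hz => by rwa [norm_sub_rev])
    simpa using this
  set c := planCost 2 γ with hcdef
  have hc0 : 0 ≤ c := planCost_nonneg _ _
  have hW : wasserstein 2 μ ν ≤ c := wasserstein_le_planCost hγ (hfin γ hγ)
  have h1 := h ν hν (hW.trans (hc.trans (min_le_left _ _)))
  have hCc : C * c ≤ ε / 8 := by
    have h2 : c ≤ ε / (8 * (C + 1)) := hc.trans (min_le_right _ _)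
    calc C * c ≤ (C + 1) * (ε / (8 * (C + 1))) := by gcongr; linarith
      _ = ε / 8 := by field_simp
  -- The given plan and an optimal one have nearly the same action, since both are close to `∫ ψ dν
  -- - ∫ ψ dμ`, and the optimal one is no more expensive. Existence of an optimal plan is essential:
  -- the infimum over an empty set would be the default value `0`.
  have hlow : ∫ z, inner ℝ (ξ z.1) (z.2 - z.1) ∂γ - ε / 2 * c ≤
      sInf ((fun γ : Measure (Space d × Space d) => ∫ z, inner ℝ (ξ z.1) (z.2 - z.1) ∂γ) ''
        optimalPlans 2 μ ν) := by
    refine le_csInf ((optimalPlans_nonempty hμ' hν').image _) ?_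
    rintro _ ⟨γ', hγ', rfl⟩
    have hc' : planCost 2 γ' ≤ c := by rw [planCost_eq_wasserstein hγ']; exact hW
    have hc'0 : 0 ≤ planCost 2 γ' := planCost_nonneg _ _
    have a1 := abs_le.1 (hψ ν γ hγ _ (hbd γ hγ))
    have a2 := abs_le.1 (hψ ν γ' hγ'.1 _ (hbd γ' hγ'.1))
    have b1 : C * c ^ 2 ≤ ε / 8 * c := by rw [pow_two, ← mul_assoc]; gcongr
    have b2 : C * planCost 2 γ' ^ 2 ≤ C * c ^ 2 := by gcongr
    have b3 : ε / 8 * planCost 2 γ' ≤ ε / 8 * c := by gcongr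
    simp only
    linarith [a1.1, a1.2, a2.1, a2.2]
  have h3 : ε / 2 * wasserstein 2 μ ν ≤ ε / 2 * c := by gcongr
  linarith

lemma IsTangent.neg {μ : Measure (Space d)} {ξ : Space d → Space d} (hξ : IsTangent μ ξ) :
    IsTangent μ (fun x => -ξ x) := by
  refine ⟨hξ.1.neg, fun ε hε => ?_⟩
  obtain ⟨ψ, h1, h2, h3⟩ := hξ.2 ε hε
  refine ⟨-ψ, h1.neg, ?_, ?_⟩
  · exact h2.comp_left (g := fun x : ℝ => -x) neg_zero
  · rw [← eLpNorm_neg]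
    convert h3 using 2
    funext x
    have : gradient (-ψ) x = -gradient ψ x := by
      simp only [gradient, fderiv_neg, map_neg]
    simp only [Pi.neg_apply, this]
    abel

variable {Ω : Type*} [MeasurableSpace Ω] {P : Measure Ω} [IsProbabilityMeasure P]
  {X Y η : Ω → Space d}

/-- First order expansion along arbitrary couplings. -/
theorem IsWassersteinGradient.expansion {φ : Measure (Space d) → ℝ} {ξ : Space d → Space d}
    {R₀ : ℝ} (hX : AEMeasurable X P) (hXR : ∀ᵐ ω ∂P, ‖X ω‖ ≤ R₀)
    (h : IsWassersteinGradient φ (P.map X) ξ) {R : ℝ} (hR : 0 < R) {ε : ℝ} (hε : 0 < ε) :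
    ∃ δ > 0, ∀ Y : Ω → Space d, AEMeasurable Y P → (∀ᵐ ω ∂P, ‖Y ω - X ω‖ ≤ R) →
      Real.sqrt (∫ ω, ‖Y ω - X ω‖ ^ 2 ∂P) ≤ δ →
      |φ (P.map Y) - φ (P.map X) - ∫ ω, inner ℝ (ξ (X ω)) (Y ω - X ω) ∂P| ≤
        ε * Real.sqrt (∫ ω, ‖Y ω - X ω‖ ^ 2 ∂P) := by
  have hμ := map_mem_probOn hX hXR
  obtain ⟨δ₁, hδ₁, h1⟩ := h.2.1.le_of_plan h.1 hμ hR hε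
  obtain ⟨δ₂, hδ₂, h2⟩ := IsSubgradient.le_of_plan h.2.2 h.1.neg hμ hR hε
  refine ⟨min δ₁ δ₂, by positivity, fun Y hY hYX hle => ?_⟩
  have hplan := map_prodMk_mem_plans hX hY
  have hsupp : ∀ᵐ ω ∂P, X ω ∈ (P.map X).support :=
    ae_of_ae_map hX Measure.support_mem_ae
  have hν : P.map Y ∈ probOn (fattening (P.map X) R) := by
    refine ⟨Measure.isProbabilityMeasure_map hY, ?_⟩
    rw [Measure.map_apply_of_aemeasurable hY, preimage_compl]
    · refine mem_ae_iff.1 ?_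
      filter_upwards [hsupp, hYX] with ω hω hω'
      exact mem_iUnion₂.2 ⟨X ω, hω, by simpa [dist_eq_norm] using hω'⟩
    · rw [fattening_eq_cthickening hμ hR.le]
      exact Metric.isClosed_cthickening.measurableSet.compl
  have hcost : planCost 2 (P.map (fun ω => (X ω, Y ω))) =
      Real.sqrt (∫ ω, ‖Y ω - X ω‖ ^ 2 ∂P) := by
    rw [planCost_two_map_prodMk hX hY]; simp_rw [norm_sub_rev]
  have hξm : AEStronglyMeasurable (fun z : Space d × Space d => inner ℝ (ξ z.1) (z.2 - z.1))
      (P.map (fun ω => (X ω, Y ω))) := by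
    have hmp1 : MeasurePreserving Prod.fst (P.map (fun ω => (X ω, Y ω))) (P.map X) :=
      ⟨measurable_fst, hplan.2.1⟩
    exact (h.1.1.comp_measurePreserving hmp1).1.inner (by fun_prop)
  have hint := integral_map (hX.prodMk hY) hξm
  have a1 := h1 _ hν _ hplan (by rw [hcost]; exact hle.trans (min_le_left _ _))
  have a2 := h2 _ hν _ hplan (by rw [hcost]; exact hle.trans (min_le_right _ _))
  simp only [inner_neg_left, integral_neg] at a2
  rw [hint, hcost] at a1 a2
  rw [abs_le]
  constructor <;> linarith

/-- The directional derivative of a differentiable function of measures, along the transport of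
mass by a bounded displacement. -/
theorem IsWassersteinGradient.hasDerivAt {φ : Measure (Space d) → ℝ} {ξ : Space d → Space d}
    {R₀ : ℝ} (hX : AEMeasurable X P) (hXR : ∀ᵐ ω ∂P, ‖X ω‖ ≤ R₀)
    (h : IsWassersteinGradient φ (P.map X) ξ) (hη : AEMeasurable η P) {H : ℝ}
    (hηH : ∀ᵐ ω ∂P, ‖η ω‖ ≤ H) :
    HasDerivAt (fun t : ℝ => φ (P.map (fun ω => X ω + t • η ω)))
      (∫ ω, inner ℝ (ξ (X ω)) (η ω) ∂P) 0 := by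
  set W := Real.sqrt (∫ ω, ‖η ω‖ ^ 2 ∂P) with hW
  have hW0 : 0 ≤ W := Real.sqrt_nonneg _
  rw [hasDerivAt_iff_isLittleO, Asymptotics.isLittleO_iff]
  intro c hc
  -- For `|t| ≤ 1` the displacement `t • η` stays within `|H| + 1`. Dividing by `W + 1` rather than
  -- `W` also covers a vanishing displacement.
  obtain ⟨δ, hδ, hexp⟩ := h.expansion hX hXR (R := |H| + 1) (by positivity)
    (ε := c / (W + 1)) (by positivity)
  have hev : ∀ᶠ t : ℝ in 𝓝 0, |t| < min 1 (δ / (W + 1)) := by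
    have := Metric.ball_mem_nhds (0 : ℝ) (show 0 < min 1 (δ / (W + 1)) by positivity)
    filter_upwards [this] with t ht
    simpa [Real.dist_eq] using ht
  filter_upwards [hev] with t ht
  have hcost : Real.sqrt (∫ ω, ‖X ω + t • η ω - X ω‖ ^ 2 ∂P) = |t| * W := by
    simp_rw [add_sub_cancel_left, norm_smul, mul_pow, integral_const_mul]
    rw [Real.sqrt_mul (by positivity), Real.sqrt_sq (norm_nonneg _)]
    rfl
  have h1 := hexp (fun ω => X ω + t • η ω) (hX.add (hη.const_smul t)) ?_ ?_
  · rw [hcost] at h1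
    simp only [add_sub_cancel_left, inner_smul_right, integral_const_mul] at h1
    simp only [zero_smul, add_zero, sub_zero, smul_eq_mul, Real.norm_eq_abs]
    refine h1.trans ?_
    have : W / (W + 1) ≤ 1 := by rw [div_le_one (by positivity)]; linarith
    calc c / (W + 1) * (|t| * W) = c * |t| * (W / (W + 1)) := by ring
      _ ≤ c * |t| * 1 := by gcongr
      _ = c * |t| := mul_one _
  · filter_upwards [hηH] with ω hω
    rw [add_sub_cancel_left, norm_smul, Real.norm_eq_abs]
    have h1 : |t| ≤ 1 := ht.le.trans (min_le_left _ _)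
    calc |t| * ‖η ω‖ ≤ 1 * |H| := by
          gcongr; exact hω.trans (le_abs_self H)
      _ ≤ |H| + 1 := by linarith
  · rw [hcost]
    calc |t| * W ≤ δ / (W + 1) * (W + 1) := by
          gcongr
          · exact ht.le.trans (min_le_right _ _)
          · linarith
      _ = δ := by field_simp

end Gradient

/-! ### Calculus for a velocity field at a fixed time -/

section Differential

variable {Ω : Type*} [MeasurableSpace Ω] {P : Measure Ω} [IsProbabilityMeasure P]
  {X Y η : Ω → Space d} {V : Measure (Space d) → Space d} {D : Space d → Space d →L[ℝ] Space d}
  {R H : ℝ}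

lemma inner_row (A : Space d →L[ℝ] Space d) (i : Fin d) (h : Space d) :
    inner ℝ (row A i) h = A h i := by
  rw [row, ContinuousLinearMap.adjoint_inner_left, EuclideanSpace.inner_single_left]
  simp

/-- Componentwise: the rows are square integrable as part of being gradients, and the displacement
is bounded. -/
lemma IsWassersteinDifferential.integrable (hD : IsWassersteinDifferential V (P.map X) D)
    (hX : AEMeasurable X P) (hη : AEMeasurable η P) (hηH : ∀ᵐ ω ∂P, ‖η ω‖ ≤ H) :
    Integrable (fun ω => D (X ω) (η ω)) P := by
  refine Integrable.of_eval_piLp fun i => ?_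
  have h1 : MemLp (fun ω => row (D (X ω)) i) 2 P := (hD i).1.1.comp_of_map hX
  have h2 := integrable_inner_of_memLp h1 (memLp_of_ae_bound 2 hη hηH)
  simpa only [inner_row] using h2

lemma IsWassersteinDifferential.hasDerivAt (hD : IsWassersteinDifferential V (P.map X) D)
    (hX : AEMeasurable X P) (hXR : ∀ᵐ ω ∂P, ‖X ω‖ ≤ R) (hη : AEMeasurable η P)
    (hηH : ∀ᵐ ω ∂P, ‖η ω‖ ≤ H) :
    HasDerivAt (fun t : ℝ => V (P.map (fun ω => X ω + t • η ω))) (∫ ω, D (X ω) (η ω) ∂P) 0 := by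
  have hint := hD.integrable hX hη hηH
  have key (i : Fin d) : HasDerivAt (fun t : ℝ => V (P.map (fun ω => X ω + t • η ω)) i)
      ((∫ ω, D (X ω) (η ω) ∂P) i) 0 := by
    rw [eval_integral_piLp fun i => hint.eval_piLp i]
    simpa only [inner_row] using (hD i).hasDerivAt hX hXR hη hηH
  rw [hasDerivAt_iff_hasFDerivAt, ← hasFDerivWithinAt_univ, hasFDerivWithinAt_euclidean]
  intro i
  rw [hasFDerivWithinAt_univ]
  refine (key i).hasFDerivAt.congr_fderiv ?_
  ext
  simp

omit [IsProbabilityMeasure P] in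
lemma ae_norm_add_smul_le (hXR : ∀ᵐ ω ∂P, ‖X ω‖ ≤ R) (hηH : ∀ᵐ ω ∂P, ‖η ω‖ ≤ H) {t : ℝ} {c : ℝ}
    (ht : |t| * |H| ≤ c) : ∀ᵐ ω ∂P, ‖X ω + t • η ω‖ ≤ R + c := by
  filter_upwards [hXR, hηH] with ω h1 h2
  refine (norm_add_le _ _).trans (add_le_add h1 ?_)
  rw [norm_smul, Real.norm_eq_abs]
  exact le_trans (by gcongr; exact h2.trans (le_abs_self H)) ht

/-- The integral is the derivative at `0` of `V` along `X + t η`, hence at most the `W₁`-Lipschitz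
constant times the speed `∫ ‖η‖`. This bounds the nonlocal term by a rate integrable in time,
although no such bound on the differential itself is assumed. The radius `R + 1` leaves room for
small displacements. -/
lemma IsWassersteinDifferential.norm_integral_le (hD : IsWassersteinDifferential V (P.map X) D)
    (hX : AEMeasurable X P) (hXR : ∀ᵐ ω ∂P, ‖X ω‖ ≤ R) (hη : AEMeasurable η P)
    (hηH : ∀ᵐ ω ∂P, ‖η ω‖ ≤ H) {L : ℝ} (hL0 : 0 ≤ L)
    (hL : ∀ μ ∈ probOn (Metric.closedBall (0 : Space d) (R + 1)),
      ∀ ν ∈ probOn (Metric.closedBall (0 : Space d) (R + 1)), ‖V μ - V ν‖ ≤ L * wasserstein 1 μ ν) :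
    ‖∫ ω, D (X ω) (η ω) ∂P‖ ≤ L * ∫ ω, ‖η ω‖ ∂P := by
  have hi : 0 ≤ ∫ ω, ‖η ω‖ ∂P := integral_nonneg fun _ => norm_nonneg _
  refine (hD.hasDerivAt hX hXR hη hηH).le_of_lip' (by positivity) ?_
  have hev : ∀ᶠ t : ℝ in 𝓝 0, |t| * |H| ≤ 1 := by
    have hc : Continuous fun t : ℝ => |t| * |H| := by fun_prop
    have := hc.tendsto 0
    simp only [abs_zero, zero_mul] at this
    exact this.eventually (ge_mem_nhds one_pos)
  filter_upwards [hev] with t ht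
  have hm : AEMeasurable (fun ω => X ω + t • η ω) P := hX.add (hη.const_smul t)
  have h1 := map_mem_probOn hm (ae_norm_add_smul_le hXR hηH ht)
  have h2 := map_mem_probOn hX (hXR.mono fun ω h => h.trans (by linarith : R ≤ R + 1))
  simp only [zero_smul, add_zero, sub_zero]
  refine (hL _ h1 _ h2).trans ?_
  rw [mul_assoc]
  refine mul_le_mul_of_nonneg_left ?_ hL0
  refine (wasserstein_one_map_le (R := 1) hm hX ?_).trans (le_of_eq ?_)
  · filter_upwards [hηH] with ω h
    rw [add_sub_cancel_left, norm_smul, Real.norm_eq_abs]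
    exact le_trans (by gcongr; exact h.trans (le_abs_self H)) ht
  · simp_rw [add_sub_cancel_left, norm_smul, integral_const_mul, mul_comm]

end Differential

lemma measurableSet_norm_le_and_norm_le (R : ℝ) :
    MeasurableSet {z : Space d × Space d | ‖z.1‖ ≤ R ∧ ‖z.2‖ ≤ R} :=
  (measurableSet_le (measurable_norm.comp measurable_fst) measurable_const).inter
    (measurableSet_le (measurable_norm.comp measurable_snd) measurable_const)

/-- The regularity of a velocity field at a fixed time, on the ball of radius `R`. -/
structure FrozenField (R l L : ℝ) (V : Measure (Space d) → Space d → Space d)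
    (D : Measure (Space d) → Space d → Space d → Space d →L[ℝ] Space d) : Prop where
  l_nonneg : 0 ≤ l
  L_nonneg : 0 ≤ L
  lip : ∀ μ ∈ probOn (Metric.closedBall (0 : Space d) (R + 1)),
    ∀ ν ∈ probOn (Metric.closedBall (0 : Space d) (R + 1)),
    ∀ x ∈ Metric.closedBall (0 : Space d) (R + 1), ∀ y ∈ Metric.closedBall (0 : Space d) (R + 1),
      ‖V μ x - V μ y‖ ≤ l * ‖x - y‖ ∧ ‖V μ x - V ν x‖ ≤ L * wasserstein 1 μ ν
  diff : ∀ μ ∈ compactlySupported d, Differentiable ℝ (V μ)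
  wdiff : ∀ μ ∈ compactlySupported d, ∀ x, IsWassersteinDifferential (fun ν => V ν x) μ (D μ x)
  unif_space : ∀ ε > 0, ∃ δ > 0, ∀ γ : Measure (Space d × Space d), IsProbabilityMeasure γ →
    (∀ᵐ z ∂γ, ‖z.1‖ ≤ R ∧ ‖z.2‖ ≤ R) → ∀ x x' : Space d, ‖x‖ ≤ R → ‖x'‖ ≤ R →
      ∫ p, ‖p.1 - p.2‖ ∂γ ≤ δ → ‖x - x'‖ ≤ δ →
      ‖fderiv ℝ (V (γ.map Prod.snd)) x' - fderiv ℝ (V (γ.map Prod.fst)) x‖ ≤ ε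
  unif_measure : ∀ ε > 0, ∃ δ > 0, ∀ γ : Measure (Space d × Space d), IsProbabilityMeasure γ →
    (∀ᵐ z ∂γ, ‖z.1‖ ≤ R ∧ ‖z.2‖ ≤ R) → ∀ x x' y y' : Space d, ‖x‖ ≤ R → ‖x'‖ ≤ R →
      ‖y‖ ≤ R → ‖y'‖ ≤ R → ∫ p, ‖p.1 - p.2‖ ∂γ ≤ δ → ‖x - x'‖ ≤ δ → ‖y - y'‖ ≤ δ →
      ‖D (γ.map Prod.snd) x' y' - D (γ.map Prod.fst) x y‖ ≤ ε
  bound : ∃ M, ∀ μ ∈ probOn (Metric.closedBall (0 : Space d) R), ∀ x y : Space d, ‖x‖ ≤ R →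
    ‖y‖ ≤ R → ‖D μ x y‖ ≤ M

/-- Pointwise continuity of the two differentials becomes uniform by compactness. The Lipschitz
bounds are taken on radius `R + 1`, so that they control derivatives up to the boundary of the ball
of radius `R`. -/
lemma HypCE.ae_frozenField {T : ℝ} {v : ℝ → Measure (Space d) → Space d → Space d}
    {Dv : ℝ → Measure (Space d) → Space d → Space d → Space d →L[ℝ] Space d}
    (hv : HypCE T v Dv) {R : ℝ} (hR : 0 < R) :
    ∃ l L : ℝ → ℝ, IntegrableOn l (Icc 0 T) ∧ (∀ t, 0 ≤ l t) ∧ IntegrableOn L (Icc 0 T) ∧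
      (∀ t, 0 ≤ L t) ∧ ∀ᵐ t ∂(volume.restrict (Icc 0 T)), FrozenField R (l t) (L t) (v t) (Dv t) := by
  obtain ⟨l, L, hl, hl0, hL, hL0, hlip⟩ := hv.lipschitz (R + 1) (by linarith)
  refine ⟨l, L, hl, hl0, hL, hL0, ?_⟩
  filter_upwards [hlip, hv.differentiable_space, hv.differentiable_measure,
    hv.continuous_space R hR, hv.continuous_measure R hR] with t h1 h2 h3 h4 h5
  have u1 := uniform_of_wasserstein_continuous (R := R) (Z := Ball d R)
    (f := fun μ x => fderiv ℝ (v t μ) x) (fun μ hμ x ε hε => by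
      obtain ⟨δ, hδ, h⟩ := h4 μ hμ x x.2 ε hε
      refine ⟨δ, hδ, fun ν hν x' hW hx => h ν hν x' x'.2 hW ?_⟩
      rwa [Subtype.dist_eq, dist_eq_norm] at hx)
  have u2 := uniform_of_wasserstein_continuous (R := R) (Z := Ball d R × Ball d R)
    (f := fun μ q => Dv t μ q.1 q.2) (fun μ hμ q ε hε => by
      obtain ⟨δ, hδ, h⟩ := h5 μ hμ q.1 q.1.2 q.2 q.2.2 ε hε
      refine ⟨δ, hδ, fun ν hν q' hW hx => h ν hν q'.1 q'.1.2 q'.2 q'.2.2 hW ?_ ?_⟩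
      · rw [← dist_eq_norm, ← Subtype.dist_eq]
        exact (le_max_left _ _).trans_lt hx
      · rw [← dist_eq_norm, ← Subtype.dist_eq]
        exact (le_max_right _ _).trans_lt hx)
  have mem {x : Space d} (hx : ‖x‖ ≤ R) : x ∈ Metric.closedBall (0 : Space d) R :=
    mem_closedBall_zero_iff.2 hx
  refine ⟨hl0 t, hL0 t, h1, h2, h3, fun ε hε => ?_, fun ε hε => ?_, ?_⟩
  · obtain ⟨δ, hδ, h⟩ := u1.1 ε hε
    refine ⟨δ, hδ, fun γ hγ hγR x x' hx hx' hc hxx => ?_⟩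
    refine h γ hγ hγR ⟨x, mem hx⟩ ⟨x', mem hx'⟩ hc ?_
    rwa [Subtype.dist_eq, dist_eq_norm]
  · obtain ⟨δ, hδ, h⟩ := u2.1 ε hε
    refine ⟨δ, hδ, fun γ hγ hγR x x' y y' hx hx' hy hy' hc hxx hyy => ?_⟩
    refine h γ hγ hγR (⟨x, mem hx⟩, ⟨y, mem hy⟩) (⟨x', mem hx'⟩, ⟨y', mem hy'⟩) hc ?_
    rw [Prod.dist_eq, Subtype.dist_eq, Subtype.dist_eq, dist_eq_norm, dist_eq_norm]
    exact max_le hxx hyy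
  · obtain ⟨M, hM⟩ := u2.2
    exact ⟨M, fun μ hμ x y hx hy => hM μ hμ (⟨x, mem hx⟩, ⟨y, mem hy⟩)⟩

/-! ### Estimates and uniform Taylor expansions at a fixed time. -/

namespace FrozenField

variable {R l L : ℝ} {V : Measure (Space d) → Space d → Space d}
  {D : Measure (Space d) → Space d → Space d → Space d →L[ℝ] Space d}
  {Ω : Type*} [MeasurableSpace Ω] {X Y η : Ω → Space d}

lemma closedBall_subset : Metric.closedBall (0 : Space d) R ⊆ Metric.closedBall 0 (R + 1) :=
  Metric.closedBall_subset_closedBall (by linarith)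

/-- The Lipschitz estimate along couplings. -/
lemma norm_sub_le (h : FrozenField R l L V D) {P : Measure Ω} [IsProbabilityMeasure P]
    (hX : AEMeasurable X P) (hXR : ∀ᵐ ω ∂P, ‖X ω‖ ≤ R) (hY : AEMeasurable Y P)
    (hYR : ∀ᵐ ω ∂P, ‖Y ω‖ ≤ R) {x y : Space d} (hx : ‖x‖ ≤ R) (hy : ‖y‖ ≤ R) :
    ‖V (P.map X) x - V (P.map Y) y‖ ≤ l * ‖x - y‖ + L * ∫ ω, ‖X ω - Y ω‖ ∂P := by
  have hμ := probOn_mono closedBall_subset (map_mem_probOn hX hXR)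
  have hν := probOn_mono closedBall_subset (map_mem_probOn hY hYR)
  have hx' := closedBall_subset (mem_closedBall_zero_iff.2 hx)
  have hy' := closedBall_subset (mem_closedBall_zero_iff.2 hy)
  have hW := wasserstein_one_map_le (P := P) (R := R + R) hX hY (by
    filter_upwards [hXR, hYR] with ω h1 h2 using (_root_.norm_sub_le _ _).trans (add_le_add h1 h2))
  calc ‖V (P.map X) x - V (P.map Y) y‖
      ≤ ‖V (P.map X) x - V (P.map X) y‖ + ‖V (P.map X) y - V (P.map Y) y‖ :=
        norm_sub_le_norm_sub_add_norm_sub _ _ _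
    _ ≤ l * ‖x - y‖ + L * wasserstein 1 (P.map X) (P.map Y) :=
        add_le_add (h.lip _ hμ _ hν x hx' y hy').1 (h.lip _ hμ _ hν y hy' y hy').2
    _ ≤ _ := by gcongr; exact h.L_nonneg

lemma norm_fderiv_le (h : FrozenField R l L V D) {μ : Measure (Space d)}
    (hμ : μ ∈ probOn (Metric.closedBall (0 : Space d) R)) {x : Space d} (hx : ‖x‖ ≤ R) :
    ‖fderiv ℝ (V μ) x‖ ≤ l := by
  have hμ' := probOn_mono closedBall_subset hμ
  refine norm_fderiv_le_of_lip' ℝ h.l_nonneg ?_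
  filter_upwards [Metric.closedBall_mem_nhds x one_pos] with y hy
  have hx' := closedBall_subset (mem_closedBall_zero_iff.2 hx)
  refine (h.lip μ hμ' μ hμ' y ?_ x hx').1
  rw [mem_closedBall_iff_norm] at hy
  rw [mem_closedBall_zero_iff]
  calc ‖y‖ = ‖x + (y - x)‖ := by congr 1; abel
    _ ≤ R + 1 := (norm_add_le _ _).trans (add_le_add hx hy)

variable {P : Measure Ω} [IsProbabilityMeasure P] {H : ℝ}

lemma integrable_differential (h : FrozenField R l L V D) (hX : AEMeasurable X P)
    (hXR : ∀ᵐ ω ∂P, ‖X ω‖ ≤ R) (hη : AEMeasurable η P) (hηH : ∀ᵐ ω ∂P, ‖η ω‖ ≤ H) (x : Space d) :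
    Integrable (fun ω => D (P.map X) x (X ω) (η ω)) P :=
  (h.wdiff _ (probOn_closedBall_subset_compactlySupported (map_mem_probOn hX hXR)) x).integrable
    hX hη hηH

lemma norm_integral_differential_le (h : FrozenField R l L V D) (hX : AEMeasurable X P)
    (hXR : ∀ᵐ ω ∂P, ‖X ω‖ ≤ R) (hη : AEMeasurable η P) (hηH : ∀ᵐ ω ∂P, ‖η ω‖ ≤ H) {x : Space d}
    (hx : ‖x‖ ≤ R) :
    ‖∫ ω, D (P.map X) x (X ω) (η ω) ∂P‖ ≤ L * ∫ ω, ‖η ω‖ ∂P := by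
  have hx' := closedBall_subset (mem_closedBall_zero_iff.2 hx)
  exact (h.wdiff _ (probOn_closedBall_subset_compactlySupported
    (map_mem_probOn hX hXR)) x).norm_integral_le hX hXR hη hηH h.L_nonneg
    fun μ hμ ν hν => (h.lip μ hμ ν hν x hx' x hx').2

lemma hasDerivAt (h : FrozenField R l L V D) (hX : AEMeasurable X P)
    (hXR : ∀ᵐ ω ∂P, ‖X ω‖ ≤ R) (hη : AEMeasurable η P) (hηH : ∀ᵐ ω ∂P, ‖η ω‖ ≤ H) (x : Space d) :
    HasDerivAt (fun t : ℝ => V (P.map (fun ω => X ω + t • η ω)) x)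
      (∫ ω, D (P.map X) x (X ω) (η ω) ∂P) 0 :=
  (h.wdiff _ (probOn_closedBall_subset_compactlySupported
    (map_mem_probOn hX hXR)) x).hasDerivAt hX hXR hη hηH

lemma unif_measure_map (h : FrozenField R l L V D) {ε : ℝ} (hε : 0 < ε) :
    ∃ δ > 0, ∀ (P : Measure Ω) [IsProbabilityMeasure P] (X Y : Ω → Space d), AEMeasurable X P →
      AEMeasurable Y P → (∀ᵐ ω ∂P, ‖X ω‖ ≤ R) → (∀ᵐ ω ∂P, ‖Y ω‖ ≤ R) →
      ∀ x x' y y' : Space d, ‖x‖ ≤ R → ‖x'‖ ≤ R → ‖y‖ ≤ R → ‖y'‖ ≤ R →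
      ∫ ω, ‖X ω - Y ω‖ ∂P ≤ δ → ‖x - x'‖ ≤ δ → ‖y - y'‖ ≤ δ →
      ‖D (P.map Y) x' y' - D (P.map X) x y‖ ≤ ε := by
  obtain ⟨δ, hδ, hu⟩ := h.unif_measure ε hε
  refine ⟨δ, hδ, fun P _ X Y hX hY hXR hYR x x' y y' hx hx' hy hy' hc hxx hyy => ?_⟩
  have hm := hX.prodMk hY
  have hplan := map_prodMk_mem_plans (P := P) hX hY
  have := hu (P.map fun ω => (X ω, Y ω)) hplan.1 (by
    exact (ae_map_iff hm (measurableSet_norm_le_and_norm_le R)).2 (hXR.and hYR))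
    x x' y y' hx hx' hy hy' (by rwa [integral_map hm (by fun_prop)]) hxx hyy
  rwa [hplan.2.1, hplan.2.2] at this

lemma unif_space_map (h : FrozenField R l L V D) {ε : ℝ} (hε : 0 < ε) :
    ∃ δ > 0, ∀ (P : Measure Ω) [IsProbabilityMeasure P] (X Y : Ω → Space d), AEMeasurable X P →
      AEMeasurable Y P → (∀ᵐ ω ∂P, ‖X ω‖ ≤ R) → (∀ᵐ ω ∂P, ‖Y ω‖ ≤ R) →
      ∀ x x' : Space d, ‖x‖ ≤ R → ‖x'‖ ≤ R → ∫ ω, ‖X ω - Y ω‖ ∂P ≤ δ → ‖x - x'‖ ≤ δ →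
      ‖fderiv ℝ (V (P.map Y)) x' - fderiv ℝ (V (P.map X)) x‖ ≤ ε := by
  obtain ⟨δ, hδ, hu⟩ := h.unif_space ε hε
  refine ⟨δ, hδ, fun P _ X Y hX hY hXR hYR x x' hx hx' hc hxx => ?_⟩
  have hm := hX.prodMk hY
  have hplan := map_prodMk_mem_plans (P := P) hX hY
  have := hu (P.map fun ω => (X ω, Y ω)) hplan.1 (by
    exact (ae_map_iff hm (measurableSet_norm_le_and_norm_le R)).2 (hXR.and hYR))
    x x' hx hx' (by rwa [integral_map hm (by fun_prop)]) hxx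
  rwa [hplan.2.1, hplan.2.2] at this

omit [IsProbabilityMeasure P] in
lemma ae_norm_segment_le (hXR : ∀ᵐ ω ∂P, ‖X ω‖ ≤ R) (hYR : ∀ᵐ ω ∂P, ‖Y ω‖ ≤ R) {t : ℝ}
    (ht : t ∈ Icc (0 : ℝ) 1) : ∀ᵐ ω ∂P, ‖X ω + t • (Y ω - X ω)‖ ≤ R := by
  filter_upwards [hXR, hYR] with ω h1 h2
  have := (convex_closedBall (0 : Space d) R).add_smul_sub_mem (mem_closedBall_zero_iff.2 h1)
    (mem_closedBall_zero_iff.2 h2) ht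
  exact mem_closedBall_zero_iff.1 this

/-- The first order expansion in the measure, uniformly over couplings. -/
theorem taylor_measure (h : FrozenField R l L V D) {ε : ℝ} (hε : 0 < ε) :
    ∃ δ > 0, ∀ (P : Measure Ω) [IsProbabilityMeasure P] (X Y : Ω → Space d), AEMeasurable X P →
      AEMeasurable Y P → (∀ᵐ ω ∂P, ‖X ω‖ ≤ R) → (∀ᵐ ω ∂P, ‖Y ω‖ ≤ R) → ∀ x : Space d, ‖x‖ ≤ R →
      Real.sqrt (∫ ω, ‖Y ω - X ω‖ ^ 2 ∂P) ≤ δ →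
      ‖V (P.map Y) x - V (P.map X) x - ∫ ω, D (P.map X) x (X ω) (Y ω - X ω) ∂P‖ ≤
        ε * Real.sqrt (∫ ω, ‖Y ω - X ω‖ ^ 2 ∂P) := by
  obtain ⟨δ, hδ, hu⟩ := h.unif_measure_map (Ω := Ω) (ε := ε / 2) (by positivity)
  obtain ⟨M, hM⟩ := h.bound
  -- Where the displacement exceeds `δ` the modulus of continuity says nothing; there the difference
  -- of differentials is at most `2 * |M| = C * δ ≤ C * ‖η ω‖`, which contributes only a quadratic
  -- term.
  set C := 2 * |M| / δ with hC
  have hC0 : 0 ≤ C := by positivity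
  refine ⟨min δ (ε / (2 * (C + 1))), by positivity, fun P _ X Y hX hY hXR hYR x hx hle => ?_⟩
  set W := Real.sqrt (∫ ω, ‖Y ω - X ω‖ ^ 2 ∂P) with hW
  have hW0 : 0 ≤ W := Real.sqrt_nonneg _
  set η : Ω → Space d := fun ω => Y ω - X ω with hηdef
  have hη : AEMeasurable η P := hY.sub hX
  have hηH : ∀ᵐ ω ∂P, ‖η ω‖ ≤ R + R := by
    filter_upwards [hXR, hYR] with ω h1 h2 using (_root_.norm_sub_le _ _).trans (add_le_add h2 h1)
  have hη2 : MemLp η 2 P := memLp_of_ae_bound 2 hη hηH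
  have hW1 : ∫ ω, ‖η ω‖ ∂P ≤ W := integral_norm_le_sqrt hη2
  have hWsq : ∫ ω, ‖η ω‖ ^ 2 ∂P = W ^ 2 := by
    rw [hW, Real.sq_sqrt (integral_nonneg fun _ => by positivity)]
  let Z : ℝ → Ω → Space d := fun t ω => X ω + t • η ω
  have hZ (t : ℝ) : AEMeasurable (Z t) P := hX.add (hη.const_smul t)
  have hZR {t : ℝ} (ht : t ∈ Icc (0 : ℝ) 1) : ∀ᵐ ω ∂P, ‖Z t ω‖ ≤ R :=
    ae_norm_segment_le hXR hYR ht
  set A := ∫ ω, D (P.map X) x (X ω) (η ω) ∂P with hA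
  -- The segment from `X` to `Y` has constant velocity `η`, so differentiability at the law of `Z t`
  -- in direction `η` gives the derivative at every `t`. Subtracting `t • A` leaves the variation of
  -- the differential along the segment, to which the mean value inequality applies.
  have hderiv : ∀ t ∈ Icc (0 : ℝ) 1, HasDerivWithinAt (fun t => V (P.map (Z t)) x - t • A)
      (∫ ω, D (P.map (Z t)) x (Z t ω) (η ω) ∂P - A) (Icc 0 1) t := by
    intro t ht
    have h1 := h.hasDerivAt (hZ t) (hZR ht) hη hηH x
    have h2 : HasDerivAt (fun s => V (P.map (fun ω => Z t ω + (s - t) • η ω)) x)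
        (∫ ω, D (P.map (Z t)) x (Z t ω) (η ω) ∂P) t :=
      HasDerivAt.comp_sub_const (f := fun s => V (P.map (fun ω => Z t ω + s • η ω)) x) t t
        (by rwa [sub_self])
    have h3 : (fun s => V (P.map (fun ω => Z t ω + (s - t) • η ω)) x) =
        fun s => V (P.map (Z s)) x := by
      funext s
      congr 2
      funext ω
      simp only [Z, sub_smul]
      abel
    rw [h3] at h2
    have h4 : HasDerivAt (fun t : ℝ => t • A) A t := by
      simpa using (hasDerivAt_id t).smul_const A
    exact (h2.sub h4).hasDerivWithinAt
  have hbound : ∀ t ∈ Ico (0 : ℝ) 1,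
      ‖∫ ω, D (P.map (Z t)) x (Z t ω) (η ω) ∂P - A‖ ≤ ε * W := by
    intro t ht
    have ht' : t ∈ Icc (0 : ℝ) 1 := Ico_subset_Icc_self ht
    rw [hA, ← integral_sub (h.integrable_differential (hZ t) (hZR ht') hη hηH x)
      (h.integrable_differential hX hXR hη hηH x)]
    have hdist : ∫ ω, ‖X ω - Z t ω‖ ∂P ≤ δ := by
      calc ∫ ω, ‖X ω - Z t ω‖ ∂P = t * ∫ ω, ‖η ω‖ ∂P := by
            rw [← integral_const_mul]
            refine integral_congr_ae (Eventually.of_forall fun ω => ?_)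
            simp only [Z, sub_add_cancel_left, norm_neg, norm_smul, Real.norm_eq_abs,
              abs_of_nonneg ht.1]
        _ ≤ 1 * W := by
            gcongr
            exact ht.2.le
        _ ≤ δ := by rw [one_mul]; exact hle.trans (min_le_left _ _)
    have hpt : ∀ᵐ ω ∂P, ‖D (P.map (Z t)) x (Z t ω) (η ω) - D (P.map X) x (X ω) (η ω)‖ ≤
        ε / 2 * ‖η ω‖ + C * ‖η ω‖ ^ 2 := by
      filter_upwards [hXR, hZR ht'] with ω h1 h2
      rw [← sub_apply]
      refine (ContinuousLinearMap.le_opNorm _ _).trans ?_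
      by_cases hs : ‖η ω‖ ≤ δ
      · have h3 := hu P X (Z t) hX (hZ t) hXR (hZR ht') x x (X ω) (Z t ω) hx hx h1 h2 hdist
          (by simpa using hδ.le) (by
            simp only [Z, sub_add_cancel_left, norm_neg, norm_smul, Real.norm_eq_abs,
              abs_of_nonneg ht.1]
            calc t * ‖η ω‖ ≤ 1 * ‖η ω‖ := by gcongr; exact ht.2.le
              _ ≤ δ := by rw [one_mul]; exact hs)
        calc _ ≤ ε / 2 * ‖η ω‖ := by gcongr
          _ ≤ _ := le_add_of_nonneg_right (by positivity)
      · push Not at hs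
        have h3 : ‖D (P.map (Z t)) x (Z t ω) - D (P.map X) x (X ω)‖ ≤ 2 * |M| := by
          refine (_root_.norm_sub_le _ _).trans ?_
          have e1 := hM _ (map_mem_probOn (hZ t) (hZR ht')) x (Z t ω) hx h2
          have e2 := hM _ (map_mem_probOn hX hXR) x (X ω) hx h1
          linarith [le_abs_self M]
        calc _ ≤ 2 * |M| * ‖η ω‖ := by gcongr
          _ = C * (δ * ‖η ω‖) := by rw [hC]; field_simp
          _ ≤ C * (‖η ω‖ * ‖η ω‖) := by gcongr
          _ = C * ‖η ω‖ ^ 2 := by ring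
          _ ≤ _ := le_add_of_nonneg_left (by positivity)
    calc ‖∫ ω, (D (P.map (Z t)) x (Z t ω) (η ω) - D (P.map X) x (X ω) (η ω)) ∂P‖
        ≤ ∫ ω, (ε / 2 * ‖η ω‖ + C * ‖η ω‖ ^ 2) ∂P := by
          refine norm_integral_le_of_norm_le ?_ hpt
          exact ((hη2.integrable (by norm_num)).norm.const_mul _).add
            ((hη2.integrable_norm_pow two_ne_zero).const_mul _)
      _ = ε / 2 * ∫ ω, ‖η ω‖ ∂P + C * W ^ 2 := by
          rw [integral_add ((hη2.integrable (by norm_num)).norm.const_mul _)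
            ((hη2.integrable_norm_pow two_ne_zero).const_mul _), integral_const_mul,
            integral_const_mul, hWsq]
      _ ≤ ε / 2 * W + ε / 2 * W := by
          have h2 : W ≤ ε / (2 * (C + 1)) := hle.trans (min_le_right _ _)
          have h3 : C * W ≤ ε / 2 := by
            calc C * W ≤ (C + 1) * (ε / (2 * (C + 1))) := by gcongr; linarith
              _ = ε / 2 := by field_simp
          have h4 : C * W ^ 2 ≤ ε / 2 * W := by rw [pow_two, ← mul_assoc]; gcongr
          have h5 : ε / 2 * ∫ ω, ‖η ω‖ ∂P ≤ ε / 2 * W := by gcongr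
          linarith
      _ = ε * W := by ring
  have hfin := norm_image_sub_le_of_norm_deriv_le_segment_01' hderiv hbound
  have e0 : Z 0 = X := by funext ω; simp [Z]
  have e1 : Z 1 = Y := by funext ω; simp [Z, η]
  simp only [e0, e1, one_smul, zero_smul, sub_zero] at hfin
  rwa [sub_right_comm]

/-- The first order expansion in the measure and the position, uniformly over couplings. -/
theorem taylor (h : FrozenField R l L V D) {ε : ℝ} (hε : 0 < ε) :
    ∃ δ > 0, ∀ (P : Measure Ω) [IsProbabilityMeasure P] (X Y : Ω → Space d), AEMeasurable X P →
      AEMeasurable Y P → (∀ᵐ ω ∂P, ‖X ω‖ ≤ R) → (∀ᵐ ω ∂P, ‖Y ω‖ ≤ R) → ∀ x y : Space d,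
      ‖x‖ ≤ R → ‖y‖ ≤ R → Real.sqrt (∫ ω, ‖Y ω - X ω‖ ^ 2 ∂P) ≤ δ → ‖y - x‖ ≤ δ →
      ‖V (P.map Y) y - V (P.map X) x - fderiv ℝ (V (P.map X)) x (y - x) -
          ∫ ω, D (P.map X) x (X ω) (Y ω - X ω) ∂P‖ ≤
        ε * (‖y - x‖ + Real.sqrt (∫ ω, ‖Y ω - X ω‖ ^ 2 ∂P)) := by
  obtain ⟨δ₁, hδ₁, h1⟩ := h.taylor_measure (Ω := Ω) hε
  obtain ⟨δ₂, hδ₂, h2⟩ := h.unif_space_map (Ω := Ω) hε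
  refine ⟨min δ₁ δ₂, by positivity, fun P _ X Y hX hY hXR hYR x y hx hy hW hxy => ?_⟩
  have a1 := h1 P X Y hX hY hXR hYR x hx (hW.trans (min_le_left _ _))
  have hη2 : MemLp (fun ω => Y ω - X ω) 2 P := memLp_of_ae_bound 2 (R := R + R) (hY.sub hX) (by
    filter_upwards [hXR, hYR] with ω h1 h2 using (_root_.norm_sub_le _ _).trans (add_le_add h2 h1))
  have hW1 : ∫ ω, ‖X ω - Y ω‖ ∂P ≤ δ₂ := by
    simp_rw [norm_sub_rev (X _)]
    exact (integral_norm_le_sqrt hη2).trans (hW.trans (min_le_right _ _))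
  have hν := probOn_closedBall_subset_compactlySupported (map_mem_probOn hY hYR)
  have hseg : segment ℝ x y ⊆ Metric.closedBall (0 : Space d) R :=
    (convex_closedBall (0 : Space d) R).segment_subset (mem_closedBall_zero_iff.2 hx)
      (mem_closedBall_zero_iff.2 hy)
  -- The position is moved after the measure: along the segment, each derivative of `V (P.map Y)` is
  -- compared with the derivative of `V (P.map X)` at `x` by uniform continuity.
  have a2 := (convex_segment x y).norm_image_sub_le_of_norm_fderiv_le' (𝕜 := ℝ)
    (f := V (P.map Y)) (φ := fderiv ℝ (V (P.map X)) x) (C := ε) (fun z _ => h.diff _ hν z)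
    (fun z hz => h2 P X Y hX hY hXR hYR x z hx (mem_closedBall_zero_iff.1 (hseg hz)) hW1 (by
      rw [norm_sub_rev]
      exact (norm_sub_le_of_mem_segment hz).trans (hxy.trans (min_le_right _ _))))
    (left_mem_segment ℝ x y) (right_mem_segment ℝ x y)
  calc _ = ‖(V (P.map Y) y - V (P.map Y) x - fderiv ℝ (V (P.map X)) x (y - x)) +
        (V (P.map Y) x - V (P.map X) x - ∫ ω, D (P.map X) x (X ω) (Y ω - X ω) ∂P)‖ := by
        congr 1; abel
    _ ≤ _ := (norm_add_le _ _).trans (by linarith)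

end FrozenField

/-! ### Measurability in time -/

section Measurability

/-- A simple time change cuts the diagonal into finitely many pieces on which the first argument is
frozen. -/
lemma aestronglyMeasurable_simpleFunc_diag {E : Type*} [NormedAddCommGroup E] {m : Measure ℝ}
    (φ : SimpleFunc ℝ ℝ) {u : ℝ → ℝ → E} (hm : ∀ σ ∈ φ.range, AEStronglyMeasurable (u σ) m) :
    AEStronglyMeasurable (fun s => u (φ s) s) m := by
  classical
  have h : (fun s => u (φ s) s) = fun s => ∑ c ∈ φ.range, (φ ⁻¹' {c}).indicator (u c) s := by
    funext s
    rw [Finset.sum_eq_single (φ s)]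
    · rw [indicator_of_mem (by simp)]
    · intro b _ hb
      rw [indicator_of_notMem (by simpa using hb.symm)]
    · intro h
      exact absurd (φ.mem_range_self s) h
  rw [h]
  exact Finset.aestronglyMeasurable_fun_sum _ fun c hc =>
    (hm c hc).indicator (φ.measurableSet_fiber c)

/-- Carathéodory functions are measurable along the diagonal. -/
lemma aestronglyMeasurable_diag {E : Type*} [NormedAddCommGroup E] {T : ℝ} (hT : 0 ≤ T)
    {u : ℝ → ℝ → E}
    (hm : ∀ σ ∈ Icc 0 T, AEStronglyMeasurable (u σ) (volume.restrict (Icc 0 T)))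
    (hc : ∀ᵐ s ∂(volume.restrict (Icc 0 T)), ContinuousOn (fun σ => u σ s) (Icc 0 T)) :
    AEStronglyMeasurable (fun s => u s s) (volume.restrict (Icc 0 T)) := by
  have h0 : (0 : ℝ) ∈ Icc 0 T := ⟨le_rfl, hT⟩
  set φ : ℕ → SimpleFunc ℝ ℝ := SimpleFunc.approxOn id measurable_id (Icc 0 T) 0 h0 with hφ
  have hφm (n : ℕ) (s : ℝ) : φ n s ∈ Icc 0 T := SimpleFunc.approxOn_mem measurable_id h0 n s
  refine aestronglyMeasurable_of_tendsto_ae atTop (f := fun n s => u (φ n s) s) (fun n => ?_) ?_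
  · refine aestronglyMeasurable_simpleFunc_diag (φ n) fun σ hσ => hm σ ?_
    obtain ⟨s, rfl⟩ := SimpleFunc.mem_range.1 hσ
    exact hφm n s
  · filter_upwards [hc, ae_restrict_mem measurableSet_Icc] with s hs hsT
    have h1 : Tendsto (fun n => φ n s) atTop (𝓝 s) :=
      SimpleFunc.tendsto_approxOn measurable_id h0 (subset_closure hsT)
    exact (hs s hsT).tendsto.comp
      (tendsto_nhdsWithin_iff.2 ⟨h1, Eventually.of_forall fun n => hφm n s⟩)

variable {Ω : Type*} [MeasurableSpace Ω]

/-- A bounded family of random vectors with continuous trajectories. -/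
structure IsBoundedCurve (T R : ℝ) (P : Measure Ω) (X : ℝ → Ω → Space d) : Prop where
  meas : ∀ σ ∈ Icc 0 T, AEMeasurable (X σ) P
  bound : ∀ σ ∈ Icc 0 T, ∀ᵐ ω ∂P, ‖X σ ω‖ ≤ R
  cont : ∀ᵐ ω ∂P, ContinuousOn (fun σ => X σ ω) (Icc 0 T)

variable {T R H : ℝ} {P : Measure Ω} {X η : ℝ → Ω → Space d}

lemma IsBoundedCurve.add_smul (hX : IsBoundedCurve T R P X) (hη : IsBoundedCurve T H P η) {c : ℝ}
    (hc0 : 0 ≤ c) (hc1 : c ≤ 1) :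
    IsBoundedCurve T (R + |H|) P (fun s ω => X s ω + c • η s ω) where
  meas σ hσ := (hX.meas σ hσ).add ((hη.meas σ hσ).const_smul c)
  bound σ hσ := by
    filter_upwards [hX.bound σ hσ, hη.bound σ hσ] with ω h1 h2
    refine (norm_add_le _ _).trans (add_le_add h1 ?_)
    rw [norm_smul, Real.norm_of_nonneg hc0]
    calc c * ‖η σ ω‖ ≤ 1 * |H| := by gcongr; exact h2.trans (le_abs_self H)
      _ = |H| := one_mul _
  cont := by
    filter_upwards [hX.cont, hη.cont] with ω h1 h2 using h1.add (h2.const_smul c)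

variable {v : ℝ → Measure (Space d) → Space d → Space d}
  {Dv : ℝ → Measure (Space d) → Space d → Space d → Space d →L[ℝ] Space d}
  [IsProbabilityMeasure P]

/-- Time measurability is assumed only for a frozen measure and a frozen point. Along moving ones it
follows from the diagonal lemma, because the Lipschitz bounds, with dominated convergence for the
mean displacement, give continuity in the frozen parameter. -/
lemma HypCE.aestronglyMeasurable_velocity (hv : HypCE T v Dv) (hT : 0 ≤ T) (hR : 0 < R)
    (hX : IsBoundedCurve T R P X) {x : ℝ → Space d} (hx : ContinuousOn x (Icc 0 T))
    (hxR : ∀ σ ∈ Icc 0 T, ‖x σ‖ ≤ R) :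
    AEStronglyMeasurable (fun s => v s (P.map (X s)) (x s)) (volume.restrict (Icc 0 T)) := by
  obtain ⟨l, L, -, -, -, -, hF⟩ := hv.ae_frozenField hR
  refine aestronglyMeasurable_diag (u := fun σ s => v s (P.map (X σ)) (x σ)) hT (fun σ hσ => ?_) ?_
  · exact hv.measurable _ (probOn_closedBall_subset_compactlySupported
      (map_mem_probOn (hX.meas σ hσ) (hX.bound σ hσ))) _
  · filter_upwards [hF] with s hs
    intro σ₀ hσ₀
    rw [ContinuousWithinAt, tendsto_iff_norm_sub_tendsto_zero]
    have hint : Tendsto (fun σ => ∫ ω, ‖X σ ω - X σ₀ ω‖ ∂P) (𝓝[Icc 0 T] σ₀) (𝓝 (∫ _, (0 : ℝ) ∂P)) := by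
      refine tendsto_integral_filter_of_dominated_convergence (fun _ => R + R) ?_ ?_
        (integrable_const _) ?_
      · filter_upwards [self_mem_nhdsWithin] with σ hσ
        exact ((hX.meas σ hσ).sub (hX.meas σ₀ hσ₀)).norm.aestronglyMeasurable
      · filter_upwards [self_mem_nhdsWithin] with σ hσ
        filter_upwards [hX.bound σ hσ, hX.bound σ₀ hσ₀] with ω h1 h2
        rw [norm_norm]
        exact (norm_sub_le _ _).trans (add_le_add h1 h2)
      · filter_upwards [hX.cont] with ω hω
        exact tendsto_iff_norm_sub_tendsto_zero.1 (hω σ₀ hσ₀).tendsto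
    have hxt : Tendsto (fun σ => ‖x σ - x σ₀‖) (𝓝[Icc 0 T] σ₀) (𝓝 0) :=
      tendsto_iff_norm_sub_tendsto_zero.1 (hx σ₀ hσ₀).tendsto
    have hsum := (hxt.const_mul (l s)).add (hint.const_mul (L s))
    simp only [integral_zero, mul_zero, add_zero] at hsum
    refine squeeze_zero' (Eventually.of_forall fun _ => norm_nonneg _) ?_ hsum
    filter_upwards [self_mem_nhdsWithin] with σ hσ
    exact hs.norm_sub_le (hX.meas σ hσ) (hX.bound σ hσ) (hX.meas σ₀ hσ₀) (hX.bound σ₀ hσ₀)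
      (hxR σ hσ) (hxR σ₀ hσ₀)

lemma tendsto_slope_one_div {E : Type*} [NormedAddCommGroup E] [NormedSpace ℝ E] {f : ℝ → E}
    {f' : E} (h : HasDerivAt f f' 0) :
    Tendsto (fun n : ℕ => ((n : ℝ) + 1) • (f (1 / ((n : ℝ) + 1)) - f 0)) atTop (𝓝 f') := by
  have h1 := h.tendsto_slope_zero
  have h2 : Tendsto (fun n : ℕ => 1 / ((n : ℝ) + 1)) atTop (𝓝[≠] 0) :=
    tendsto_nhdsWithin_iff.2 ⟨tendsto_one_div_add_atTop_nhds_zero_nat,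
      Eventually.of_forall fun n => by
        have : (0 : ℝ) < 1 / ((n : ℝ) + 1) := by positivity
        exact this.ne'⟩
  have h3 := h1.comp h2
  simpa [Function.comp_def] using h3

lemma aestronglyMeasurable_smul_sub {α E : Type*} [MeasurableSpace α] {m : Measure α}
    [NormedAddCommGroup E] [NormedSpace ℝ E] {f g : α → E} (c : ℝ) (hf : AEStronglyMeasurable f m)
    (hg : AEStronglyMeasurable g m) : AEStronglyMeasurable (fun s => c • (f s - g s)) m :=
  (hf.sub hg).const_smul c

lemma one_div_succ_nonneg (n : ℕ) : (0 : ℝ) ≤ 1 / ((n : ℝ) + 1) := by positivity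

lemma one_div_succ_le_one (n : ℕ) : 1 / ((n : ℝ) + 1) ≤ 1 := by
  rw [div_le_one (by positivity)]
  linarith [n.cast_nonneg (α := ℝ)]

/-- The derivative is a pointwise limit of difference quotients of the velocity. The radius grows by
`|H|` to contain the shifted points. -/
lemma HypCE.aestronglyMeasurable_fderiv (hv : HypCE T v Dv) (hT : 0 ≤ T) (hR : 0 < R)
    (hX : IsBoundedCurve T R P X) {x e : ℝ → Space d} (hx : ContinuousOn x (Icc 0 T))
    (hxR : ∀ σ ∈ Icc 0 T, ‖x σ‖ ≤ R) (he : ContinuousOn e (Icc 0 T)) :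
    AEStronglyMeasurable (fun s => fderiv ℝ (v s (P.map (X s))) (x s) (e s))
      (volume.restrict (Icc 0 T)) := by
  obtain ⟨H, hH⟩ := isCompact_Icc.exists_bound_of_continuousOn he
  have hXR' : IsBoundedCurve T (R + |H|) P X := ⟨hX.meas, fun σ hσ => (hX.bound σ hσ).mono
    fun ω h => h.trans (le_add_of_nonneg_right (abs_nonneg _)), hX.cont⟩
  have hR' : 0 < R + |H| := by positivity
  refine aestronglyMeasurable_of_tendsto_ae atTop (f := fun (n : ℕ) s => ((n : ℝ) + 1) •
    (v s (P.map (X s)) (x s + (1 / ((n : ℝ) + 1)) • e s) - v s (P.map (X s)) (x s)))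
    (fun n => ?_) ?_
  · refine aestronglyMeasurable_smul_sub _ ?_ ?_
    · refine hv.aestronglyMeasurable_velocity hT hR' hXR'
        (hx.add (he.const_smul (1 / ((n : ℝ) + 1)))) fun σ hσ => ?_
      refine (norm_add_le _ _).trans (add_le_add (hxR σ hσ) ?_)
      rw [norm_smul, Real.norm_of_nonneg (one_div_succ_nonneg n)]
      calc 1 / ((n : ℝ) + 1) * ‖e σ‖ ≤ 1 * |H| := by
            gcongr
            · exact one_div_succ_le_one n
            · exact (hH σ hσ).trans (le_abs_self H)
        _ = |H| := one_mul _
    · exact hv.aestronglyMeasurable_velocity hT hR hX hx hxR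
  · filter_upwards [hv.differentiable_space, ae_restrict_mem measurableSet_Icc] with s hs hsT
    have hd := (hs _ (probOn_closedBall_subset_compactlySupported
      (map_mem_probOn (hX.meas s hsT) (hX.bound s hsT)))) (x s)
    have h1 : HasDerivAt (fun t : ℝ => v s (P.map (X s)) (x s + t • e s))
        (fderiv ℝ (v s (P.map (X s))) (x s) (e s)) 0 := by
      have h2 : HasDerivAt (fun t : ℝ => x s + t • e s) (e s) 0 := by
        simpa using ((hasDerivAt_id (0 : ℝ)).smul_const (e s)).const_add (x s)
      refine HasFDerivAt.comp_hasDerivAt (0 : ℝ) ?_ h2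
      simpa using hd.hasFDerivAt
    simpa using tendsto_slope_one_div h1

/-- Nothing is assumed about the measurability of `Dv` in time; the nonlocal term is instead a limit
of difference quotients of the velocity along `X + η / (n + 1)`. -/
lemma HypCE.aestronglyMeasurable_differential (hv : HypCE T v Dv) (hT : 0 ≤ T) (hR : 0 < R)
    (hX : IsBoundedCurve T R P X) (hη : IsBoundedCurve T H P η) {x : ℝ → Space d}
    (hx : ContinuousOn x (Icc 0 T)) (hxR : ∀ σ ∈ Icc 0 T, ‖x σ‖ ≤ R) :
    AEStronglyMeasurable (fun s => ∫ ω, Dv s (P.map (X s)) (x s) (X s ω) (η s ω) ∂P)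
      (volume.restrict (Icc 0 T)) := by
  have hR' : 0 < R + |H| := by positivity
  obtain ⟨l, L, -, -, -, -, hF⟩ := hv.ae_frozenField hR
  refine aestronglyMeasurable_of_tendsto_ae atTop (f := fun (n : ℕ) s => ((n : ℝ) + 1) •
    (v s (P.map (fun ω => X s ω + (1 / ((n : ℝ) + 1)) • η s ω)) (x s) - v s (P.map (X s)) (x s)))
    (fun n => ?_) ?_
  · refine aestronglyMeasurable_smul_sub _ ?_ ?_
    · exact hv.aestronglyMeasurable_velocity hT hR'
        (hX.add_smul hη (one_div_succ_nonneg n) (one_div_succ_le_one n)) hx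
        fun σ hσ => (hxR σ hσ).trans (le_add_of_nonneg_right (abs_nonneg _))
    · exact hv.aestronglyMeasurable_velocity hT hR hX hx hxR
  · filter_upwards [hF, ae_restrict_mem measurableSet_Icc] with s hs hsT
    have h1 := tendsto_slope_one_div (hs.hasDerivAt (hX.meas s hsT) (hX.bound s hsT)
      (hη.meas s hsT) (hη.bound s hsT) (x s))
    simpa using h1

lemma eq_sum_smulRight (A : Space d →L[ℝ] Space d) :
    A = ∑ i : Fin d, (EuclideanSpace.proj i : Space d →L[ℝ] ℝ).smulRight
      (A (EuclideanSpace.single i 1)) := by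
  ext1 x
  conv_lhs => rw [← (EuclideanSpace.basisFun (Fin d) ℝ).sum_repr x]
  simp [map_sum]

lemma aestronglyMeasurable_clm {α : Type*} [MeasurableSpace α] {m : Measure α}
    {A : α → Space d →L[ℝ] Space d} (h : ∀ e, AEStronglyMeasurable (fun s => A s e) m) :
    AEStronglyMeasurable A m := by
  have : A = fun s => ∑ i : Fin d, (EuclideanSpace.proj i : Space d →L[ℝ] ℝ).smulRight
      (A s (EuclideanSpace.single i 1)) := funext fun s => eq_sum_smulRight _
  rw [this]
  refine Finset.aestronglyMeasurable_fun_sum _ fun i _ => ?_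
  exact (ContinuousLinearMap.smulRightL ℝ (Space d) (Space d)
    (EuclideanSpace.proj i : Space d →L[ℝ] ℝ)).continuous.comp_aestronglyMeasurable (h _)

end Measurability

/-! ### Radial truncation -/

/-- The radial retraction onto the ball of radius `R`. -/
noncomputable def truncate (R : ℝ) (x : Space d) : Space d := (R / max R ‖x‖) • x

section Truncate

variable {R : ℝ}

lemma continuous_truncate (hR : 0 < R) : Continuous (truncate R : Space d → Space d) := by
  have h : Continuous fun x : Space d => R / max R ‖x‖ :=
    continuous_const.div (by fun_prop) fun x => (lt_max_of_lt_left hR).ne'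
  exact h.smul continuous_id

lemma norm_truncate (hR : 0 < R) (x : Space d) : ‖truncate R x‖ = R * (‖x‖ / max R ‖x‖) := by
  rw [truncate, norm_smul, Real.norm_of_nonneg (by positivity)]
  ring

lemma norm_truncate_le (hR : 0 < R) (x : Space d) : ‖truncate R x‖ ≤ R := by
  rw [norm_truncate hR]
  have : ‖x‖ / max R ‖x‖ ≤ 1 := div_le_one_of_le₀ (le_max_right _ _) (by positivity)
  calc R * (‖x‖ / max R ‖x‖) ≤ R * 1 := by gcongr
    _ = R := mul_one R

lemma norm_truncate_le_norm (hR : 0 < R) (x : Space d) : ‖truncate R x‖ ≤ ‖x‖ := by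
  rw [truncate, norm_smul, Real.norm_of_nonneg (by positivity)]
  have : R / max R ‖x‖ ≤ 1 := div_le_one_of_le₀ (le_max_left _ _) (by positivity)
  calc R / max R ‖x‖ * ‖x‖ ≤ 1 * ‖x‖ := by gcongr
    _ = ‖x‖ := one_mul _

lemma truncate_of_norm_le (hR : 0 < R) {x : Space d} (hx : ‖x‖ ≤ R) : truncate R x = x := by
  rw [truncate, max_eq_left hx, div_self hR.ne', one_smul]

/-- The difference is `(R / a) • (x - y)` plus a radial correction proportional to `b - a`. Since
`max R ‖·‖` is `1`-Lipschitz, each piece is at most `‖x - y‖`; the constant `2` is all that is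
needed below. -/
lemma norm_truncate_sub_le (hR : 0 < R) (x y : Space d) :
    ‖truncate R x - truncate R y‖ ≤ 2 * ‖x - y‖ := by
  set a := max R ‖x‖ with ha
  set b := max R ‖y‖ with hb
  have ha0 : 0 < a := lt_max_of_lt_left hR
  have hb0 : 0 < b := lt_max_of_lt_left hR
  have hab : |b - a| ≤ ‖x - y‖ := by
    refine (abs_max_sub_max_le_max _ _ _ _).trans ?_
    simp only [sub_self, abs_zero]
    refine max_le (norm_nonneg _) ?_
    rw [norm_sub_rev]
    exact abs_norm_sub_norm_le y x
  have h1 : truncate R x - truncate R y = (R / a) • (x - y) + ((R / a) * ((b - a) / b)) • y := by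
    have : R / a * ((b - a) / b) = R / a - R / b := by field_simp
    rw [truncate, truncate, ← ha, ← hb, this, sub_smul, smul_sub]
    abel
  have hRa : R / a ≤ 1 := div_le_one_of_le₀ (le_max_left _ _) ha0.le
  have hyb : ‖y‖ / b ≤ 1 := div_le_one_of_le₀ (le_max_right _ _) hb0.le
  have hRa0 : 0 ≤ R / a := by positivity
  rw [h1]
  refine (norm_add_le _ _).trans ?_
  rw [norm_smul, norm_smul, norm_mul, norm_div (b - a), Real.norm_of_nonneg hRa0,
    Real.norm_of_nonneg hb0.le, Real.norm_eq_abs]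
  have h2 : R / a * (|b - a| / b) * ‖y‖ = R / a * |b - a| * (‖y‖ / b) := by ring
  rw [h2]
  calc R / a * ‖x - y‖ + R / a * |b - a| * (‖y‖ / b)
      ≤ 1 * ‖x - y‖ + 1 * ‖x - y‖ * 1 := by gcongr
    _ = 2 * ‖x - y‖ := by ring

/-- The radial retraction as a continuous map to the ball. -/
noncomputable def ballRetract {r : ℝ} (hr : 0 < r) : C(Space d, Ball d r) :=
  ⟨fun x => ⟨truncate r x, mem_closedBall_zero_iff.2 (norm_truncate_le hr x)⟩,
    (continuous_truncate hr).subtype_mk _⟩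

lemma ballRetract_of_mem {r : ℝ} (hr : 0 < r) {x : Space d}
    (hx : x ∈ Metric.closedBall (0 : Space d) r) : ballRetract hr x = ⟨x, hx⟩ :=
  Subtype.ext (truncate_of_norm_le hr (mem_closedBall_zero_iff.1 hx))

end Truncate

/-! ### Existence and uniqueness of the non-local flow -/

section Flow

lemma isBoundedCurve_of_continuousOn {Ω : Type*} [TopologicalSpace Ω] [MeasurableSpace Ω]
    [OpensMeasurableSpace Ω] {P : Measure Ω} {S : Set Ω} (hS : MeasurableSet S)
    (hPS : ∀ᵐ ω ∂P, ω ∈ S) {T R : ℝ} {f : ℝ → Ω → Space d}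
    (hf : ContinuousOn (fun p : ℝ × Ω => f p.1 p.2) (Icc 0 T ×ˢ S))
    (hb : ∀ t ∈ Icc 0 T, ∀ ω ∈ S, ‖f t ω‖ ≤ R) : IsBoundedCurve T R P f where
  meas σ hσ := by
    have h1 : ContinuousOn (f σ) S :=
      hf.comp (f := fun ω => (σ, ω)) (by fun_prop) fun ω hω => ⟨hσ, hω⟩
    have h2 := h1.aemeasurable (μ := P) hS
    rwa [Measure.restrict_eq_self_of_ae_mem hPS] at h2
  bound σ hσ := hPS.mono fun ω hω => hb σ hσ ω hω
  cont := hPS.mono fun ω hω =>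
    hf.comp (f := fun t => (t, ω)) (by fun_prop) fun t ht => ⟨ht, hω⟩

variable {T r : ℝ} {v : ℝ → Measure (Space d) → Space d → Space d}
  {Dv : ℝ → Measure (Space d) → Space d → Space d → Space d →L[ℝ] Space d}
  {τ : ℝ} {μ : Measure (Space d)}

lemma firstMoment_map_le {Ω : Type*} [MeasurableSpace Ω] {P : Measure Ω} [IsProbabilityMeasure P]
    {X : Ω → Space d} (hX : AEMeasurable X P) {N : ℝ} (hXN : ∀ᵐ ω ∂P, ‖X ω‖ ≤ N) :
    firstMoment (P.map X) ≤ N := by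
  rw [firstMoment, integral_map hX (by fun_prop)]
  refine (integral_mono_of_nonneg (Eventually.of_forall fun _ => norm_nonneg _)
    (integrable_const N) hXN).trans (le_of_eq ?_)
  simp

/-- The velocity is Lipschitz only on bounded sets, so the equation is first solved with positions
truncated at radius `R`. Truncation does not increase norms, so the growth bound survives, and
Grönwall keeps the solution inside the ball where truncation is the identity. The radius depends
only on `m`, `T` and `r`, hence serves all initial times and measures at once. -/
theorem HypCE.exists_flow (hv : HypCE T v Dv) (hT : 0 ≤ T) (hr : 0 < r) :
    ∃ R > 0, ∀ τ ∈ Icc 0 T, ∀ μ ∈ probOn (Metric.closedBall (0 : Space d) r),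
      ∃ Φ : ℝ → Space d → Space d, IsNonlocalFlow T v (Metric.closedBall 0 r) τ μ Φ ∧
        Continuous (fun p : ℝ × Space d => Φ p.1 p.2) ∧
        ∀ t ∈ Icc 0 T, ∀ x ∈ Metric.closedBall (0 : Space d) r, ‖Φ t x‖ ≤ R := by
  obtain ⟨m, hm, hm0, hgrowth⟩ := hv.sublinear
  -- The factor `2` counts the position and the first moment, both controlled by the same supremum.
  obtain ⟨lam, hw⟩ := exists_isVolterraWeight (k := fun s => 2 * m s) (hm.const_mul 2)
  have hmi : 0 ≤ ∫ s in Icc 0 T, m s := integral_nonneg hm0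
  set R := 2 * (r + ∫ s in Icc 0 T, m s) * Real.exp (lam * T) with hRdef
  have hR : 0 < R := by positivity
  refine ⟨R, hR, fun τ hτ μ hμ => ?_⟩
  have hμ1 := hμ.1
  obtain ⟨l, L, hl, hl0, hL, hL0, hF⟩ := hv.ae_frozenField hR
  let X (u : C(Ball d r, Space d)) (x : Space d) : Space d := truncate R (u (ballRetract hr x))
  have hXc (u) : Continuous (X u) :=
    (continuous_truncate hR).comp (u.continuous.comp (ballRetract hr).continuous)
  have hXm (u) : AEMeasurable (X u) μ := (hXc u).aemeasurable
  have hXR (u x) : ‖X u x‖ ≤ R := norm_truncate_le hR _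
  have hXu (u x) : ‖X u x‖ ≤ ‖u‖ := (norm_truncate_le_norm hR _).trans (u.norm_coe_le_norm _)
  have hcs (u) : μ.map (X u) ∈ compactlySupported d :=
    probOn_closedBall_subset_compactlySupported
      (map_mem_probOn (hXm u) (Eventually.of_forall (hXR u)))
  have hgr : ∀ᵐ s ∂(volume.restrict (Icc 0 T)), ∀ u : C(Ball d r, Space d), ∀ q N, ‖u q‖ ≤ N →
      (∀ q, ‖u q‖ ≤ N) → ‖v s (μ.map (X u)) (truncate R (u q))‖ ≤ 2 * m s * N + m s := by
    filter_upwards [hgrowth] with s hs u q N _ hN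
    refine (hs _ (hcs u) _).trans ?_
    have h1 := firstMoment_map_le (hXm u) (N := N)
      (Eventually.of_forall fun x => (norm_truncate_le_norm hR _).trans (hN _))
    have h2 := (norm_truncate_le_norm hR (u q)).trans (hN q)
    calc m s * (1 + ‖truncate R (u q)‖ + firstMoment (μ.map (X u))) ≤ m s * (1 + N + N) := by
          gcongr
          exact hm0 s
      _ = _ := by ring
  obtain ⟨u, hu, hint, heq⟩ := exists_volterra_solution (T := T) hτ
    (⟨fun q => q, continuous_subtype_val⟩ : C(Ball d r, Space d))
    (fun s u q => v s (μ.map (X u)) (truncate R (u q)))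
    -- Here the factor `2` is the Lipschitz constant of the truncation.
    (k := fun s => 2 * (l s + L s)) (g := fun s => 2 * m s)
    ((hl.add hL).const_mul 2) (hm.const_mul 2) (by
      filter_upwards [hF] with s hs u w q
      have hb (x : Space d) : ‖X u x - X w x‖ ≤ 2 * ‖u - w‖ :=
        (norm_truncate_sub_le hR _ _).trans (by gcongr; exact (u - w).norm_coe_le_norm _)
      have h1 : ∫ x, ‖X u x - X w x‖ ∂μ ≤ 2 * ‖u - w‖ := by
        refine (integral_mono_of_nonneg (Eventually.of_forall fun _ => norm_nonneg _)
          (integrable_const _) (Eventually.of_forall hb)).trans (le_of_eq (by simp))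
      have h2 : ‖truncate R (u q) - truncate R (w q)‖ ≤ 2 * ‖u - w‖ :=
        (norm_truncate_sub_le hR _ _).trans (by gcongr; exact (u - w).norm_coe_le_norm _)
      refine (hs.norm_sub_le (hXm u) (Eventually.of_forall (hXR u)) (hXm w)
        (Eventually.of_forall (hXR w)) (norm_truncate_le hR _) (norm_truncate_le hR _)).trans ?_
      calc _ ≤ l s * (2 * ‖u - w‖) + L s * (2 * ‖u - w‖) := by
            gcongr
            · exact hs.l_nonneg
            · exact hs.L_nonneg
        _ = _ := by ring)
    (by
      filter_upwards [hgr] with s hs u q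
      refine (hs u q _ (u.norm_coe_le_norm q) u.norm_coe_le_norm).trans ?_
      nlinarith [hm0 s, norm_nonneg u])
    (by
      filter_upwards [hv.differentiable_space] with s hs u
      exact (hs _ (hcs u)).continuous.comp ((continuous_truncate hR).comp u.continuous))
    (fun u hu q => by
      have hev (q : Ball d r) : Continuous fun s => truncate R (u s q) :=
        (continuous_truncate hR).comp ((continuous_eval_const q).comp hu)
      exact hv.aestronglyMeasurable_velocity hT hR (P := μ) (X := fun s => X (u s))
        ⟨fun σ _ => hXm _, fun σ _ => Eventually.of_forall (hXR _),
          Eventually.of_forall fun x => (hev _).continuousOn⟩ (hev q).continuousOn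
        fun σ _ => norm_truncate_le hR _)
  -- the a priori bound
  have hbound : ∀ t ∈ Icc 0 T, ∀ q, ‖u t q‖ ≤ R := by
    intro t ht q
    have hbdd : ∃ M, ∀ t ∈ Icc 0 T, ∀ q, ‖u t q‖ ≤ M := by
      obtain ⟨M, hM⟩ := isCompact_Icc.exists_bound_of_continuousOn (s := Icc 0 T) hu.continuousOn
      exact ⟨M, fun t ht q => ((u t).norm_coe_le_norm q).trans (hM t ht)⟩
    refine (hw.norm_le (hm.const_mul 2) hτ (e := fun t q => u t q) (f := fun _ => m)
      (A := r + ∫ s in Icc 0 T, m s) hbdd heq (fun _ => hm) (fun _ => hm0) (fun q => ?_) (fun q => ?_)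
      t ht q).trans ?_
    · gcongr
      exact mem_closedBall_zero_iff.1 q.2
    · filter_upwards [hgr] with s hs N hN
      exact hs (u s) q N (hN q) hN
    · rw [hRdef]
      gcongr
      · exact hw.1
      · rw [abs_le]; constructor <;> linarith [ht.1, ht.2, hτ.1, hτ.2]
  have huncurry : Continuous fun p : ℝ × Ball d r => u p.1 p.2 := by
    have : Continuous fun p : ℝ × Ball d r => (u p.1, p.2) := by fun_prop
    exact ContinuousEval.continuous_eval.comp this
  have hcont : Continuous fun p : ℝ × Space d => u p.1 (ballRetract hr p.2) :=
    huncurry.comp (f := fun p : ℝ × Space d => (p.1, ballRetract hr p.2)) (by fun_prop)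
  have hXeq : ∀ s ∈ Icc 0 T, X (u s) = fun x => u s (ballRetract hr x) := fun s hs =>
    funext fun x => truncate_of_norm_le hR (hbound s hs _)
  have hrhs : ∀ s ∈ Icc 0 T, ∀ x (hx : x ∈ Metric.closedBall (0 : Space d) r),
      v s (μ.map (X (u s))) (truncate R (u s ⟨x, hx⟩)) =
        v s (μ.map fun x => u s (ballRetract hr x)) (u s (ballRetract hr x)) := by
    intro s hs x hx
    rw [hXeq s hs, truncate_of_norm_le hR (hbound s hs _), ballRetract_of_mem hr hx]
  refine ⟨fun t x => u t (ballRetract hr x), ⟨hcont.continuousOn, fun x hx => ?_, fun t ht x hx => ?_⟩,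
    hcont, fun t ht x _ => hbound t ht _⟩
  · rw [intervalIntegrable_iff]
    refine ((hint ⟨x, hx⟩).congr_fun (fun s hs => hrhs s hs x hx) measurableSet_Icc).mono_set ?_
    exact uIoc_subset_Icc_of_mem ⟨le_rfl, hT⟩ ⟨hT, le_rfl⟩
  · simp only [ballRetract_of_mem hr hx]
    rw [heq t ht ⟨x, hx⟩]
    congr 1
    refine intervalIntegral.integral_congr fun s hs => ?_
    have := hrhs s (uIcc_subset_Icc hτ ht hs) x hx
    rw [ballRetract_of_mem hr hx] at this
    exact this

/-- Continuity on a compact set provides a ball containing both flows; on it their difference solves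
a Volterra inequality without source, so Grönwall with `A = 0` makes it vanish. No a priori radius
is imposed on the competitor. -/
theorem IsNonlocalFlow.eq_of_isNonlocalFlow (hv : HypCE T v Dv) (hτ : τ ∈ Icc 0 T)
    (hμ : μ ∈ probOn (Metric.closedBall (0 : Space d) r)) {Φ Ψ : ℝ → Space d → Space d}
    (hΦ : IsNonlocalFlow T v (Metric.closedBall 0 r) τ μ Φ)
    (hΨ : IsNonlocalFlow T v (Metric.closedBall 0 r) τ μ Ψ) :
    ∀ t ∈ Icc 0 T, ∀ x ∈ Metric.closedBall (0 : Space d) r, Ψ t x = Φ t x := by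
  have hμ1 := hμ.1
  have hKc : IsCompact (Icc 0 T ×ˢ Metric.closedBall (0 : Space d) r) :=
    isCompact_Icc.prod (isCompact_closedBall _ _)
  obtain ⟨M₁, hM₁⟩ := hKc.exists_bound_of_continuousOn hΦ.continuousOn
  obtain ⟨M₂, hM₂⟩ := hKc.exists_bound_of_continuousOn hΨ.continuousOn
  set R := |M₁| + |M₂| + 1 with hRdef
  have hR : 0 < R := by positivity
  have b1 : ∀ t ∈ Icc 0 T, ∀ x ∈ Metric.closedBall (0 : Space d) r, ‖Φ t x‖ ≤ R := fun t ht x hx =>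
    (hM₁ (t, x) ⟨ht, hx⟩).trans (by linarith [le_abs_self M₁, abs_nonneg M₂])
  have b2 : ∀ t ∈ Icc 0 T, ∀ x ∈ Metric.closedBall (0 : Space d) r, ‖Ψ t x‖ ≤ R := fun t ht x hx =>
    (hM₂ (t, x) ⟨ht, hx⟩).trans (by linarith [le_abs_self M₂, abs_nonneg M₁])
  obtain ⟨l, L, hl, hl0, hL, hL0, hF⟩ := hv.ae_frozenField hR
  obtain ⟨lam, hw⟩ := exists_isVolterraWeight (k := fun s => l s + L s) (hl.add hL)
  have hKm : MeasurableSet (Metric.closedBall (0 : Space d) r) :=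
    Metric.isClosed_closedBall.measurableSet
  have c1 := isBoundedCurve_of_continuousOn hKm (ae_mem_of_mem_probOn hμ) hΦ.continuousOn b1
  have c2 := isBoundedCurve_of_continuousOn hKm (ae_mem_of_mem_probOn hμ) hΨ.continuousOn b2
  have hsub {x t} (hx : x ∈ Metric.closedBall (0 : Space d) r) (ht : t ∈ Icc 0 T)
      {Φ : ℝ → Space d → Space d} (hΦ : IsNonlocalFlow T v (Metric.closedBall 0 r) τ μ Φ) :
      IntervalIntegrable (fun s => v s (μ.map (Φ s)) (Φ s x)) volume τ t :=
    (hΦ.integrable x hx).mono_set (by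
      rw [uIcc_of_le (hτ.1.trans hτ.2)]
      exact uIcc_subset_Icc hτ ht)
  have key := hw.norm_le (Q := Ball d r) (hl.add hL) hτ (e := fun t q => Ψ t q - Φ t q)
    (c := fun _ => 0) (f := fun _ _ => 0) (A := 0)
    (F := fun s q => v s (μ.map (Ψ s)) (Ψ s q) - v s (μ.map (Φ s)) (Φ s q))
    ⟨R + R, fun t ht q => (norm_sub_le _ _).trans (add_le_add (b2 t ht q q.2) (b1 t ht q q.2))⟩
    (fun t ht q => by
      rw [hΨ.eq_integral t ht q q.2, hΦ.eq_integral t ht q q.2,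
        intervalIntegral.integral_sub (hsub q.2 ht hΨ) (hsub q.2 ht hΦ)]
      abel)
    (fun _ => integrableOn_zero) (fun _ _ => le_rfl) (fun _ => by simp) (fun q => by
      filter_upwards [hF, ae_restrict_mem measurableSet_Icc] with s hs hsT N hN
      refine (hs.norm_sub_le (c2.meas s hsT) (c2.bound s hsT) (c1.meas s hsT) (c1.bound s hsT)
        (b2 s hsT q q.2) (b1 s hsT q q.2)).trans ?_
      have h1 : ∫ x, ‖Ψ s x - Φ s x‖ ∂μ ≤ N := by
        refine (integral_mono_of_nonneg (Eventually.of_forall fun _ => norm_nonneg _)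
          (integrable_const N) ?_).trans (le_of_eq (by simp))
        filter_upwards [ae_mem_of_mem_probOn hμ] with x hx using hN ⟨x, hx⟩
      calc _ ≤ l s * N + L s * N := by
            gcongr
            · exact hs.l_nonneg
            · exact hN q
            · exact hs.L_nonneg
        _ = _ := by ring)
  intro t ht x hx
  have := key t ht ⟨x, hx⟩
  rw [mul_zero, zero_mul] at this
  exact sub_eq_zero.1 (norm_le_zero_iff.1 this)

end Flow

/-! ### Uniform estimates along flows -/

/-- Apply the unscaled version to `f / scale`. Where the scale vanishes, domination forces `f = 0`
almost everywhere, so the convention `0⁻¹ = 0` does no harm. -/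
lemma exists_integral_le_mul_of_dominated {α P : Type*} [MeasurableSpace α] {m : Measure α}
    (size scale : P → ℝ) (hscale : ∀ p, 0 ≤ scale p) (f : P → α → ℝ) {g : α → ℝ}
    (hg : Integrable g m) (hf : ∀ p, AEStronglyMeasurable (f p) m)
    (hfg : ∀ p, ∀ᵐ s ∂m, |f p s| ≤ g s * scale p)
    (hlim : ∀ᵐ s ∂m, ∀ ε > 0, ∃ δ > 0, ∀ p, size p ≤ δ → |f p s| ≤ ε * scale p) :
    ∀ ε > 0, ∃ δ > 0, ∀ p, size p ≤ δ → ∫ s, |f p s| ∂m ≤ ε * scale p := by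
  intro ε hε
  have key (p : P) (a b : ℝ) (hb : 0 ≤ b) (h : |a| ≤ b * scale p) : |(scale p)⁻¹ * a| ≤ b := by
    rw [abs_mul, abs_inv, abs_of_nonneg (hscale p)]
    rcases (hscale p).eq_or_lt with h0 | h0
    · rw [← h0]
      simpa using hb
    · rw [inv_mul_le_iff₀ h0]
      linarith
  obtain ⟨δ, hδ, h⟩ := exists_integral_le_of_dominated (m := m) size
    (fun p s => (scale p)⁻¹ * f p s) (g := fun s => |g s|) hg.abs (fun p => (hf p).const_mul _)
    (fun p => by
      filter_upwards [hfg p] with s hs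
      exact key p _ _ (abs_nonneg _) (hs.trans (by gcongr; exacts [hscale p, le_abs_self _])))
    (by
      filter_upwards [hlim] with s hs ε hε
      obtain ⟨δ, hδ, h⟩ := hs ε hε
      exact ⟨δ, hδ, fun p hp => key p _ _ hε.le (h p hp)⟩) ε hε
  refine ⟨δ, hδ, fun p hp => ?_⟩
  have h1 : ∫ s, |f p s| ∂m = scale p * ∫ s, |(scale p)⁻¹ * f p s| ∂m := by
    rw [← integral_const_mul]
    refine integral_congr_ae ?_
    filter_upwards [hfg p] with s hs
    rw [abs_mul, abs_inv, abs_of_nonneg (hscale p)]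
    rcases (hscale p).eq_or_lt with h0 | h0
    · rw [← h0] at hs ⊢
      simpa using hs
    · field_simp
  rw [h1, mul_comm]
  exact mul_le_mul_of_nonneg_right (h p hp) (hscale p)

lemma FrozenField.continuousOn_fderiv {R l L : ℝ} {V : Measure (Space d) → Space d → Space d}
    {D : Measure (Space d) → Space d → Space d → Space d →L[ℝ] Space d}
    (h : FrozenField R l L V D) {μ : Measure (Space d)}
    (hμ : μ ∈ probOn (Metric.closedBall (0 : Space d) R)) :
    ContinuousOn (fderiv ℝ (V μ)) (Metric.closedBall 0 R) := by
  have := hμ.1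
  rw [Metric.continuousOn_iff]
  intro x hx ε hε
  obtain ⟨δ, hδ, hu⟩ := h.unif_space_map (Ω := Space d) (half_pos hε)
  refine ⟨δ, hδ, fun y hy hyx => ?_⟩
  have := hu μ id id aemeasurable_id aemeasurable_id (ae_norm_le_of_mem_probOn hμ)
    (ae_norm_le_of_mem_probOn hμ) x y (mem_closedBall_zero_iff.1 hx) (mem_closedBall_zero_iff.1 hy)
    (by simpa using hδ.le) (by rw [← dist_eq_norm, dist_comm]; exact hyx.le)
  rw [Measure.map_id] at this
  rw [dist_eq_norm]
  linarith

/-- A velocity field together with its bounds on the ball of radius `R`. -/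
structure Frame (T r R lam : ℝ) (l L : ℝ → ℝ) (v : ℝ → Measure (Space d) → Space d → Space d)
    (Dv : ℝ → Measure (Space d) → Space d → Space d → Space d →L[ℝ] Space d) : Prop where
  T_nonneg : 0 ≤ T
  r_pos : 0 < r
  R_pos : 0 < R
  hyp : HypCE T v Dv
  l_int : IntegrableOn l (Icc 0 T)
  l_nonneg : ∀ t, 0 ≤ l t
  L_int : IntegrableOn L (Icc 0 T)
  L_nonneg : ∀ t, 0 ≤ L t
  frozen : ∀ᵐ t ∂(volume.restrict (Icc 0 T)), FrozenField R (l t) (L t) (v t) (Dv t)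
  weight : IsVolterraWeight T (fun s => l s + L s) lam

/-- A continuous extension of a non-local flow that is bounded by `R` on the initial ball. -/
structure IsBoundedFlow (T r R : ℝ) (v : ℝ → Measure (Space d) → Space d → Space d) (τ : ℝ)
    (μ : Measure (Space d)) (Φ : ℝ → Space d → Space d) : Prop where
  τ_mem : τ ∈ Icc 0 T
  μ_mem : μ ∈ probOn (Metric.closedBall (0 : Space d) r)
  flow : IsNonlocalFlow T v (Metric.closedBall 0 r) τ μ Φ
  cont : Continuous fun p : ℝ × Space d => Φ p.1 p.2
  bound : ∀ t ∈ Icc 0 T, ∀ x ∈ Metric.closedBall (0 : Space d) r, ‖Φ t x‖ ≤ R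

/-- The solution of the equation of variations in space along a flow. -/
structure IsVariation (T r : ℝ) (v : ℝ → Measure (Space d) → Space d → Space d) (τ : ℝ)
    (μ : Measure (Space d)) (Φ : ℝ → Space d → Space d) (A : ℝ → Space d → Space d →L[ℝ] Space d) :
    Prop where
  cont : Continuous fun p : ℝ × Space d => A p.1 p.2
  integrable : ∀ x ∈ Metric.closedBall (0 : Space d) r,
    IntegrableOn (fun s => (fderiv ℝ (v s (μ.map (Φ s))) (Φ s x)).comp (A s x)) (Icc 0 T)
  eq_integral : ∀ t ∈ Icc 0 T, ∀ x ∈ Metric.closedBall (0 : Space d) r, A t x =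
    ContinuousLinearMap.id ℝ (Space d) +
      ∫ s in τ..t, (fderiv ℝ (v s (μ.map (Φ s))) (Φ s x)).comp (A s x)

section Frame

variable {T r R lam : ℝ} {l L : ℝ → ℝ} {v : ℝ → Measure (Space d) → Space d → Space d}
  {Dv : ℝ → Measure (Space d) → Space d → Space d → Space d →L[ℝ] Space d}
  {τ : ℝ} {μ : Measure (Space d)} {Φ : ℝ → Space d → Space d}
  {A : ℝ → Space d → Space d →L[ℝ] Space d}

lemma intervalIntegrable_of_integrableOn_Icc {E : Type*} [NormedAddCommGroup E] {f : ℝ → E}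
    (hf : IntegrableOn f (Icc 0 T)) (hτ : τ ∈ Icc 0 T) {t : ℝ} (ht : t ∈ Icc 0 T) :
    IntervalIntegrable f volume τ t :=
  intervalIntegrable_iff.2 (hf.mono_set (uIoc_subset_Icc_of_mem hτ ht))

lemma exists_bound_of_continuous {E : Type*} [NormedAddCommGroup E] {f : ℝ → Space d → E}
    (hf : Continuous fun p : ℝ × Space d => f p.1 p.2) (T r : ℝ) :
    ∃ M, 0 ≤ M ∧ ∀ t ∈ Icc 0 T, ∀ x ∈ Metric.closedBall (0 : Space d) r, ‖f t x‖ ≤ M := by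
  obtain ⟨M, hM⟩ := ((isCompact_Icc (a := 0) (b := T)).prod
    (isCompact_closedBall (0 : Space d) r)).exists_bound_of_continuousOn hf.continuousOn
  exact ⟨|M|, abs_nonneg M, fun t ht x hx => (hM (t, x) ⟨ht, hx⟩).trans (le_abs_self M)⟩

/-- The weight is at most `exp (lam * T)` because `|t - τ| ≤ T`, so one constant serves every
initial time and every flow in the frame. -/
lemma Frame.norm_le (h : Frame T r R lam l L v Dv) {E Q : Type*} [NormedAddCommGroup E]
    [NormedSpace ℝ E] (hτ : τ ∈ Icc 0 T) {e : ℝ → Q → E} {c : Q → E} {F : ℝ → Q → E}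
    {f : Q → ℝ → ℝ} {B : ℝ} (hbdd : ∃ M, ∀ t ∈ Icc 0 T, ∀ q, ‖e t q‖ ≤ M)
    (heq : ∀ t ∈ Icc 0 T, ∀ q, e t q = c q + ∫ s in τ..t, F s q)
    (hf : ∀ q, IntegrableOn (f q) (Icc 0 T)) (hf0 : ∀ q s, 0 ≤ f q s)
    (hB : ∀ q, ‖c q‖ + ∫ s in Icc 0 T, f q s ≤ B)
    (hF : ∀ q, ∀ᵐ s ∂(volume.restrict (Icc 0 T)), ∀ N, (∀ q', ‖e s q'‖ ≤ N) →
      ‖F s q‖ ≤ (l s + L s) * N + f q s) :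
    ∀ t ∈ Icc 0 T, ∀ q, ‖e t q‖ ≤ 2 * Real.exp (lam * T) * B := by
  intro t ht q
  have hB0 : 0 ≤ B := le_trans (add_nonneg (norm_nonneg _) (integral_nonneg (hf0 q))) (hB q)
  refine (h.weight.norm_le (h.l_int.add h.L_int) hτ hbdd heq hf hf0 hB hF t ht q).trans ?_
  have : |t - τ| ≤ T := by
    rw [abs_le]
    constructor <;> linarith [ht.1, ht.2, hτ.1, hτ.2]
  have : Real.exp (lam * |t - τ|) ≤ Real.exp (lam * T) :=
    Real.exp_le_exp.2 (mul_le_mul_of_nonneg_left this h.weight.1)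
  nlinarith

lemma IsBoundedFlow.continuous_slice (hΦ : IsBoundedFlow T r R v τ μ Φ) (t : ℝ) :
    Continuous (Φ t) :=
  hΦ.cont.comp (f := fun x => (t, x)) (by fun_prop)

lemma IsBoundedFlow.continuous_time (hΦ : IsBoundedFlow T r R v τ μ Φ) (x : Space d) :
    Continuous (fun t => Φ t x) :=
  hΦ.cont.comp (f := fun t => (t, x)) (by fun_prop)

lemma IsBoundedFlow.isBoundedCurve (hΦ : IsBoundedFlow T r R v τ μ Φ) {Ω : Type*}
    [MeasurableSpace Ω] {P : Measure Ω} {g : Ω → Space d} (hg : AEMeasurable g P)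
    (hgK : ∀ᵐ ω ∂P, g ω ∈ Metric.closedBall (0 : Space d) r) :
    IsBoundedCurve T R P (fun s ω => Φ s (g ω)) where
  meas σ _ := (hΦ.continuous_slice σ).measurable.comp_aemeasurable hg
  bound σ hσ := hgK.mono fun _ hω => hΦ.bound σ hσ _ hω
  cont := Eventually.of_forall fun ω => (hΦ.continuous_time (g ω)).continuousOn

lemma IsBoundedFlow.isBoundedCurve_self (hΦ : IsBoundedFlow T r R v τ μ Φ) :
    IsBoundedCurve T R μ Φ :=
  hΦ.isBoundedCurve aemeasurable_id (ae_mem_of_mem_probOn hΦ.μ_mem)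

lemma IsBoundedFlow.map_mem_probOn (hΦ : IsBoundedFlow T r R v τ μ Φ) {s : ℝ} (hs : s ∈ Icc 0 T) :
    μ.map (Φ s) ∈ probOn (Metric.closedBall (0 : Space d) R) := by
  have := hΦ.μ_mem.1
  exact NonlocalFlow.map_mem_probOn (hΦ.isBoundedCurve_self.meas s hs)
    (hΦ.isBoundedCurve_self.bound s hs)

lemma IsBoundedFlow.intervalIntegrable (hΦ : IsBoundedFlow T r R v τ μ Φ) {t : ℝ}
    (ht : t ∈ Icc 0 T) {x : Space d} (hx : x ∈ Metric.closedBall (0 : Space d) r) :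
    IntervalIntegrable (fun s => v s (μ.map (Φ s)) (Φ s x)) volume τ t :=
  (hΦ.flow.integrable x hx).mono_set (by
    rw [uIcc_of_le (hΦ.τ_mem.1.trans hΦ.τ_mem.2)]
    exact uIcc_subset_Icc hΦ.τ_mem ht)

lemma IsBoundedFlow.aestronglyMeasurable_fderiv (hΦ : IsBoundedFlow T r R v τ μ Φ)
    (h : Frame T r R lam l L v Dv) {x : Space d} (hx : x ∈ Metric.closedBall (0 : Space d) r)
    {e : ℝ → Space d} (he : ContinuousOn e (Icc 0 T)) :
    AEStronglyMeasurable (fun s => fderiv ℝ (v s (μ.map (Φ s))) (Φ s x) (e s))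
      (volume.restrict (Icc 0 T)) := by
  have := hΦ.μ_mem.1
  exact h.hyp.aestronglyMeasurable_fderiv h.T_nonneg h.R_pos hΦ.isBoundedCurve_self
    (hΦ.continuous_time x).continuousOn (fun σ hσ => hΦ.bound σ hσ x hx) he

/-- Flows are Lipschitz in space. -/
lemma Frame.exists_norm_flow_sub_le (h : Frame T r R lam l L v Dv) :
    ∃ C > 0, ∀ τ μ Φ, IsBoundedFlow T r R v τ μ Φ → ∀ t ∈ Icc 0 T,
      ∀ x ∈ Metric.closedBall (0 : Space d) r, ∀ y ∈ Metric.closedBall (0 : Space d) r,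
      ‖Φ t x - Φ t y‖ ≤ C * ‖x - y‖ := by
  refine ⟨2 * Real.exp (lam * T), by positivity, fun τ μ Φ hΦ t ht x hx y hy => ?_⟩
  have := hΦ.μ_mem.1
  -- Both trajectories are driven by the same measure, so the dependence on the measure cancels and
  -- the single difference `Φ t x - Φ t y` is a closed unknown.
  refine h.norm_le (Q := Unit) hΦ.τ_mem (e := fun t _ => Φ t x - Φ t y) (c := fun _ => x - y)
    (f := fun _ _ => 0)
    (F := fun s _ => v s (μ.map (Φ s)) (Φ s x) - v s (μ.map (Φ s)) (Φ s y))
    ⟨R + R, fun t ht q => (norm_sub_le _ _).trans (add_le_add (hΦ.bound t ht x hx)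
      (hΦ.bound t ht y hy))⟩
    (fun t ht _ => ?_) (fun _ => integrableOn_zero) (fun _ _ => le_rfl) (fun _ => by simp)
    (fun _ => ?_) t ht ()
  · rw [hΦ.flow.eq_integral t ht x hx, hΦ.flow.eq_integral t ht y hy,
      intervalIntegral.integral_sub (hΦ.intervalIntegrable ht hx) (hΦ.intervalIntegrable ht hy)]
    abel
  · filter_upwards [h.frozen, ae_restrict_mem measurableSet_Icc] with s hs hsT N hN
    have c := hΦ.isBoundedCurve_self
    have h1 := hs.norm_sub_le (c.meas s hsT) (c.bound s hsT) (c.meas s hsT) (c.bound s hsT)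
      (hΦ.bound s hsT x hx) (hΦ.bound s hsT y hy)
    simp only [sub_self, norm_zero, integral_zero, mul_zero, add_zero] at h1
    have h2 := hN ()
    have h3 : 0 ≤ N := (norm_nonneg _).trans h2
    calc _ ≤ l s * N := h1.trans (by gcongr; exact hs.l_nonneg)
      _ ≤ (l s + L s) * N + 0 := by nlinarith [hs.L_nonneg]

/-- A linear Volterra equation for operators, with rate `l` because the space derivative of the
velocity is bounded by its Lipschitz constant. Measurability is checked vector by vector. -/
lemma Frame.exists_isVariation (h : Frame T r R lam l L v Dv) (hΦ : IsBoundedFlow T r R v τ μ Φ) :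
    ∃ A, IsVariation T r v τ μ Φ A := by
  have hμ1 := hΦ.μ_mem.1
  have hop : ∀ᵐ s ∂(volume.restrict (Icc 0 T)), ∀ q : Ball d r, ∀ B : Space d →L[ℝ] Space d,
      ‖(fderiv ℝ (v s (μ.map (Φ s))) (Φ s q)).comp B‖ ≤ l s * ‖B‖ := by
    filter_upwards [h.frozen, ae_restrict_mem measurableSet_Icc] with s hs hsT q B
    refine (ContinuousLinearMap.opNorm_comp_le _ _).trans ?_
    gcongr
    exact hs.norm_fderiv_le (hΦ.map_mem_probOn hsT) (hΦ.bound s hsT q q.2)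
  obtain ⟨u, hu, hint, heq⟩ := exists_volterra_solution (T := T) hΦ.τ_mem
    (ContinuousMap.const (Ball d r) (ContinuousLinearMap.id ℝ (Space d)))
    (fun s u q => (fderiv ℝ (v s (μ.map (Φ s))) (Φ s q)).comp (u q)) (k := l) (g := l)
    h.l_int h.l_int (by
      filter_upwards [hop] with s hs u w q
      rw [← ContinuousLinearMap.comp_sub]
      refine (hs q _).trans ?_
      have := h.l_nonneg s
      gcongr
      exact (u - w).norm_coe_le_norm q) (by
      filter_upwards [hop] with s hs u q
      refine (hs q _).trans ?_
      have := h.l_nonneg s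
      gcongr
      linarith [u.norm_coe_le_norm q]) (by
      filter_upwards [h.frozen, ae_restrict_mem measurableSet_Icc] with s hs hsT u
      have h1 : Continuous fun q : Ball d r => fderiv ℝ (v s (μ.map (Φ s))) (Φ s q) :=
        (hs.continuousOn_fderiv (hΦ.map_mem_probOn hsT)).comp_continuous
          ((hΦ.continuous_slice s).comp continuous_subtype_val)
          fun q => mem_closedBall_zero_iff.2 (hΦ.bound s hsT q q.2)
      exact h1.clm_comp u.continuous)
    (fun u hu q => by
      refine aestronglyMeasurable_clm fun e => ?_
      have h1 : Continuous fun s => u s q e :=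
        ((continuous_eval_const q).comp hu).clm_apply continuous_const
      exact hΦ.aestronglyMeasurable_fderiv h q.2 h1.continuousOn)
  have huncurry : Continuous fun p : ℝ × Ball d r => u p.1 p.2 := by
    have : Continuous fun p : ℝ × Ball d r => (u p.1, p.2) := by fun_prop
    exact ContinuousEval.continuous_eval.comp this
  refine ⟨fun t x => u t (ballRetract h.r_pos x),
    huncurry.comp (f := fun p : ℝ × Space d => (p.1, ballRetract h.r_pos p.2)) (by fun_prop),
    fun x hx => ?_, fun t ht x hx => ?_⟩
  · simp only [ballRetract_of_mem h.r_pos hx]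
    exact hint ⟨x, hx⟩
  · simp only [ballRetract_of_mem h.r_pos hx]
    exact heq t ht ⟨x, hx⟩

lemma Frame.exists_norm_variation_le (h : Frame T r R lam l L v Dv) :
    ∃ C > 0, ∀ τ μ Φ A, IsBoundedFlow T r R v τ μ Φ → IsVariation T r v τ μ Φ A →
      ∀ t ∈ Icc 0 T, ∀ x ∈ Metric.closedBall (0 : Space d) r, ‖A t x‖ ≤ C := by
  refine ⟨2 * Real.exp (lam * T) * 1, by positivity, fun τ μ Φ A hΦ hA t ht x hx => ?_⟩
  obtain ⟨M, -, hM⟩ := exists_bound_of_continuous hA.cont T r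
  refine h.norm_le (Q := Unit) hΦ.τ_mem (e := fun t _ => A t x)
    (c := fun _ => ContinuousLinearMap.id ℝ (Space d)) (f := fun _ _ => 0)
    (F := fun s _ => (fderiv ℝ (v s (μ.map (Φ s))) (Φ s x)).comp (A s x))
    ⟨M, fun t ht _ => hM t ht x hx⟩ (fun t ht _ => hA.eq_integral t ht x hx)
    (fun _ => integrableOn_zero) (fun _ _ => le_rfl)
    (fun _ => by simpa using ContinuousLinearMap.norm_id_le) (fun _ => ?_) t ht ()
  filter_upwards [h.frozen, ae_restrict_mem measurableSet_Icc] with s hs hsT N hN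
  have h2 := hN ()
  have h3 : 0 ≤ N := (norm_nonneg _).trans h2
  calc _ ≤ l s * N := (ContinuousLinearMap.opNorm_comp_le _ _).trans (by
        gcongr
        · exact hs.l_nonneg
        · exact hs.norm_fderiv_le (hΦ.map_mem_probOn hsT) (hΦ.bound s hsT x hx))
    _ ≤ (l s + L s) * N + 0 := by nlinarith [hs.L_nonneg]

end Frame

/-! ### Flows with coupled initial measures -/

/-- Two flows, a coupling of their initial measures, and the space derivative of the first. -/
structure FlowCoupling (T r R : ℝ) (v : ℝ → Measure (Space d) → Space d → Space d) where
  τ : ℝ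
  μ : Measure (Space d)
  ν : Measure (Space d)
  γ : Measure (Space d × Space d)
  Φ : ℝ → Space d → Space d
  Ψ : ℝ → Space d → Space d
  A : ℝ → Space d → Space d →L[ℝ] Space d
  flow_fst : IsBoundedFlow T r R v τ μ Φ
  flow_snd : IsBoundedFlow T r R v τ ν Ψ
  isVariation : IsVariation T r v τ μ Φ A
  mem_plans : γ ∈ plans μ ν

namespace FlowCoupling

variable {T r R lam : ℝ} {l L : ℝ → ℝ} {v : ℝ → Measure (Space d) → Space d → Space d}
  {Dv : ℝ → Measure (Space d) → Space d → Space d → Space d →L[ℝ] Space d}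
  (c : FlowCoupling T r R v)

instance : IsProbabilityMeasure c.γ := c.mem_plans.1

lemma ae_mem : ∀ᵐ p ∂c.γ, p.1 ∈ Metric.closedBall (0 : Space d) r ∧
    p.2 ∈ Metric.closedBall (0 : Space d) r := by
  filter_upwards [ae_norm_le_of_mem_plans c.flow_fst.μ_mem c.flow_snd.μ_mem c.mem_plans] with p hp
  exact ⟨mem_closedBall_zero_iff.2 hp.1, mem_closedBall_zero_iff.2 hp.2⟩

lemma map_fst (s : ℝ) : c.γ.map (fun p => c.Φ s p.1) = c.μ.map (c.Φ s) := by
  rw [← c.mem_plans.2.1, Measure.map_map (c.flow_fst.continuous_slice s).measurable measurable_fst]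
  rfl

lemma map_snd (s : ℝ) : c.γ.map (fun p => c.Ψ s p.2) = c.ν.map (c.Ψ s) := by
  rw [← c.mem_plans.2.2, Measure.map_map (c.flow_snd.continuous_slice s).measurable measurable_snd]
  rfl

lemma isBoundedCurve_fst : IsBoundedCurve T R c.γ (fun s p => c.Φ s p.1) :=
  c.flow_fst.isBoundedCurve measurable_fst.aemeasurable (c.ae_mem.mono fun _ h => h.1)

lemma isBoundedCurve_snd : IsBoundedCurve T R c.γ (fun s p => c.Ψ s p.2) :=
  c.flow_snd.isBoundedCurve measurable_snd.aemeasurable (c.ae_mem.mono fun _ h => h.2)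

/-- The quadratic cost of the initial coupling. -/
noncomputable def cost : ℝ := planCost 2 c.γ

lemma cost_nonneg : 0 ≤ c.cost := planCost_nonneg _ _

lemma cost_eq : c.cost = Real.sqrt (∫ p, ‖p.2 - p.1‖ ^ 2 ∂c.γ) := by
  rw [cost, planCost_two]
  simp_rw [norm_sub_rev]

lemma memLp_sub (q : ENNReal) : MemLp (fun p : Space d × Space d => p.2 - p.1) q c.γ :=
  memLp_of_ae_bound q (R := r + r) (by fun_prop) (by
    filter_upwards [c.ae_mem] with p hp
    exact (norm_sub_le _ _).trans (add_le_add (mem_closedBall_zero_iff.1 hp.2)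
      (mem_closedBall_zero_iff.1 hp.1)))

lemma integral_norm_sub_le : ∫ p, ‖p.2 - p.1‖ ∂c.γ ≤ c.cost := by
  rw [cost_eq]
  exact integral_norm_le_sqrt (c.memLp_sub 2)

lemma integral_le_of_norm_le {E : Type*} [NormedAddCommGroup E] {f : Space d × Space d → E}
    {a b : ℝ} (hb : 0 ≤ b) (hf : ∀ᵐ p ∂c.γ, ‖f p‖ ≤ a + b * ‖p.2 - p.1‖) :
    ∫ p, ‖f p‖ ∂c.γ ≤ a + b * c.cost := by
  have hi : Integrable (fun p : Space d × Space d => b * ‖p.2 - p.1‖) c.γ :=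
    ((memLp_one_iff_integrable.1 (c.memLp_sub 1)).norm).const_mul b
  calc ∫ p, ‖f p‖ ∂c.γ ≤ ∫ p, (a + b * ‖p.2 - p.1‖) ∂c.γ :=
        integral_mono_of_nonneg (Eventually.of_forall fun _ => norm_nonneg _)
          ((integrable_const a).add hi) hf
    _ = a + b * ∫ p, ‖p.2 - p.1‖ ∂c.γ := by
        rw [integral_add (integrable_const a) hi, integral_const_mul]
        simp
    _ ≤ a + b * c.cost := by gcongr; exact c.integral_norm_sub_le

end FlowCoupling

/-! ### Stability of the flow and expansion of its space increments. -/

section Stability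

variable {T r R lam : ℝ} {l L : ℝ → ℝ} {v : ℝ → Measure (Space d) → Space d → Space d}
  {Dv : ℝ → Measure (Space d) → Space d → Space d → Space d →L[ℝ] Space d}

/-- Flows depend on the initial measure in a Lipschitz way. -/
lemma Frame.exists_stability (h : Frame T r R lam l L v Dv) :
    ∃ C > 0, ∀ c : FlowCoupling T r R v, ∀ t ∈ Icc 0 T,
      ∀ x ∈ Metric.closedBall (0 : Space d) r, ‖c.Ψ t x - c.Φ t x‖ ≤ C * c.cost := by
  obtain ⟨C₁, hC₁, hlip⟩ := h.exists_norm_flow_sub_le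
  have hLi : 0 ≤ ∫ s in Icc 0 T, L s := integral_nonneg h.L_nonneg
  -- The `+ 1` only keeps the constant positive when the integral of `L` vanishes.
  refine ⟨2 * Real.exp (lam * T) * ((∫ s in Icc 0 T, L s) * C₁ + 1), by positivity,
    fun c t ht x hx => ?_⟩
  have hW := c.cost_nonneg
  -- The unknown is the whole family over the ball, since comparing the transported measures
  -- averages `Ψ - Φ` over the second marginal. What remains there, `Φ s p.2 - Φ s p.1`, is the
  -- source and is controlled by the cost.
  have key := h.norm_le (Q := Ball d r) c.flow_fst.τ_mem (e := fun t q => c.Ψ t q - c.Φ t q)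
    (c := fun _ => 0) (f := fun _ s => L s * (C₁ * c.cost))
    (F := fun s q => v s (c.ν.map (c.Ψ s)) (c.Ψ s q) - v s (c.μ.map (c.Φ s)) (c.Φ s q))
    (B := (∫ s in Icc 0 T, L s) * (C₁ * c.cost))
    ⟨R + R, fun t ht q => (norm_sub_le _ _).trans (add_le_add (c.flow_snd.bound t ht q q.2)
      (c.flow_fst.bound t ht q q.2))⟩
    (fun t ht q => by
      rw [c.flow_snd.flow.eq_integral t ht q q.2, c.flow_fst.flow.eq_integral t ht q q.2,
        intervalIntegral.integral_sub (c.flow_snd.intervalIntegrable ht q.2)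
          (c.flow_fst.intervalIntegrable ht q.2)]
      abel) (fun _ => h.L_int.mul_const _)
    (fun _ s => mul_nonneg (h.L_nonneg s) (by positivity))
    (fun _ => by simp [integral_mul_const]) (fun q => by
      filter_upwards [h.frozen, ae_restrict_mem measurableSet_Icc] with s hs hsT N hN
      rw [← c.map_fst, ← c.map_snd]
      have b1 := c.isBoundedCurve_fst
      have b2 := c.isBoundedCurve_snd
      refine (hs.norm_sub_le (b2.meas s hsT) (b2.bound s hsT) (b1.meas s hsT) (b1.bound s hsT)
        (c.flow_snd.bound s hsT q q.2) (c.flow_fst.bound s hsT q q.2)).trans ?_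
      have h1 : ∫ p, ‖c.Ψ s p.2 - c.Φ s p.1‖ ∂c.γ ≤ N + C₁ * c.cost := by
        refine c.integral_le_of_norm_le hC₁.le ?_
        filter_upwards [c.ae_mem] with p hp
        calc ‖c.Ψ s p.2 - c.Φ s p.1‖
            ≤ ‖c.Ψ s p.2 - c.Φ s p.2‖ + ‖c.Φ s p.2 - c.Φ s p.1‖ :=
              norm_sub_le_norm_sub_add_norm_sub _ _ _
          _ ≤ N + C₁ * ‖p.2 - p.1‖ :=
              add_le_add (hN ⟨p.2, hp.2⟩) (hlip _ _ _ c.flow_fst s hsT _ hp.2 _ hp.1)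
      calc _ ≤ l s * N + L s * (N + C₁ * c.cost) := by
            gcongr
            · exact hs.l_nonneg
            · exact hN q
            · exact hs.L_nonneg
        _ = _ := by ring) t ht ⟨x, hx⟩
  refine key.trans ?_
  have := mul_nonneg (Real.exp_pos (lam * T)).le hW
  linarith

/-- The combined Lipschitz estimate along the coupling. -/
lemma Frame.exists_norm_snd_sub_fst_le (h : Frame T r R lam l L v Dv) :
    ∃ C > 0, ∀ c : FlowCoupling T r R v, ∀ t ∈ Icc 0 T,
      ∀ y ∈ Metric.closedBall (0 : Space d) r, ∀ z ∈ Metric.closedBall (0 : Space d) r,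
        ‖c.Ψ t z - c.Φ t y‖ ≤ C * (c.cost + ‖z - y‖) := by
  obtain ⟨C₁, hC₁, hlip⟩ := h.exists_norm_flow_sub_le
  obtain ⟨C₂, hC₂, hstab⟩ := h.exists_stability
  refine ⟨C₁ + C₂, by positivity, fun c t ht y hy z hz => ?_⟩
  have hW := c.cost_nonneg
  calc ‖c.Ψ t z - c.Φ t y‖ ≤ ‖c.Ψ t z - c.Φ t z‖ + ‖c.Φ t z - c.Φ t y‖ :=
        norm_sub_le_norm_sub_add_norm_sub _ _ _
    _ ≤ C₂ * c.cost + C₁ * ‖z - y‖ :=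
        add_le_add (hstab c t ht z hz) (hlip _ _ _ c.flow_fst t ht z hz y hy)
    _ ≤ _ := by nlinarith [norm_nonneg (z - y), mul_nonneg hC₁.le hW,
        mul_nonneg hC₂.le (norm_nonneg (z - y))]

/-- The remainder in the expansion of the second field along the derivative of the first. -/
noncomputable def FlowCoupling.spaceRemainder (c : FlowCoupling T r R v) (y z : Space d) (s : ℝ) :
    Space d :=
  v s (c.ν.map (c.Ψ s)) (c.Ψ s z) - v s (c.ν.map (c.Ψ s)) (c.Ψ s y) -
    fderiv ℝ (v s (c.μ.map (c.Φ s))) (c.Φ s y) (c.Ψ s z - c.Ψ s y)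

lemma IsBoundedFlow.aestronglyMeasurable_velocity {τ : ℝ} {μ : Measure (Space d)}
    {Φ : ℝ → Space d → Space d} (hΦ : IsBoundedFlow T r R v τ μ Φ)
    (h : Frame T r R lam l L v Dv) {x : Space d} (hx : x ∈ Metric.closedBall (0 : Space d) r) :
    AEStronglyMeasurable (fun s => v s (μ.map (Φ s)) (Φ s x)) (volume.restrict (Icc 0 T)) := by
  have := hΦ.μ_mem.1
  exact h.hyp.aestronglyMeasurable_velocity h.T_nonneg h.R_pos hΦ.isBoundedCurve_self
    (hΦ.continuous_time x).continuousOn (fun σ hσ => hΦ.bound σ hσ x hx)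

lemma FlowCoupling.aestronglyMeasurable_spaceRemainder (c : FlowCoupling T r R v)
    (h : Frame T r R lam l L v Dv) {y z : Space d} (hy : y ∈ Metric.closedBall (0 : Space d) r)
    (hz : z ∈ Metric.closedBall (0 : Space d) r) :
    AEStronglyMeasurable (c.spaceRemainder y z) (volume.restrict (Icc 0 T)) :=
  ((c.flow_snd.aestronglyMeasurable_velocity h hz).sub
    (c.flow_snd.aestronglyMeasurable_velocity h hy)).sub
    (c.flow_fst.aestronglyMeasurable_fderiv h hy
      ((c.flow_snd.continuous_time z).sub (c.flow_snd.continuous_time y)).continuousOn)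

lemma FlowCoupling.norm_velocity_sub_le (c : FlowCoupling T r R v) {s : ℝ} (hs : s ∈ Icc 0 T)
    {D : Measure (Space d) → Space d → Space d → Space d →L[ℝ] Space d}
    {a b : ℝ} (hF : FrozenField R a b (v s) D) {x y : Space d} (hx : ‖x‖ ≤ R) (hy : ‖y‖ ≤ R) :
    ‖v s (c.ν.map (c.Ψ s)) x - v s (c.ν.map (c.Ψ s)) y‖ ≤ a * ‖x - y‖ := by
  have b2 := c.isBoundedCurve_snd
  have h1 := hF.norm_sub_le (b2.meas s hs) (b2.bound s hs) (b2.meas s hs) (b2.bound s hs) hx hy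
  simpa [c.map_snd] using h1

/-- The integral of the space remainder is small, uniformly over couplings. -/
lemma Frame.integral_spaceRemainder_le (h : Frame T r R lam l L v Dv) :
    ∀ ε > 0, ∃ δ > 0, ∀ c : FlowCoupling T r R v,
      ∀ y ∈ Metric.closedBall (0 : Space d) r, ∀ z ∈ Metric.closedBall (0 : Space d) r,
      c.cost + ‖z - y‖ ≤ δ →
        ∫ s in Icc 0 T, ‖c.spaceRemainder y z s‖ ≤ ε * ‖z - y‖ := by
  obtain ⟨C₁, hC₁, hlip⟩ := h.exists_norm_flow_sub_le
  obtain ⟨C₂, hC₂, hstab⟩ := h.exists_norm_snd_sub_fst_le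
  intro ε hε
  -- Smallness is required of both the cost and `‖z - y‖`, while the gain is relative to `‖z - y‖`
  -- alone; thus a coupling of zero cost still gives differentiability in space.
  obtain ⟨δ, hδ, H⟩ := exists_integral_le_mul_of_dominated (m := volume.restrict (Icc 0 T))
    (P := FlowCoupling T r R v × Ball d r × Ball d r)
    (fun p => p.1.cost + ‖(p.2.2 : Space d) - p.2.1‖) (fun p => ‖(p.2.2 : Space d) - p.2.1‖)
    (fun _ => norm_nonneg _) (fun p s => ‖p.1.spaceRemainder p.2.1 p.2.2 s‖)
    (g := fun s => 2 * C₁ * l s) (h.l_int.const_mul _)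
    (fun p => (p.1.aestronglyMeasurable_spaceRemainder h p.2.1.2 p.2.2.2).norm)
    (fun ⟨c, y, z⟩ => by
      filter_upwards [h.frozen, ae_restrict_mem measurableSet_Icc] with s hs hsT
      rw [abs_norm]
      have hl := hs.l_nonneg
      have h1 := hlip _ _ _ c.flow_snd s hsT z z.2 y y.2
      calc ‖c.spaceRemainder y z s‖ ≤ l s * ‖c.Ψ s z - c.Ψ s y‖ + l s * ‖c.Ψ s z - c.Ψ s y‖ := by
            refine (norm_sub_le _ _).trans (add_le_add ?_ ?_)
            · exact c.norm_velocity_sub_le hsT hs (c.flow_snd.bound s hsT z z.2)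
                (c.flow_snd.bound s hsT y y.2)
            · refine (ContinuousLinearMap.le_opNorm _ _).trans ?_
              gcongr
              exact hs.norm_fderiv_le (c.flow_fst.map_mem_probOn hsT) (c.flow_fst.bound s hsT y y.2)
        _ ≤ l s * (C₁ * ‖(z : Space d) - y‖) + l s * (C₁ * ‖(z : Space d) - y‖) := by gcongr
        _ = _ := by ring)
    (by
      filter_upwards [h.frozen, ae_restrict_mem measurableSet_Icc] with s hs hsT ε hε
      obtain ⟨δ, hδ, hu⟩ := hs.unif_space_map (Ω := Space d × Space d) (ε := ε / C₁)
        (by positivity)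
      refine ⟨δ / (2 * C₂), by positivity, fun ⟨c, y, z⟩ hp => ?_⟩
      simp only at hp
      have hW := c.cost_nonneg
      have hle : C₂ * (c.cost + ‖(z : Space d) - y‖) ≤ δ / 2 := by
        rw [le_div_iff₀ (by positivity)] at hp
        linarith
      have hcost : C₂ * (2 * c.cost) ≤ δ := by
        nlinarith [norm_nonneg ((z : Space d) - y)]
      have b1 := c.isBoundedCurve_fst
      have b2 := c.isBoundedCurve_snd
      have hint : ∫ p, ‖c.Φ s p.1 - c.Ψ s p.2‖ ∂c.γ ≤ δ := by
        simp_rw [norm_sub_rev (c.Φ s _)]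
        refine (c.integral_le_of_norm_le (a := C₂ * c.cost) hC₂.le ?_).trans (le_trans (by linarith) hcost)
        filter_upwards [c.ae_mem] with p hp
        rw [← mul_add]
        exact hstab c s hsT _ hp.1 _ hp.2
      -- Both balls are convex, so checking endpoints suffices: the whole segment remains where the
      -- bounds hold and within `δ` of the base point `c.Φ s y`.
      have hseg : segment ℝ (c.Ψ s y) (c.Ψ s z) ⊆
          Metric.closedBall 0 R ∩ Metric.closedBall (c.Φ s y) δ := by
        refine ((convex_closedBall _ _).inter (convex_closedBall _ _)).segment_subset
          ⟨mem_closedBall_zero_iff.2 (c.flow_snd.bound s hsT y y.2), mem_closedBall_iff_norm.2 ?_⟩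
          ⟨mem_closedBall_zero_iff.2 (c.flow_snd.bound s hsT z z.2), mem_closedBall_iff_norm.2 ?_⟩
        · refine (hstab c s hsT y y.2 y y.2).trans ?_
          rw [sub_self, norm_zero, add_zero]
          nlinarith
        · exact (hstab c s hsT y y.2 z z.2).trans (by linarith)
      have hmv := (convex_segment (𝕜 := ℝ) (c.Ψ s y) (c.Ψ s z)).norm_image_sub_le_of_norm_fderiv_le'
        (f := v s (c.ν.map (c.Ψ s))) (φ := fderiv ℝ (v s (c.μ.map (c.Φ s))) (c.Φ s y)) (C := ε / C₁)
        (fun x _ => hs.diff _ (probOn_closedBall_subset_compactlySupported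
          (c.flow_snd.map_mem_probOn hsT)) x)
        (fun x hx => by
          have := hu c.γ _ _ (b1.meas s hsT) (b2.meas s hsT) (b1.bound s hsT) (b2.bound s hsT)
            (c.Φ s y) x (c.flow_fst.bound s hsT y y.2) (mem_closedBall_zero_iff.1 (hseg hx).1) hint
            (by rw [norm_sub_rev]; exact mem_closedBall_iff_norm.1 (hseg hx).2)
          rwa [c.map_fst, c.map_snd] at this)
        (left_mem_segment ℝ _ _) (right_mem_segment ℝ _ _)
      rw [abs_norm]
      calc ‖c.spaceRemainder y z s‖ ≤ ε / C₁ * ‖c.Ψ s z - c.Ψ s y‖ := hmv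
        _ ≤ ε / C₁ * (C₁ * ‖(z : Space d) - y‖) := by
            gcongr
            exact hlip _ _ _ c.flow_snd s hsT z z.2 y y.2
        _ = _ := by field_simp) ε hε
  refine ⟨δ, hδ, fun c y hy z hz hle => ?_⟩
  simpa using H (c, ⟨y, hy⟩, ⟨z, hz⟩) hle

lemma FlowCoupling.integrableOn_spaceRemainder (c : FlowCoupling T r R v)
    (h : Frame T r R lam l L v Dv) {y z : Space d} (hy : y ∈ Metric.closedBall (0 : Space d) r)
    (hz : z ∈ Metric.closedBall (0 : Space d) r) :
    IntegrableOn (c.spaceRemainder y z) (Icc 0 T) := by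
  refine Integrable.mono' (h.l_int.mul_const (2 * (R + R)))
    (c.aestronglyMeasurable_spaceRemainder h hy hz) ?_
  filter_upwards [h.frozen, ae_restrict_mem measurableSet_Icc] with s hs hsT
  have hl := hs.l_nonneg
  have hb : ‖c.Ψ s z - c.Ψ s y‖ ≤ R + R := (norm_sub_le _ _).trans
    (add_le_add (c.flow_snd.bound s hsT z hz) (c.flow_snd.bound s hsT y hy))
  calc ‖c.spaceRemainder y z s‖ ≤ l s * ‖c.Ψ s z - c.Ψ s y‖ + l s * ‖c.Ψ s z - c.Ψ s y‖ := by
        refine (norm_sub_le _ _).trans (add_le_add ?_ ?_)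
        · exact c.norm_velocity_sub_le hsT hs (c.flow_snd.bound s hsT z hz)
            (c.flow_snd.bound s hsT y hy)
        · refine (ContinuousLinearMap.le_opNorm _ _).trans ?_
          gcongr
          exact hs.norm_fderiv_le (c.flow_fst.map_mem_probOn hsT) (c.flow_fst.bound s hsT y hy)
    _ ≤ l s * (R + R) + l s * (R + R) := by gcongr
    _ = _ := by ring

/-- The space increments of the second flow are approximated by the derivative of the first. -/
theorem Frame.norm_space_expansion_le (h : Frame T r R lam l L v Dv) :
    ∀ ε > 0, ∃ δ > 0, ∀ c : FlowCoupling T r R v,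
      ∀ y ∈ Metric.closedBall (0 : Space d) r, ∀ z ∈ Metric.closedBall (0 : Space d) r,
      c.cost + ‖z - y‖ ≤ δ → ∀ t ∈ Icc 0 T,
        ‖c.Ψ t z - c.Ψ t y - c.A t y (z - y)‖ ≤ ε * ‖z - y‖ := by
  intro ε hε
  obtain ⟨δ, hδ, H⟩ := h.integral_spaceRemainder_le (ε / (2 * Real.exp (lam * T))) (by positivity)
  refine ⟨δ, hδ, fun c y hy z hz hle t ht => ?_⟩
  obtain ⟨M, hM0, hM⟩ := exists_bound_of_continuous c.isVariation.cont T r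
  have hrem := c.integrableOn_spaceRemainder h hy hz
  have hA := c.isVariation.integrable y hy
  have key := h.norm_le (Q := Unit) c.flow_fst.τ_mem
    (e := fun t _ => c.Ψ t z - c.Ψ t y - c.A t y (z - y)) (c := fun _ => 0)
    (f := fun _ s => ‖c.spaceRemainder y z s‖)
    (F := fun s _ => fderiv ℝ (v s (c.μ.map (c.Φ s))) (c.Φ s y)
      (c.Ψ s z - c.Ψ s y - c.A s y (z - y)) + c.spaceRemainder y z s)
    (B := ε / (2 * Real.exp (lam * T)) * ‖z - y‖)
    ⟨R + R + M * ‖z - y‖, fun t ht _ => (norm_sub_le _ _).trans (add_le_add ((norm_sub_le _ _).trans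
      (add_le_add (c.flow_snd.bound t ht z hz) (c.flow_snd.bound t ht y hy)))
      ((c.A t y).le_of_opNorm_le (hM t ht y hy) _))⟩
    (fun t ht _ => by
      have i1 := c.flow_snd.intervalIntegrable ht hz
      have i2 := c.flow_snd.intervalIntegrable ht hy
      have i3 := intervalIntegrable_of_integrableOn_Icc hA c.flow_fst.τ_mem ht
      have e3 : c.A t y (z - y) = (z - y) + ∫ s in c.τ..t,
          fderiv ℝ (v s (c.μ.map (c.Φ s))) (c.Φ s y) (c.A s y (z - y)) := by
        rw [c.isVariation.eq_integral t ht y hy, add_apply,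
          ContinuousLinearMap.intervalIntegral_apply i3]
        rfl
      have i4 : IntervalIntegrable (fun s => fderiv ℝ (v s (c.μ.map (c.Φ s))) (c.Φ s y)
          (c.A s y (z - y))) volume c.τ t :=
        intervalIntegrable_iff.2 ((ContinuousLinearMap.apply ℝ (Space d) (z - y)).integrable_comp
          (intervalIntegrable_iff.1 i3))
      rw [c.flow_snd.flow.eq_integral t ht z hz, c.flow_snd.flow.eq_integral t ht y hy, e3]
      have : ∫ s in c.τ..t, (fderiv ℝ (v s (c.μ.map (c.Φ s))) (c.Φ s y)
          (c.Ψ s z - c.Ψ s y - c.A s y (z - y)) + c.spaceRemainder y z s) =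
          ∫ s in c.τ..t, (v s (c.ν.map (c.Ψ s)) (c.Ψ s z) - v s (c.ν.map (c.Ψ s)) (c.Ψ s y) -
            fderiv ℝ (v s (c.μ.map (c.Φ s))) (c.Φ s y) (c.A s y (z - y))) := by
        congr 1
        funext s
        rw [FlowCoupling.spaceRemainder, map_sub _ (c.Ψ s z - c.Ψ s y)]
        abel
      rw [this, intervalIntegral.integral_sub (i1.sub i2) i4, intervalIntegral.integral_sub i1 i2]
      abel)
    (fun _ => hrem.norm) (fun _ _ => norm_nonneg _)
    (fun _ => by simpa using H c y hy z hz hle) (fun _ => by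
      filter_upwards [h.frozen, ae_restrict_mem measurableSet_Icc] with s hs hsT N hN
      have h2 := hN ()
      have h3 : 0 ≤ N := (norm_nonneg _).trans h2
      refine (norm_add_le _ _).trans (add_le_add_left ?_ _)
      calc _ ≤ l s * N := (ContinuousLinearMap.le_opNorm _ _).trans (by
            gcongr
            · exact hs.l_nonneg
            · exact hs.norm_fderiv_le (c.flow_fst.map_mem_probOn hsT) (c.flow_fst.bound s hsT y hy))
        _ ≤ (l s + L s) * N := by nlinarith [hs.L_nonneg]) t ht ()
  refine key.trans (le_of_eq ?_)
  field_simp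

end Stability

/-! ### Differentiability in space -/

lemma FrozenField.continuousOn_integral_differential {Ω : Type*} [MeasurableSpace Ω]
    {P : Measure Ω} [IsProbabilityMeasure P] {X η : Ω → Space d} {R l L H : ℝ}
    {V : Measure (Space d) → Space d → Space d}
    {D : Measure (Space d) → Space d → Space d → Space d →L[ℝ] Space d}
    (h : FrozenField R l L V D) (hX : AEMeasurable X P) (hXR : ∀ᵐ ω ∂P, ‖X ω‖ ≤ R)
    (hη : AEMeasurable η P) (hηH : ∀ᵐ ω ∂P, ‖η ω‖ ≤ H) :
    ContinuousOn (fun x => ∫ ω, D (P.map X) x (X ω) (η ω) ∂P) (Metric.closedBall 0 R) := by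
  rw [Metric.continuousOn_iff]
  intro x hx ε hε
  have hI : 0 ≤ ∫ ω, ‖η ω‖ ∂P := integral_nonneg fun _ => norm_nonneg _
  set I := ∫ ω, ‖η ω‖ ∂P
  obtain ⟨δ, hδ, hu⟩ := h.unif_measure_map (Ω := Ω) (ε := ε / (I + 1)) (by positivity)
  refine ⟨δ, hδ, fun y hy hyx => ?_⟩
  rw [dist_eq_norm] at hyx ⊢
  rw [← integral_sub (h.integrable_differential hX hXR hη hηH y)
    (h.integrable_differential hX hXR hη hηH x)]
  have hi : Integrable (fun ω => ε / (I + 1) * ‖η ω‖) P :=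
    ((memLp_one_iff_integrable.1 (memLp_of_ae_bound 1 hη hηH)).norm).const_mul _
  have h1 : ‖∫ ω, (D (P.map X) y (X ω) (η ω) - D (P.map X) x (X ω) (η ω)) ∂P‖ ≤
      ∫ ω, ε / (I + 1) * ‖η ω‖ ∂P := by
    refine norm_integral_le_of_norm_le hi ?_
    filter_upwards [hXR] with ω hω
    refine ((D (P.map X) y (X ω) - D (P.map X) x (X ω)).le_of_opNorm_le ?_ _)
    refine hu P X X hX hX hXR hXR x y (X ω) (X ω) (mem_closedBall_zero_iff.1 hx)
      (mem_closedBall_zero_iff.1 hy) hω hω ?_ ?_ ?_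
    · simpa using hδ.le
    · rw [norm_sub_rev]; exact hyx.le
    · simpa using hδ.le
  rw [integral_const_mul] at h1
  refine h1.trans_lt ?_
  rw [div_mul_eq_mul_div, div_lt_iff₀ (by positivity)]
  nlinarith

section Derivative

variable {T r R lam : ℝ} {l L : ℝ → ℝ} {v : ℝ → Measure (Space d) → Space d → Space d}
  {Dv : ℝ → Measure (Space d) → Space d → Space d → Space d →L[ℝ] Space d}
  {τ : ℝ} {μ : Measure (Space d)} {Φ : ℝ → Space d → Space d}
  {A : ℝ → Space d → Space d →L[ℝ] Space d}

/-- The coupling of a flow with itself along the diagonal. -/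
noncomputable def FlowCoupling.diag (hΦ : IsBoundedFlow T r R v τ μ Φ)
    (hA : IsVariation T r v τ μ Φ A) : FlowCoupling T r R v where
  τ := τ
  μ := μ
  ν := μ
  γ := μ.map fun x => (x, x)
  Φ := Φ
  Ψ := Φ
  A := A
  flow_fst := hΦ
  flow_snd := hΦ
  isVariation := hA
  mem_plans := by
    have := hΦ.μ_mem.1
    have h := map_prodMk_mem_plans (P := μ) (X := id) (Y := id) aemeasurable_id aemeasurable_id
    rwa [Measure.map_id] at h

lemma FlowCoupling.cost_diag (hΦ : IsBoundedFlow T r R v τ μ Φ)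
    (hA : IsVariation T r v τ μ Φ A) : (FlowCoupling.diag hΦ hA).cost = 0 := by
  have := planCost_two_map_prodMk (P := μ) (X := fun x : Space d => x) (Y := fun x => x)
    aemeasurable_id aemeasurable_id
  simp only [sub_self, norm_zero, ne_eq, OfNat.ofNat_ne_zero, not_false_eq_true, zero_pow,
    integral_zero, Real.sqrt_zero] at this
  exact this

/-- The space expansion for the diagonal coupling: its cost is zero and its two flows coincide, so
what remains is the Fréchet estimate with derivative `A t y`. -/
lemma Frame.hasFDerivWithinAt (h : Frame T r R lam l L v Dv) (hΦ : IsBoundedFlow T r R v τ μ Φ)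
    (hA : IsVariation T r v τ μ Φ A) {t : ℝ} (ht : t ∈ Icc 0 T) {y : Space d}
    (hy : y ∈ Metric.closedBall (0 : Space d) r) :
    HasFDerivWithinAt (Φ t) (A t y) (Metric.closedBall 0 r) y := by
  rw [hasFDerivWithinAt_iff_isLittleO, Asymptotics.isLittleO_iff]
  intro ε hε
  obtain ⟨δ, hδ, H⟩ := h.norm_space_expansion_le ε hε
  filter_upwards [self_mem_nhdsWithin,
    mem_nhdsWithin_of_mem_nhds (Metric.closedBall_mem_nhds y hδ)] with z hz hzy
  refine H (FlowCoupling.diag hΦ hA) y hy z hz ?_ t ht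
  rw [FlowCoupling.cost_diag, zero_add]
  exact mem_closedBall_iff_norm.1 hzy

/-- The ball is convex with nonempty interior because `r > 0`, so derivatives within it are unique
even at boundary points. -/
lemma Frame.fderivWithin_eq (h : Frame T r R lam l L v Dv) (hΦ : IsBoundedFlow T r R v τ μ Φ)
    (hA : IsVariation T r v τ μ Φ A) {t : ℝ} (ht : t ∈ Icc 0 T) {y : Space d}
    (hy : y ∈ Metric.closedBall (0 : Space d) r) :
    fderivWithin ℝ (Φ t) (Metric.closedBall 0 r) y = A t y := by
  refine (h.hasFDerivWithinAt hΦ hA ht hy).fderivWithin ?_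
  refine uniqueDiffOn_convex (convex_closedBall _ _) ⟨0, ?_⟩ y hy
  exact Metric.ball_subset_interior_closedBall (Metric.mem_ball_self h.r_pos)

end Derivative

/-! ### The linearised equation -/

section Linearised

variable {T r R lam : ℝ} {l L : ℝ → ℝ} {v : ℝ → Measure (Space d) → Space d → Space d}
  {Dv : ℝ → Measure (Space d) → Space d → Space d → Space d →L[ℝ] Space d}

namespace FlowCoupling

variable (c : FlowCoupling T r R v)

/-- The non-local term of the linearised equation in the direction of a displacement field. -/
noncomputable def nonlocalTerm
    (Dv : ℝ → Measure (Space d) → Space d → Space d → Space d →L[ℝ] Space d) (s : ℝ)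
    (η : Space d × Space d → Space d) (x : Space d) : Space d :=
  ∫ p, Dv s (c.μ.map (c.Φ s)) (c.Φ s x) (c.Φ s p.1) (η p) ∂c.γ

/-- The displacement of the coupling transported along the flow. -/
def displacement (s : ℝ) (w : Space d → Space d) (p : Space d × Space d) : Space d :=
  c.A s p.1 (p.2 - p.1) + w p.1

/-- The right-hand side of the linearised equation. -/
noncomputable def lin (Dv : ℝ → Measure (Space d) → Space d → Space d → Space d →L[ℝ] Space d)
    (s : ℝ) (w : Space d → Space d) (x : Space d) : Space d :=
  fderiv ℝ (v s (c.μ.map (c.Φ s))) (c.Φ s x) (w x) + c.nonlocalTerm Dv s (c.displacement s w) x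

section FixedTime

variable {c} {s : ℝ} {a b H : ℝ} {η η' : Space d × Space d → Space d} {w w' : Space d → Space d}
  {x : Space d}

lemma integrable_nonlocal (hF : FrozenField R a b (v s) (Dv s)) (hs : s ∈ Icc 0 T)
    (hη : AEMeasurable η c.γ) (hηH : ∀ᵐ p ∂c.γ, ‖η p‖ ≤ H) (x : Space d) :
    Integrable (fun p => Dv s (c.μ.map (c.Φ s)) x (c.Φ s p.1) (η p)) c.γ := by
  have := hF.integrable_differential (c.isBoundedCurve_fst.meas s hs)
    (c.isBoundedCurve_fst.bound s hs) hη hηH x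
  rwa [c.map_fst] at this

lemma norm_nonlocalTerm_le (hF : FrozenField R a b (v s) (Dv s)) (hs : s ∈ Icc 0 T)
    (hη : AEMeasurable η c.γ) (hηH : ∀ᵐ p ∂c.γ, ‖η p‖ ≤ H)
    (hx : x ∈ Metric.closedBall (0 : Space d) r) :
    ‖c.nonlocalTerm Dv s η x‖ ≤ b * ∫ p, ‖η p‖ ∂c.γ := by
  have := hF.norm_integral_differential_le (c.isBoundedCurve_fst.meas s hs)
    (c.isBoundedCurve_fst.bound s hs) hη hηH (c.flow_fst.bound s hs x hx)
  rwa [c.map_fst] at this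

lemma nonlocalTerm_sub {H' : ℝ} (hF : FrozenField R a b (v s) (Dv s)) (hs : s ∈ Icc 0 T)
    (hη : AEMeasurable η c.γ) (hηH : ∀ᵐ p ∂c.γ, ‖η p‖ ≤ H)
    (hη' : AEMeasurable η' c.γ) (hηH' : ∀ᵐ p ∂c.γ, ‖η' p‖ ≤ H') (x : Space d) :
    c.nonlocalTerm Dv s η x - c.nonlocalTerm Dv s η' x =
      c.nonlocalTerm Dv s (fun p => η p - η' p) x := by
  rw [nonlocalTerm, nonlocalTerm, ← integral_sub (integrable_nonlocal hF hs hη hηH _)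
    (integrable_nonlocal hF hs hη' hηH' _)]
  simp only [nonlocalTerm, map_sub]

lemma aemeasurable_comp_fst (hw : ContinuousOn w (Metric.closedBall 0 r)) :
    AEMeasurable (fun p : Space d × Space d => w p.1) c.γ := by
  have h1 : AEMeasurable w c.μ := by
    have := hw.aemeasurable (μ := c.μ) Metric.isClosed_closedBall.measurableSet
    rwa [Measure.restrict_eq_self_of_ae_mem (ae_mem_of_mem_probOn c.flow_fst.μ_mem)] at this
  rw [← c.mem_plans.2.1] at h1
  exact h1.comp_measurable measurable_fst

lemma aemeasurable_displacement (hw : ContinuousOn w (Metric.closedBall 0 r)) :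
    AEMeasurable (c.displacement s w) c.γ := by
  refine AEMeasurable.add ?_ (aemeasurable_comp_fst hw)
  have h1 : Continuous (c.A s) := c.isVariation.cont.comp (f := fun x => (s, x)) (by fun_prop)
  have : Continuous fun p : Space d × Space d => c.A s p.1 (p.2 - p.1) :=
    (h1.comp continuous_fst).clm_apply (continuous_snd.sub continuous_fst)
  exact this.measurable.aemeasurable

lemma exists_norm_displacement_le (hs : s ∈ Icc 0 T) (hw : ContinuousOn w (Metric.closedBall 0 r)) :
    ∃ H, ∀ᵐ p ∂c.γ, ‖c.displacement s w p‖ ≤ H := by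
  obtain ⟨M, hM0, hM⟩ := exists_bound_of_continuous c.isVariation.cont T r
  obtain ⟨N, hN⟩ := (isCompact_closedBall (0 : Space d) r).exists_bound_of_continuousOn hw
  refine ⟨M * (r + r) + N, ?_⟩
  filter_upwards [c.ae_mem] with p hp
  refine (norm_add_le _ _).trans (add_le_add ?_ (hN _ hp.1))
  refine ((c.A s p.1).le_of_opNorm_le (hM s hs _ hp.1) _).trans ?_
  gcongr
  exact (norm_sub_le _ _).trans (add_le_add (mem_closedBall_zero_iff.1 hp.2)
    (mem_closedBall_zero_iff.1 hp.1))

/-- The inhomogeneous displacement `A (z - y)` cancels in the difference, and the nonlocal term is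
bounded by the Lipschitz constant in the measure. -/
lemma norm_lin_sub_le (hF : FrozenField R a b (v s) (Dv s)) (hs : s ∈ Icc 0 T)
    (hw : ContinuousOn w (Metric.closedBall 0 r)) (hw' : ContinuousOn w' (Metric.closedBall 0 r))
    {N : ℝ} (hN : ∀ x ∈ Metric.closedBall (0 : Space d) r, ‖w x - w' x‖ ≤ N)
    (hx : x ∈ Metric.closedBall (0 : Space d) r) :
    ‖c.lin Dv s w x - c.lin Dv s w' x‖ ≤ (a + b) * N := by
  obtain ⟨H, hH⟩ := exists_norm_displacement_le (c := c) hs hw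
  obtain ⟨H', hH'⟩ := exists_norm_displacement_le (c := c) hs hw'
  have hNae : ∀ᵐ p ∂c.γ, ‖w p.1 - w' p.1‖ ≤ N := c.ae_mem.mono fun p hp => hN _ hp.1
  have h1 : c.lin Dv s w x - c.lin Dv s w' x =
      fderiv ℝ (v s (c.μ.map (c.Φ s))) (c.Φ s x) (w x - w' x) +
        c.nonlocalTerm Dv s (fun p => w p.1 - w' p.1) x := by
    have h2 := nonlocalTerm_sub hF hs (aemeasurable_displacement (c := c) hw) hH
      (aemeasurable_displacement hw') hH' x
    simp only [displacement, add_sub_add_left_eq_sub] at h2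
    rw [← h2, lin, lin, map_sub]
    abel
  have h3 : ∫ p, ‖w p.1 - w' p.1‖ ∂c.γ ≤ N :=
    (integral_mono_of_nonneg (Eventually.of_forall fun _ => norm_nonneg _)
      (integrable_const N) hNae).trans (le_of_eq (by simp))
  rw [h1, add_mul]
  refine (norm_add_le _ _).trans (add_le_add ?_ ?_)
  · refine (ContinuousLinearMap.le_of_opNorm_le _ (hF.norm_fderiv_le
      (c.flow_fst.map_mem_probOn hs) (c.flow_fst.bound s hs x hx)) _).trans ?_
    have := hF.l_nonneg
    gcongr
    exact hN x hx
  · refine (norm_nonlocalTerm_le hF hs ((aemeasurable_comp_fst hw).sub (aemeasurable_comp_fst hw'))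
      hNae hx).trans ?_
    exact mul_le_mul_of_nonneg_left h3 hF.L_nonneg

/-- Compare with `w = 0`, where only the transported displacement `A (z - y)` remains and integrates
to at most `C` times the cost. -/
lemma norm_lin_le (hF : FrozenField R a b (v s) (Dv s)) (hs : s ∈ Icc 0 T)
    {C : ℝ} (hC : 0 ≤ C) (hA : ∀ x ∈ Metric.closedBall (0 : Space d) r, ‖c.A s x‖ ≤ C)
    (hw : ContinuousOn w (Metric.closedBall 0 r)) {N : ℝ}
    (hN : ∀ x ∈ Metric.closedBall (0 : Space d) r, ‖w x‖ ≤ N)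
    (hx : x ∈ Metric.closedBall (0 : Space d) r) :
    ‖c.lin Dv s w x‖ ≤ (a + b) * N + b * (C * c.cost) := by
  have h0 : ContinuousOn (fun _ : Space d => (0 : Space d)) (Metric.closedBall 0 r) :=
    continuousOn_const
  have h1 := norm_lin_sub_le (c := c) hF hs hw h0 (by simpa using hN) hx
  obtain ⟨H, hH⟩ := exists_norm_displacement_le (c := c) hs h0
  have h2 : ‖c.lin Dv s (fun _ => 0) x‖ ≤ b * (C * c.cost) := by
    rw [lin, map_zero, zero_add]
    refine (norm_nonlocalTerm_le hF hs (aemeasurable_displacement h0) hH hx).trans ?_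
    have := hF.L_nonneg
    gcongr
    refine (c.integral_le_of_norm_le (a := 0) hC ?_).trans (by rw [zero_add])
    filter_upwards [c.ae_mem] with p hp
    rw [displacement, add_zero, zero_add]
    exact (c.A s p.1).le_of_opNorm_le (hA _ hp.1) _
  calc _ = ‖(c.lin Dv s w x - c.lin Dv s (fun _ => 0) x) + c.lin Dv s (fun _ => 0) x‖ := by
        rw [sub_add_cancel]
    _ ≤ _ := (norm_add_le _ _).trans (add_le_add h1 h2)

lemma continuousOn_lin (hF : FrozenField R a b (v s) (Dv s)) (hs : s ∈ Icc 0 T)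
    (hw : ContinuousOn w (Metric.closedBall 0 r)) :
    ContinuousOn (c.lin Dv s w) (Metric.closedBall 0 r) := by
  obtain ⟨H, hH⟩ := exists_norm_displacement_le (c := c) hs hw
  have hmaps : MapsTo (c.Φ s) (Metric.closedBall 0 r) (Metric.closedBall 0 R) :=
    fun x hx => mem_closedBall_zero_iff.2 (c.flow_fst.bound s hs x hx)
  have hΦ := (c.flow_fst.continuous_slice s).continuousOn (s := Metric.closedBall 0 r)
  refine ContinuousOn.add ?_ ?_
  · exact ((hF.continuousOn_fderiv (c.flow_fst.map_mem_probOn hs)).comp hΦ hmaps).clm_apply hw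
  · have h1 := hF.continuousOn_integral_differential (c.isBoundedCurve_fst.meas s hs)
      (c.isBoundedCurve_fst.bound s hs) (aemeasurable_displacement (c := c) hw) hH
    rw [c.map_fst] at h1
    exact h1.comp hΦ hmaps

end FixedTime

lemma continuousOn_slice {w : ℝ → Space d → Space d}
    (hw : ContinuousOn (fun p : ℝ × Space d => w p.1 p.2) (Icc 0 T ×ˢ Metric.closedBall 0 r))
    {s : ℝ} (hs : s ∈ Icc 0 T) : ContinuousOn (w s) (Metric.closedBall 0 r) :=
  hw.comp (f := fun x => (s, x)) (by fun_prop) fun _ hx => ⟨hs, hx⟩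

variable {c}

lemma aestronglyMeasurable_nonlocalTerm (h : Frame T r R lam l L v Dv) {H : ℝ}
    {η : ℝ → Space d × Space d → Space d} (hη : IsBoundedCurve T H c.γ η) {x : Space d}
    (hx : x ∈ Metric.closedBall (0 : Space d) r) :
    AEStronglyMeasurable (fun s => c.nonlocalTerm Dv s (η s) x) (volume.restrict (Icc 0 T)) := by
  have := h.hyp.aestronglyMeasurable_differential h.T_nonneg h.R_pos c.isBoundedCurve_fst hη
    (c.flow_fst.continuous_time x).continuousOn (fun σ hσ => c.flow_fst.bound σ hσ x hx)
  simp only [c.map_fst] at this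
  exact this

lemma aestronglyMeasurable_lin (h : Frame T r R lam l L v Dv) {w : ℝ → Space d → Space d}
    (hw : ContinuousOn (fun p : ℝ × Space d => w p.1 p.2) (Icc 0 T ×ˢ Metric.closedBall 0 r))
    {x : Space d} (hx : x ∈ Metric.closedBall (0 : Space d) r) :
    AEStronglyMeasurable (fun s => c.lin Dv s (w s) x) (volume.restrict (Icc 0 T)) := by
  refine (c.flow_fst.aestronglyMeasurable_fderiv h hx
    (hw.comp (f := fun s => (s, x)) (by fun_prop) fun _ hs => ⟨hs, hx⟩)).add ?_
  have hcont : ContinuousOn (fun q : ℝ × Space d × Space d => c.displacement q.1 (w q.1) q.2)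
      (Icc 0 T ×ˢ (Metric.closedBall (0 : Space d) r ×ˢ Metric.closedBall (0 : Space d) r)) := by
    refine ContinuousOn.add ?_ ?_
    · have h1 : Continuous fun q : ℝ × Space d × Space d => c.A q.1 q.2.1 :=
        c.isVariation.cont.comp (f := fun q : ℝ × Space d × Space d => (q.1, q.2.1)) (by fun_prop)
      exact (h1.clm_apply (by fun_prop)).continuousOn
    · exact hw.comp (f := fun q : ℝ × Space d × Space d => (q.1, q.2.1)) (by fun_prop)
        fun q hq => ⟨hq.1, hq.2.1⟩
  obtain ⟨H, hH⟩ := ((isCompact_Icc (a := 0) (b := T)).prod ((isCompact_closedBall (0 : Space d) r).prod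
    (isCompact_closedBall (0 : Space d) r))).exists_bound_of_continuousOn hcont
  have hm : MeasurableSet (Metric.closedBall (0 : Space d) r) :=
    Metric.isClosed_closedBall.measurableSet
  exact aestronglyMeasurable_nonlocalTerm h
    (isBoundedCurve_of_continuousOn (f := fun s p => c.displacement s (w s) p) (hm.prod hm)
      (c.ae_mem.mono fun p hp => hp) hcont fun t ht p hp => hH (t, p) ⟨ht, hp⟩) hx

lemma integrableOn_lin (h : Frame T r R lam l L v Dv) {w : ℝ → Space d → Space d}
    (hw : ContinuousOn (fun p : ℝ × Space d => w p.1 p.2) (Icc 0 T ×ˢ Metric.closedBall 0 r))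
    {x : Space d} (hx : x ∈ Metric.closedBall (0 : Space d) r) :
    IntegrableOn (fun s => c.lin Dv s (w s) x) (Icc 0 T) := by
  obtain ⟨M, hM0, hM⟩ := exists_bound_of_continuous c.isVariation.cont T r
  obtain ⟨N, hN⟩ := (isCompact_Icc.prod
    (isCompact_closedBall (0 : Space d) r)).exists_bound_of_continuousOn hw
  refine Integrable.mono' (((h.l_int.add h.L_int).mul_const N).add
    (h.L_int.mul_const (M * c.cost))) (aestronglyMeasurable_lin h hw hx) ?_
  filter_upwards [h.frozen, ae_restrict_mem measurableSet_Icc] with s hs hsT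
  exact norm_lin_le hs hsT hM0 (hM s hsT) (continuousOn_slice hw hsT)
    (fun x hx => hN (s, x) ⟨hsT, hx⟩) hx

lemma nonlocalIntegrand_ae_eq (h : Frame T r R lam l L v Dv) (w : ℝ → Space d → Space d)
    {s : ℝ} (hs : s ∈ Icc 0 T) (x : Space d) :
    nonlocalIntegrand Dv (Metric.closedBall 0 r) c.μ c.Φ w s x =ᵐ[c.γ]
      fun p => Dv s (c.μ.map (c.Φ s)) (c.Φ s x) (c.Φ s p.1) (c.displacement s (w s) p) := by
  filter_upwards [c.ae_mem] with p hp
  rw [nonlocalIntegrand, h.fderivWithin_eq c.flow_fst c.isVariation hs hp.1]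
  rfl

lemma linearisedRHS_eq (h : Frame T r R lam l L v Dv) (w : ℝ → Space d → Space d)
    {s : ℝ} (hs : s ∈ Icc 0 T) (x : Space d) :
    linearisedRHS v Dv (Metric.closedBall 0 r) c.μ c.γ c.Φ w s x = c.lin Dv s (w s) x := by
  rw [linearisedRHS, integral_congr_ae (nonlocalIntegrand_ae_eq h w hs x)]
  rfl

/-- The derivative within the ball equals `A` almost everywhere for the plan, so the equation can be
written with `lin`, and both integrability clauses then follow from continuity of `w`. -/
lemma isLinearisedSolution_iff (h : Frame T r R lam l L v Dv) {w : ℝ → Space d → Space d} :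
    IsLinearisedSolution T v Dv (Metric.closedBall 0 r) c.τ c.μ c.γ c.Φ w ↔
      ContinuousOn (fun p : ℝ × Space d => w p.1 p.2) (Icc 0 T ×ˢ Metric.closedBall 0 r) ∧
      ∀ t ∈ Icc 0 T, ∀ x ∈ Metric.closedBall (0 : Space d) r,
        w t x = ∫ s in c.τ..t, c.lin Dv s (w s) x := by
  have hcongr {t : ℝ} (ht : t ∈ Icc 0 T) (x : Space d) :
      ∫ s in c.τ..t, linearisedRHS v Dv (Metric.closedBall 0 r) c.μ c.γ c.Φ w s x =
        ∫ s in c.τ..t, c.lin Dv s (w s) x :=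
    intervalIntegral.integral_congr fun s hs =>
      linearisedRHS_eq h w (uIcc_subset_Icc c.flow_fst.τ_mem ht hs) x
  constructor
  · intro hw
    exact ⟨hw.continuousOn, fun t ht x hx => by rw [hw.eq_integral t ht x hx, hcongr ht]⟩
  · rintro ⟨hc, heq⟩
    refine ⟨hc, fun x hx => ?_, fun x hx => ?_, fun t ht x hx => ?_⟩
    · filter_upwards [h.frozen, ae_restrict_mem measurableSet_Icc] with s hs hsT
      have hcs := continuousOn_slice hc hsT
      obtain ⟨H, hH⟩ := exists_norm_displacement_le (c := c) hsT hcs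
      exact (integrable_nonlocal hs hsT (aemeasurable_displacement hcs) hH _).congr
        (nonlocalIntegrand_ae_eq h w hsT x).symm
    · rw [intervalIntegrable_iff]
      refine ((integrableOn_lin (c := c) h hc hx).congr_fun
        (fun s hs => (linearisedRHS_eq h w hs x).symm) measurableSet_Icc).mono_set ?_
      exact uIoc_subset_Icc_of_mem ⟨le_rfl, h.T_nonneg⟩ ⟨h.T_nonneg, le_rfl⟩
    · rw [heq t ht x hx, hcongr ht]

end FlowCoupling

/-- The map `w ↦ lin w` is affine with Lipschitz rate `l + L`, so the general Volterra theorem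
applies on the ball; the radial retraction supplies values outside it. -/
lemma Frame.exists_isLinearisedSolution (h : Frame T r R lam l L v Dv)
    (c : FlowCoupling T r R v) :
    ∃ w, IsLinearisedSolution T v Dv (Metric.closedBall 0 r) c.τ c.μ c.γ c.Φ w := by
  obtain ⟨M, hM0, hM⟩ := exists_bound_of_continuous c.isVariation.cont T r
  let X (u : C(Ball d r, Space d)) (x : Space d) : Space d := u (ballRetract h.r_pos x)
  have hXc (u) : Continuous (X u) := u.continuous.comp (ballRetract h.r_pos).continuous
  have hXq (u) (q : Ball d r) : X u q = u q := by
    simp only [X, ballRetract_of_mem h.r_pos q.2]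
  have hW := c.cost_nonneg
  obtain ⟨u, hu, hint, heq⟩ := exists_volterra_solution (T := T) c.flow_fst.τ_mem
    (0 : C(Ball d r, Space d)) (fun s u q => c.lin Dv s (X u) q)
    (k := fun s => l s + L s) (g := fun s => l s + L s + L s * (M * c.cost))
    (h.l_int.add h.L_int) ((h.l_int.add h.L_int).add (h.L_int.mul_const _)) (by
      filter_upwards [h.frozen, ae_restrict_mem measurableSet_Icc] with s hs hsT u w q
      exact FlowCoupling.norm_lin_sub_le hs hsT (hXc u).continuousOn (hXc w).continuousOn
        (fun x _ => (u - w).norm_coe_le_norm _) q.2)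
    (by
      filter_upwards [h.frozen, ae_restrict_mem measurableSet_Icc] with s hs hsT u q
      refine (FlowCoupling.norm_lin_le hs hsT hM0 (hM s hsT) (hXc u).continuousOn
        (fun x _ => u.norm_coe_le_norm _) q.2).trans ?_
      have h1 : 0 ≤ L s * (M * c.cost) := mul_nonneg hs.L_nonneg (by positivity)
      nlinarith [norm_nonneg u, hs.L_nonneg, hs.l_nonneg, mul_nonneg h1 (norm_nonneg u)])
    (by
      filter_upwards [h.frozen, ae_restrict_mem measurableSet_Icc] with s hs hsT u
      exact (FlowCoupling.continuousOn_lin hs hsT (hXc u).continuousOn).comp_continuous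
        continuous_subtype_val fun q => q.2)
    (fun u hu q => by
      refine FlowCoupling.aestronglyMeasurable_lin (w := fun s => X (u s)) h ?_ q.2
      have : Continuous fun p : ℝ × Space d => (u p.1, ballRetract h.r_pos p.2) := by fun_prop
      exact (ContinuousEval.continuous_eval.comp this).continuousOn)
  refine ⟨fun t => X (u t), (FlowCoupling.isLinearisedSolution_iff h).2 ⟨?_, fun t ht x hx => ?_⟩⟩
  · have : Continuous fun p : ℝ × Space d => (u p.1, ballRetract h.r_pos p.2) := by fun_prop
    exact (ContinuousEval.continuous_eval.comp this).continuousOn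
  · have := heq t ht ⟨x, hx⟩
    rw [ContinuousMap.zero_apply, zero_add] at this
    rw [← this]
    exact hXq (u t) ⟨x, hx⟩

lemma Frame.linearisedSolution_unique (h : Frame T r R lam l L v Dv) (c : FlowCoupling T r R v)
    {u w : ℝ → Space d → Space d}
    (hu : IsLinearisedSolution T v Dv (Metric.closedBall 0 r) c.τ c.μ c.γ c.Φ u)
    (hw : IsLinearisedSolution T v Dv (Metric.closedBall 0 r) c.τ c.μ c.γ c.Φ w) :
    ∀ t ∈ Icc 0 T, ∀ x ∈ Metric.closedBall (0 : Space d) r, u t x = w t x := by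
  obtain ⟨hu, hue⟩ := (FlowCoupling.isLinearisedSolution_iff h).1 hu
  obtain ⟨hw, hwe⟩ := (FlowCoupling.isLinearisedSolution_iff h).1 hw
  obtain ⟨M, hM⟩ := (isCompact_Icc.prod
    (isCompact_closedBall (0 : Space d) r)).exists_bound_of_continuousOn (hu.sub hw)
  have key := h.norm_le (Q := Ball d r) c.flow_fst.τ_mem (e := fun t q => u t q - w t q)
    (c := fun _ => 0) (f := fun _ _ => 0) (B := 0)
    (F := fun s q => c.lin Dv s (u s) q - c.lin Dv s (w s) q)
    ⟨M, fun t ht q => hM (t, q) ⟨ht, q.2⟩⟩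
    (fun t ht q => by
      rw [hue t ht q q.2, hwe t ht q q.2, zero_add, intervalIntegral.integral_sub
        (intervalIntegrable_of_integrableOn_Icc (FlowCoupling.integrableOn_lin h hu q.2)
          c.flow_fst.τ_mem ht)
        (intervalIntegrable_of_integrableOn_Icc (FlowCoupling.integrableOn_lin h hw q.2)
          c.flow_fst.τ_mem ht)])
    (fun _ => integrableOn_zero) (fun _ _ => le_rfl) (fun _ => by simp) (fun q => by
      filter_upwards [h.frozen, ae_restrict_mem measurableSet_Icc] with s hs hsT N hN
      rw [add_zero]
      exact FlowCoupling.norm_lin_sub_le hs hsT (FlowCoupling.continuousOn_slice hu hsT)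
        (FlowCoupling.continuousOn_slice hw hsT) (fun x hx => hN ⟨x, hx⟩) q.2)
  intro t ht x hx
  have := key t ht ⟨x, hx⟩
  rw [mul_zero] at this
  exact sub_eq_zero.1 (norm_le_zero_iff.1 this)

/-- The only source in the equation is the transported displacement, of size `L s * C₁` times the
cost, and Grönwall preserves linearity in the cost. -/
lemma Frame.exists_norm_linearisedSolution_le (h : Frame T r R lam l L v Dv) :
    ∃ C > 0, ∀ (c : FlowCoupling T r R v) (w : ℝ → Space d → Space d),
      IsLinearisedSolution T v Dv (Metric.closedBall 0 r) c.τ c.μ c.γ c.Φ w →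
      ∀ t ∈ Icc 0 T, ∀ x ∈ Metric.closedBall (0 : Space d) r, ‖w t x‖ ≤ C * c.cost := by
  obtain ⟨C₁, hC₁, hA⟩ := h.exists_norm_variation_le
  have hLi : 0 ≤ ∫ s in Icc 0 T, L s := integral_nonneg h.L_nonneg
  refine ⟨2 * Real.exp (lam * T) * ((∫ s in Icc 0 T, L s) * C₁ + 1), by positivity,
    fun c w hw t ht x hx => ?_⟩
  obtain ⟨hw, hwe⟩ := (FlowCoupling.isLinearisedSolution_iff h).1 hw
  obtain ⟨M, hM⟩ := (isCompact_Icc.prod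
    (isCompact_closedBall (0 : Space d) r)).exists_bound_of_continuousOn hw
  have hW := c.cost_nonneg
  have key := h.norm_le (Q := Ball d r) c.flow_fst.τ_mem (e := fun t q => w t q)
    (c := fun _ => 0) (f := fun _ s => L s * (C₁ * c.cost))
    (B := (∫ s in Icc 0 T, L s) * (C₁ * c.cost)) (F := fun s q => c.lin Dv s (w s) q)
    ⟨M, fun t ht q => hM (t, q) ⟨ht, q.2⟩⟩ (fun t ht q => by rw [zero_add]; exact hwe t ht q q.2)
    (fun _ => h.L_int.mul_const _) (fun _ s => mul_nonneg (h.L_nonneg s) (by positivity))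
    (fun _ => by simp [integral_mul_const]) (fun q => by
      filter_upwards [h.frozen, ae_restrict_mem measurableSet_Icc] with s hs hsT N hN
      exact FlowCoupling.norm_lin_le hs hsT hC₁.le
        (hA _ _ _ _ c.flow_fst c.isVariation s hsT) (FlowCoupling.continuousOn_slice hw hsT)
        (fun x hx => hN ⟨x, hx⟩) q.2) t ht ⟨x, hx⟩
  refine key.trans ?_
  have := mul_nonneg (Real.exp_pos (lam * T)).le hW
  linarith

end Linearised

/-! ### The first order expansion of the flow -/

section Expansion

variable {T r R lam : ℝ} {l L : ℝ → ℝ} {v : ℝ → Measure (Space d) → Space d → Space d}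
  {Dv : ℝ → Measure (Space d) → Space d → Space d → Space d →L[ℝ] Space d}

namespace FlowCoupling

variable (c : FlowCoupling T r R v)

lemma integrable_of_continuous {f : Space d × Space d → Space d} (hf : Continuous f) :
    Integrable f c.γ := by
  obtain ⟨M, hM⟩ := ((isCompact_closedBall (0 : Space d) r).prod
    (isCompact_closedBall (0 : Space d) r)).exists_bound_of_continuousOn hf.continuousOn
  exact memLp_one_iff_integrable.1
    (memLp_of_ae_bound 1 hf.aemeasurable (c.ae_mem.mono fun p hp => hM p hp))

lemma integral_norm_sub_sq : ∫ p, ‖p.2 - p.1‖ ^ 2 ∂c.γ = c.cost ^ 2 := by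
  rw [cost_eq, Real.sq_sqrt (integral_nonneg fun _ => by positivity)]

lemma continuous_snd_sub_fst (s : ℝ) :
    Continuous fun p : Space d × Space d => c.Ψ s p.2 - c.Φ s p.1 :=
  ((c.flow_snd.continuous_slice s).comp continuous_snd).sub
    ((c.flow_fst.continuous_slice s).comp continuous_fst)

/-- The error of the space derivative along the coupling. -/
def increment (s : ℝ) (p : Space d × Space d) : Space d :=
  c.Ψ s p.2 - c.Ψ s p.1 - c.A s p.1 (p.2 - p.1)

lemma continuous_increment (s : ℝ) : Continuous (c.increment s) := by
  have h1 : Continuous (c.A s) := c.isVariation.cont.comp (f := fun x => (s, x)) (by fun_prop)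
  exact (((c.flow_snd.continuous_slice s).comp continuous_snd).sub
    ((c.flow_snd.continuous_slice s).comp continuous_fst)).sub
    ((h1.comp continuous_fst).clm_apply (continuous_snd.sub continuous_fst))

/-- The remainder in the expansion of the velocity along the two flows. -/
noncomputable def flowRemainder
    (Dv : ℝ → Measure (Space d) → Space d → Space d → Space d →L[ℝ] Space d)
    (x : Space d) (s : ℝ) : Space d :=
  v s (c.ν.map (c.Ψ s)) (c.Ψ s x) - v s (c.μ.map (c.Φ s)) (c.Φ s x) -
    fderiv ℝ (v s (c.μ.map (c.Φ s))) (c.Φ s x) (c.Ψ s x - c.Φ s x) -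
    c.nonlocalTerm Dv s (fun p => c.Ψ s p.2 - c.Φ s p.1) x

lemma aestronglyMeasurable_flowRemainder (h : Frame T r R lam l L v Dv) {x : Space d}
    (hx : x ∈ Metric.closedBall (0 : Space d) r) :
    AEStronglyMeasurable (c.flowRemainder Dv x) (volume.restrict (Icc 0 T)) := by
  refine (((c.flow_snd.aestronglyMeasurable_velocity h hx).sub
    (c.flow_fst.aestronglyMeasurable_velocity h hx)).sub
    (c.flow_fst.aestronglyMeasurable_fderiv h hx
      ((c.flow_snd.continuous_time x).sub (c.flow_fst.continuous_time x)).continuousOn)).sub ?_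
  refine aestronglyMeasurable_nonlocalTerm (H := R + R) h ⟨fun σ _ =>
    (c.continuous_snd_sub_fst σ).aemeasurable, fun σ hσ => ?_, Eventually.of_forall fun p =>
      ((c.flow_snd.continuous_time _).sub (c.flow_fst.continuous_time _)).continuousOn⟩ hx
  filter_upwards [c.ae_mem] with p hp
  exact (norm_sub_le _ _).trans (add_le_add (c.flow_snd.bound σ hσ _ hp.2)
    (c.flow_fst.bound σ hσ _ hp.1))

end FlowCoupling

/-- Pairs at distance at most `δ / 2` are covered by the space expansion, the cost using the other
half of `δ`. For distant pairs the Lipschitz bound is traded for a quadratic one, whose integral is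
of order cost squared. -/
lemma Frame.integral_norm_increment_le (h : Frame T r R lam l L v Dv) :
    ∀ ε > 0, ∃ δ > 0, ∀ c : FlowCoupling T r R v, c.cost ≤ δ → ∀ s ∈ Icc 0 T,
      ∫ p, ‖c.increment s p‖ ∂c.γ ≤ ε * c.cost := by
  obtain ⟨C₁, hC₁, hlip⟩ := h.exists_norm_flow_sub_le
  obtain ⟨C₂, hC₂, hA⟩ := h.exists_norm_variation_le
  intro ε hε
  obtain ⟨δ, hδ, H⟩ := h.norm_space_expansion_le (ε / 2) (half_pos hε)
  -- Chosen so that `C * (δ / 2) = C₁ + C₂`; the threshold `ε / (2 * C)` below then makes the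
  -- quadratic term at most `ε / 2` times the cost.
  set C := 2 * (C₁ + C₂) / δ with hC
  have hC0 : 0 < C := by positivity
  refine ⟨min (δ / 2) (ε / (2 * C)), by positivity, fun c hc s hs => ?_⟩
  have hW := c.cost_nonneg
  have hcδ := hc.trans (min_le_left _ _)
  have hcC := hc.trans (min_le_right _ _)
  rw [le_div_iff₀ (by positivity)] at hcC
  have hi1 : Integrable (fun p : Space d × Space d => ε / 2 * ‖p.2 - p.1‖) c.γ :=
    ((memLp_one_iff_integrable.1 (c.memLp_sub 1)).norm).const_mul _
  have hi2 : Integrable (fun p : Space d × Space d => C * ‖p.2 - p.1‖ ^ 2) c.γ :=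
    ((c.memLp_sub 2).integrable_norm_pow two_ne_zero).const_mul _
  have hpt : ∀ᵐ p ∂c.γ, ‖c.increment s p‖ ≤ ε / 2 * ‖p.2 - p.1‖ + C * ‖p.2 - p.1‖ ^ 2 := by
    filter_upwards [c.ae_mem] with p hp
    rcases le_total ‖p.2 - p.1‖ (δ / 2) with hle | hle
    · have := H c _ hp.1 _ hp.2 (by linarith) s hs
      refine this.trans (le_add_of_nonneg_right (by positivity))
    · have h1 : ‖c.increment s p‖ ≤ (C₁ + C₂) * ‖p.2 - p.1‖ := by
        rw [add_mul]
        exact (norm_sub_le _ _).trans (add_le_add (hlip _ _ _ c.flow_snd s hs _ hp.2 _ hp.1)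
          ((c.A s p.1).le_of_opNorm_le (hA _ _ _ _ c.flow_fst c.isVariation s hs _ hp.1) _))
      have h2 : C₁ + C₂ ≤ C * ‖p.2 - p.1‖ := by
        calc C₁ + C₂ = C * (δ / 2) := by rw [hC]; field_simp
          _ ≤ _ := by gcongr
      calc _ ≤ C * ‖p.2 - p.1‖ * ‖p.2 - p.1‖ := h1.trans (by gcongr)
        _ = C * ‖p.2 - p.1‖ ^ 2 := by ring
        _ ≤ _ := le_add_of_nonneg_left (by positivity)
  calc ∫ p, ‖c.increment s p‖ ∂c.γ
      ≤ ∫ p, (ε / 2 * ‖p.2 - p.1‖ + C * ‖p.2 - p.1‖ ^ 2) ∂c.γ :=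
        integral_mono_of_nonneg (Eventually.of_forall fun _ => norm_nonneg _) (hi1.add hi2) hpt
    _ = ε / 2 * ∫ p, ‖p.2 - p.1‖ ∂c.γ + C * c.cost ^ 2 := by
        rw [integral_add hi1 hi2, integral_const_mul, integral_const_mul, c.integral_norm_sub_sq]
    _ ≤ ε / 2 * c.cost + C * c.cost ^ 2 := by gcongr; exact c.integral_norm_sub_le
    _ ≤ ε * c.cost := by nlinarith

/-- Provides the dominating function: each term of the remainder is separately of the order of the
cost. The factor `4` covers two nonlocal terms, each with a mean displacement of `2 * C` times the
cost. -/
lemma Frame.exists_norm_flowRemainder_le (h : Frame T r R lam l L v Dv) :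
    ∃ C > 0, ∀ c : FlowCoupling T r R v, ∀ x ∈ Metric.closedBall (0 : Space d) r,
      ∀ᵐ s ∂(volume.restrict (Icc 0 T)), ‖c.flowRemainder Dv x s‖ ≤ C * (l s + L s) * c.cost := by
  obtain ⟨C, hC, hstab⟩ := h.exists_norm_snd_sub_fst_le
  refine ⟨4 * C, by positivity, fun c x hx => ?_⟩
  have hW := c.cost_nonneg
  filter_upwards [h.frozen, ae_restrict_mem measurableSet_Icc] with s hs hsT
  have b1 := c.isBoundedCurve_fst
  have b2 := c.isBoundedCurve_snd
  have hxx : ‖c.Ψ s x - c.Φ s x‖ ≤ C * c.cost := by simpa using hstab c s hsT x hx x hx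
  have hint : ∫ p, ‖c.Ψ s p.2 - c.Φ s p.1‖ ∂c.γ ≤ C * c.cost + C * c.cost := by
    refine c.integral_le_of_norm_le hC.le ?_
    filter_upwards [c.ae_mem] with p hp
    rw [← mul_add]
    exact hstab c s hsT _ hp.1 _ hp.2
  have h1 := hs.norm_sub_le (b2.meas s hsT) (b2.bound s hsT) (b1.meas s hsT) (b1.bound s hsT)
    (c.flow_snd.bound s hsT x hx) (c.flow_fst.bound s hsT x hx)
  rw [c.map_fst, c.map_snd] at h1
  have h2 := (fderiv ℝ (v s (c.μ.map (c.Φ s))) (c.Φ s x)).le_of_opNorm_le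
    (hs.norm_fderiv_le (c.flow_fst.map_mem_probOn hsT) (c.flow_fst.bound s hsT x hx))
    (c.Ψ s x - c.Φ s x)
  have h3 := FlowCoupling.norm_nonlocalTerm_le (c := c) (η := fun p => c.Ψ s p.2 - c.Φ s p.1)
    (H := R + R) hs hsT (c.continuous_snd_sub_fst s).aemeasurable (by
      filter_upwards [b1.bound s hsT, b2.bound s hsT] with p h1 h2
      exact (norm_sub_le _ _).trans (add_le_add h2 h1)) hx
  have h4 := mul_le_mul_of_nonneg_left hxx hs.l_nonneg
  have h5 := mul_le_mul_of_nonneg_left hint hs.L_nonneg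
  have h6 : 0 ≤ C * l s * c.cost := mul_nonneg (mul_nonneg hC.le hs.l_nonneg) hW
  refine (norm_sub_le _ _).trans (le_trans (add_le_add (norm_sub_le _ _) le_rfl) ?_)
  nlinarith

lemma FlowCoupling.integrableOn_flowRemainder (c : FlowCoupling T r R v)
    (h : Frame T r R lam l L v Dv) {x : Space d} (hx : x ∈ Metric.closedBall (0 : Space d) r) :
    IntegrableOn (c.flowRemainder Dv x) (Icc 0 T) := by
  obtain ⟨C, hC, hb⟩ := h.exists_norm_flowRemainder_le
  exact Integrable.mono' (((h.l_int.add h.L_int).const_mul C).mul_const c.cost)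
    (c.aestronglyMeasurable_flowRemainder h hx) (hb c x hx)

/-- At almost every time the Taylor expansion of the velocity is uniform over couplings, and
stability converts its scale into the cost of the initial coupling; uniform dominated convergence
then integrates in time. -/
lemma Frame.integral_flowRemainder_le (h : Frame T r R lam l L v Dv) :
    ∀ ε > 0, ∃ δ > 0, ∀ c : FlowCoupling T r R v, ∀ x ∈ Metric.closedBall (0 : Space d) r,
      c.cost ≤ δ → ∫ s in Icc 0 T, ‖c.flowRemainder Dv x s‖ ≤ ε * c.cost := by
  obtain ⟨C₀, hC₀, hbound⟩ := h.exists_norm_flowRemainder_le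
  obtain ⟨C, hC, hstab⟩ := h.exists_norm_snd_sub_fst_le
  intro ε hε
  obtain ⟨δ, hδ, H⟩ := exists_integral_le_mul_of_dominated (m := volume.restrict (Icc 0 T))
    (P := FlowCoupling T r R v × Ball d r) (fun p => p.1.cost) (fun p => p.1.cost)
    (fun p => p.1.cost_nonneg) (fun p s => ‖p.1.flowRemainder Dv p.2 s‖)
    (g := fun s => C₀ * (l s + L s)) ((h.l_int.add h.L_int).const_mul C₀)
    (fun p => (p.1.aestronglyMeasurable_flowRemainder h p.2.2).norm)
    (fun ⟨c, x⟩ => by simpa using hbound c x x.2)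
    (by
      filter_upwards [h.frozen, ae_restrict_mem measurableSet_Icc] with s hs hsT ε hε
      -- The position moves by at most `C` times the cost and the measure, in `L²`, by at most `2 *
      -- C` times the cost, whence `3 * C`.
      obtain ⟨δ, hδ, hu⟩ := hs.taylor (Ω := Space d × Space d) (ε := ε / (3 * C)) (by positivity)
      refine ⟨δ / (2 * C), by positivity, fun ⟨c, x⟩ hp => ?_⟩
      simp only at hp
      have hW := c.cost_nonneg
      have hle : 2 * C * c.cost ≤ δ := by
        rw [le_div_iff₀ (by positivity)] at hp
        linarith
      have b1 := c.isBoundedCurve_fst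
      have b2 := c.isBoundedCurve_snd
      have hxx : ‖c.Ψ s x - c.Φ s x‖ ≤ C * c.cost := by simpa using hstab c s hsT x x.2 x x.2
      have hi : Integrable (fun p : Space d × Space d => 2 * C ^ 2 * ‖p.2 - p.1‖ ^ 2) c.γ :=
        ((c.memLp_sub 2).integrable_norm_pow two_ne_zero).const_mul _
      have hsq : ∫ p, ‖c.Ψ s p.2 - c.Φ s p.1‖ ^ 2 ∂c.γ ≤ (2 * C * c.cost) ^ 2 := by
        calc ∫ p, ‖c.Ψ s p.2 - c.Φ s p.1‖ ^ 2 ∂c.γ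
            ≤ ∫ p, (2 * C ^ 2 * c.cost ^ 2 + 2 * C ^ 2 * ‖p.2 - p.1‖ ^ 2) ∂c.γ := by
              refine integral_mono_of_nonneg (Eventually.of_forall fun _ => by positivity)
                ((integrable_const _).add hi) ?_
              filter_upwards [c.ae_mem] with p hp
              have h1 := hstab c s hsT _ hp.1 _ hp.2
              calc ‖c.Ψ s p.2 - c.Φ s p.1‖ ^ 2 ≤ (C * (c.cost + ‖p.2 - p.1‖)) ^ 2 := by gcongr
                _ ≤ _ := by nlinarith [mul_nonneg (sq_nonneg C) (sq_nonneg (c.cost - ‖p.2 - p.1‖))]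
          _ = 2 * C ^ 2 * c.cost ^ 2 + 2 * C ^ 2 * c.cost ^ 2 := by
              rw [integral_add (integrable_const _) hi, integral_const, probReal_univ, one_smul,
                integral_const_mul (2 * C ^ 2), c.integral_norm_sub_sq]
          _ = _ := by ring
      have hsqrt : Real.sqrt (∫ p, ‖c.Ψ s p.2 - c.Φ s p.1‖ ^ 2 ∂c.γ) ≤ 2 * C * c.cost :=
        Real.sqrt_le_iff.2 ⟨by positivity, hsq⟩
      have key := hu c.γ _ _ (b1.meas s hsT) (b2.meas s hsT) (b1.bound s hsT) (b2.bound s hsT)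
        (c.Φ s x) (c.Ψ s x) (c.flow_fst.bound s hsT x x.2) (c.flow_snd.bound s hsT x x.2)
        (hsqrt.trans hle) (hxx.trans (by nlinarith))
      rw [c.map_fst, c.map_snd] at key
      rw [abs_norm]
      calc ‖c.flowRemainder Dv x s‖ ≤ ε / (3 * C) * (C * c.cost + 2 * C * c.cost) :=
            le_trans key (by gcongr)
        _ = ε * c.cost := by field_simp; ring) ε hε
  refine ⟨δ, hδ, fun c x hx hle => ?_⟩
  simpa using H (c, ⟨x, hx⟩) hle

/-- The first order expansion of the flow with respect to the initial measure. -/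
theorem Frame.norm_flow_expansion_le (h : Frame T r R lam l L v Dv) :
    ∀ ε > 0, ∃ δ > 0, ∀ (c : FlowCoupling T r R v) (w : ℝ → Space d → Space d),
      IsLinearisedSolution T v Dv (Metric.closedBall 0 r) c.τ c.μ c.γ c.Φ w → c.cost ≤ δ →
      ∀ t ∈ Icc 0 T, ∀ x ∈ Metric.closedBall (0 : Space d) r,
        ‖c.Ψ t x - c.Φ t x - w t x‖ ≤ ε * c.cost := by
  intro ε hε
  have hLi : 0 ≤ ∫ s in Icc 0 T, L s := integral_nonneg h.L_nonneg
  set I := ∫ s in Icc 0 T, L s with hI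
  -- The Taylor remainder contributes `ε'` and the space increments `ε' * I`, both multiplied by the
  -- Grönwall constant `2 * exp (lam * T)`.
  set ε' := ε / (2 * Real.exp (lam * T) * (1 + I)) with hε'
  have hε'0 : 0 < ε' := by positivity
  obtain ⟨δ₁, hδ₁, H1⟩ := h.integral_flowRemainder_le ε' hε'0
  obtain ⟨δ₂, hδ₂, H2⟩ := h.integral_norm_increment_le ε' hε'0
  refine ⟨min δ₁ δ₂, by positivity, fun c w hw hc t ht x hx => ?_⟩
  have hW := c.cost_nonneg
  obtain ⟨hw, hwe⟩ := (FlowCoupling.isLinearisedSolution_iff h).1 hw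
  obtain ⟨M, hM⟩ := (isCompact_Icc.prod
    (isCompact_closedBall (0 : Space d) r)).exists_bound_of_continuousOn hw
  have key := h.norm_le (Q := Ball d r) c.flow_fst.τ_mem
    (e := fun t q => c.Ψ t q - c.Φ t q - w t q) (c := fun _ => 0)
    (f := fun q s => ‖c.flowRemainder Dv q s‖ + L s * (ε' * c.cost))
    (F := fun s q => v s (c.ν.map (c.Ψ s)) (c.Ψ s q) - v s (c.μ.map (c.Φ s)) (c.Φ s q) -
      c.lin Dv s (w s) q)
    (B := ε' * c.cost + I * (ε' * c.cost))
    ⟨R + R + M, fun t ht q => (norm_sub_le _ _).trans (add_le_add ((norm_sub_le _ _).trans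
      (add_le_add (c.flow_snd.bound t ht q q.2) (c.flow_fst.bound t ht q q.2)))
      (hM (t, q) ⟨ht, q.2⟩))⟩
    (fun t ht q => by
      have i1 := c.flow_snd.intervalIntegrable ht q.2
      have i2 := c.flow_fst.intervalIntegrable ht q.2
      have i3 := intervalIntegrable_of_integrableOn_Icc
        (FlowCoupling.integrableOn_lin (c := c) h hw q.2) c.flow_fst.τ_mem ht
      rw [c.flow_snd.flow.eq_integral t ht q q.2, c.flow_fst.flow.eq_integral t ht q q.2,
        hwe t ht q q.2, intervalIntegral.integral_sub (i1.sub i2) i3,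
        intervalIntegral.integral_sub i1 i2]
      abel)
    (fun q => (c.integrableOn_flowRemainder h q.2).norm.add (h.L_int.mul_const _))
    (fun q s => add_nonneg (norm_nonneg _) (mul_nonneg (h.L_nonneg s) (by positivity)))
    (fun q => by
      rw [norm_zero, zero_add, integral_add (c.integrableOn_flowRemainder h q.2).norm
        (h.L_int.mul_const _), integral_mul_const]
      exact add_le_add (H1 c q q.2 (hc.trans (min_le_left _ _))) le_rfl)
    (fun q => by
      filter_upwards [h.frozen, ae_restrict_mem measurableSet_Icc] with s hs hsT N hN
      have hcs := FlowCoupling.continuousOn_slice hw hsT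
      obtain ⟨H, hH⟩ := FlowCoupling.exists_norm_displacement_le (c := c) hsT hcs
      have b1 := c.isBoundedCurve_fst
      have b2 := c.isBoundedCurve_snd
      have hm := (c.continuous_snd_sub_fst s).aemeasurable (μ := c.γ)
      have hmb : ∀ᵐ p ∂c.γ, ‖c.Ψ s p.2 - c.Φ s p.1‖ ≤ R + R := by
        filter_upwards [b1.bound s hsT, b2.bound s hsT] with p h1 h2
        exact (norm_sub_le _ _).trans (add_le_add h2 h1)
      have hd := FlowCoupling.aemeasurable_displacement (c := c) (s := s) hcs
      have hsub := FlowCoupling.nonlocalTerm_sub (c := c) hs hsT hm hmb hd hH q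
      -- An exact identity: the linearised operator acts on the error, and only the Taylor remainder
      -- is left over. The displacement error inside the nonlocal term is in turn the error at
      -- `p.1`, bounded by `N`, plus the space increment.
      have heq : v s (c.ν.map (c.Ψ s)) (c.Ψ s q) - v s (c.μ.map (c.Φ s)) (c.Φ s q) -
          c.lin Dv s (w s) q = fderiv ℝ (v s (c.μ.map (c.Φ s))) (c.Φ s q)
            (c.Ψ s q - c.Φ s q - w s q) + c.nonlocalTerm Dv s
              (fun p => c.Ψ s p.2 - c.Φ s p.1 - c.displacement s (w s) p) q +
            c.flowRemainder Dv q s := by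
        rw [← hsub, FlowCoupling.lin, FlowCoupling.flowRemainder, map_sub _ _ (w s q)]
        abel
      have hη : ∫ p, ‖c.Ψ s p.2 - c.Φ s p.1 - c.displacement s (w s) p‖ ∂c.γ ≤
          N + ε' * c.cost := by
        have hi := (c.integrable_of_continuous (c.continuous_increment s)).norm
        calc _ ≤ ∫ p, (N + ‖c.increment s p‖) ∂c.γ := by
              refine integral_mono_of_nonneg (Eventually.of_forall fun _ => norm_nonneg _)
                ((integrable_const N).add hi) ?_
              filter_upwards [c.ae_mem] with p hp
              have : c.Ψ s p.2 - c.Φ s p.1 - c.displacement s (w s) p =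
                  (c.Ψ s p.1 - c.Φ s p.1 - w s p.1) + c.increment s p := by
                rw [FlowCoupling.displacement, FlowCoupling.increment]
                abel
              simp only [this]
              exact (norm_add_le _ _).trans (add_le_add (hN ⟨p.1, hp.1⟩) le_rfl)
          _ = N + ∫ p, ‖c.increment s p‖ ∂c.γ := by
              rw [integral_add (integrable_const N) hi]
              simp
          _ ≤ _ := by
              have := H2 c (hc.trans (min_le_right _ _)) s hsT
              linarith
      have h1 := (fderiv ℝ (v s (c.μ.map (c.Φ s))) (c.Φ s q)).le_of_opNorm_le
        (hs.norm_fderiv_le (c.flow_fst.map_mem_probOn hsT) (c.flow_fst.bound s hsT q q.2))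
        (c.Ψ s q - c.Φ s q - w s q)
      have h2 := FlowCoupling.norm_nonlocalTerm_le (c := c) (H := R + R + H) hs hsT (hm.sub hd) (by
        filter_upwards [hmb, hH] with p h1 h2
        exact (norm_sub_le _ _).trans (add_le_add h1 h2)) q.2
      have h3 := mul_le_mul_of_nonneg_left hη hs.L_nonneg
      have h4 := mul_le_mul_of_nonneg_left (hN q) hs.l_nonneg
      rw [heq]
      calc _ ≤ l s * N + L s * (N + ε' * c.cost) + ‖c.flowRemainder Dv q s‖ :=
            (norm_add_le _ _).trans (add_le_add ((norm_add_le _ _).trans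
              (add_le_add (h1.trans h4) (h2.trans h3))) le_rfl)
        _ = _ := by ring) t ht ⟨x, hx⟩
  refine key.trans (le_of_eq ?_)
  rw [hε']
  field_simp

end Expansion

/-! ### Directional derivatives -/

section Directional

variable {T r R lam : ℝ} {l L : ℝ → ℝ} {v : ℝ → Measure (Space d) → Space d → Space d}
  {Dv : ℝ → Measure (Space d) → Space d → Space d → Space d →L[ℝ] Space d}

namespace FlowCoupling

variable (c : FlowCoupling T r R v) {h : ℝ}

lemma interpolate_mem_probOn (h0 : 0 ≤ h) (h1 : h ≤ 1) :
    interpolate c.γ h ∈ probOn (Metric.closedBall (0 : Space d) r) := by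
  refine map_mem_probOn (by fun_prop) ?_
  filter_upwards [c.ae_mem] with p hp
  exact mem_closedBall_zero_iff.1 (convex_closedBall (0 : Space d) r hp.1 hp.2 (sub_nonneg.2 h1) h0
    (sub_add_cancel 1 h))

/-- The coupling of the initial measure with an interpolated measure. -/
noncomputable def interpolated {Ψ : ℝ → Space d → Space d}
    (hΨ : IsBoundedFlow T r R v c.τ (interpolate c.γ h) Ψ) : FlowCoupling T r R v where
  τ := c.τ
  μ := c.μ
  ν := interpolate c.γ h
  γ := c.γ.map fun p => (p.1, (1 - h) • p.1 + h • p.2)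
  Φ := c.Φ
  Ψ := Ψ
  A := c.A
  flow_fst := c.flow_fst
  flow_snd := hΨ
  isVariation := c.isVariation
  mem_plans := by
    have := map_prodMk_mem_plans (P := c.γ) (X := Prod.fst)
      (Y := fun p => (1 - h) • p.1 + h • p.2) (by fun_prop) (by fun_prop)
    rwa [c.mem_plans.2.1] at this

variable {c} {Ψ : ℝ → Space d → Space d}

lemma cost_interpolated (hΨ : IsBoundedFlow T r R v c.τ (interpolate c.γ h) Ψ) (h0 : 0 ≤ h) :
    (c.interpolated hΨ).cost = h * c.cost := by
  have h1 := planCost_two_map_prodMk (P := c.γ) (X := fun p : Space d × Space d => p.1)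
    (Y := fun p => (1 - h) • p.1 + h • p.2) (by fun_prop) (by fun_prop)
  have h2 (p : Space d × Space d) :
      ‖p.1 - ((1 - h) • p.1 + h • p.2)‖ ^ 2 = h ^ 2 * ‖p.2 - p.1‖ ^ 2 := by
    have : p.1 - ((1 - h) • p.1 + h • p.2) = -(h • (p.2 - p.1)) := by module
    rw [this, norm_neg, norm_smul, Real.norm_of_nonneg h0, mul_pow]
  simp_rw [h2] at h1
  rw [integral_const_mul, c.integral_norm_sub_sq, ← mul_pow,
    Real.sqrt_sq (mul_nonneg h0 c.cost_nonneg)] at h1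
  exact h1

/-- A change of variables in the plan: the flow and its variation are unchanged, while the
displacement `z - y` is multiplied by `h`; everything else is linear. -/
lemma lin_interpolated (hΨ : IsBoundedFlow T r R v c.τ (interpolate c.γ h) Ψ) {s a b : ℝ}
    (hF : FrozenField R a b (v s) (Dv s)) (hs : s ∈ Icc 0 T) {w : Space d → Space d}
    (hw : ContinuousOn w (Metric.closedBall 0 r)) (x : Space d) :
    (c.interpolated hΨ).lin Dv s (fun y => h • w y) x = h • c.lin Dv s w x := by
  have hw' : ContinuousOn (fun y => h • w y) (Metric.closedBall 0 r) := hw.const_smul h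
  obtain ⟨H, hH⟩ := exists_norm_displacement_le (c := c.interpolated hΨ) hs hw'
  have hi := (integrable_nonlocal (c := c.interpolated hΨ) hF hs (aemeasurable_displacement hw')
    hH (c.Φ s x)).aestronglyMeasurable
  have h1 : (c.interpolated hΨ).nonlocalTerm Dv s
      ((c.interpolated hΨ).displacement s fun y => h • w y) x =
        h • c.nonlocalTerm Dv s (c.displacement s w) x := by
    have h2 := integral_map (μ := c.γ)
      (φ := fun p : Space d × Space d => (p.1, (1 - h) • p.1 + h • p.2)) (by fun_prop) hi
    refine h2.trans ?_
    rw [nonlocalTerm, ← integral_smul]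
    refine integral_congr_ae (Eventually.of_forall fun p => ?_)
    have h3 : (c.interpolated hΨ).displacement s (fun y => h • w y)
        (p.1, (1 - h) • p.1 + h • p.2) = h • c.displacement s w p := by
      have : (1 - h) • p.1 + h • p.2 - p.1 = h • (p.2 - p.1) := by module
      simp only [displacement, this, map_smul, smul_add]
      rfl
    simp only [h3, map_smul]
    rfl
  rw [lin, h1, lin, smul_add, ← map_smul]
  rfl

/-- This homogeneity lets the expansion of the flow, applied to the interpolated plan, yield the
directional derivative. -/
lemma isLinearisedSolution_interpolated (hfr : Frame T r R lam l L v Dv)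
    (hΨ : IsBoundedFlow T r R v c.τ (interpolate c.γ h) Ψ) {w : ℝ → Space d → Space d}
    (hw : IsLinearisedSolution T v Dv (Metric.closedBall 0 r) c.τ c.μ c.γ c.Φ w) :
    IsLinearisedSolution T v Dv (Metric.closedBall 0 r) (c.interpolated hΨ).τ (c.interpolated hΨ).μ
      (c.interpolated hΨ).γ (c.interpolated hΨ).Φ (fun t x => h • w t x) := by
  obtain ⟨hwc, hwe⟩ := (isLinearisedSolution_iff hfr).1 hw
  refine (isLinearisedSolution_iff hfr).2 ⟨hwc.const_smul h, fun t ht x hx => ?_⟩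
  rw [hwe t ht x hx, ← intervalIntegral.integral_smul]
  refine intervalIntegral.integral_congr_ae ?_
  rw [← ae_restrict_iff' measurableSet_uIoc]
  refine ae_restrict_of_ae_restrict_of_subset (uIoc_subset_Icc_of_mem c.flow_fst.τ_mem ht) ?_
  filter_upwards [hfr.frozen, ae_restrict_mem measurableSet_Icc] with s hs hsT
  exact (lin_interpolated hΨ hs hsT (continuousOn_slice hwc hsT) x).symm

end FlowCoupling

end Directional

end NonlocalFlow

/-! ### Assembly of the four assertions. -/

theorem mainTheorem7 {d : ℕ} {T : ℝ} (hT : 0 < T)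
    (v : ℝ → Measure (Space d) → Space d → Space d)
    (Dv : ℝ → Measure (Space d) → Space d → Space d → Space d →L[ℝ] Space d)
    (hv : HypCE T v Dv)
    {r : ℝ} (hr : 0 < r) (K : Set (Space d)) (hK : K = Metric.closedBall (0 : Space d) r) :
    ∃ (Φ : ℝ → Measure (Space d) → ℝ → Space d → Space d)
      (w : ℝ → Measure (Space d × Space d) → ℝ → Space d → Space d),
      -- `Φ τ μ` is the unique non-local flow, and it is differentiable in space
      (∀ τ ∈ Icc 0 T, ∀ μ ∈ probOn K,
        IsNonlocalFlow T v K τ μ (Φ τ μ) ∧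
        (∀ Ψ, IsNonlocalFlow T v K τ μ Ψ → ∀ t ∈ Icc 0 T, ∀ x ∈ K, Ψ t x = Φ τ μ t x) ∧
        (∀ t ∈ Icc 0 T, DifferentiableOn ℝ (Φ τ μ t) K)) ∧
      -- `w τ γ` is the unique solution of the linearised problem along the plan `γ`,
      -- and the derivative of the flow in the direction `γ`
      (∀ τ ∈ Icc 0 T, ∀ μ ∈ probOn K, ∀ ν ∈ probOn K, ∀ γ ∈ plans μ ν,
        IsLinearisedSolution T v Dv K τ μ γ (Φ τ μ) (w τ γ) ∧
        (∀ u, IsLinearisedSolution T v Dv K τ μ γ (Φ τ μ) u →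
          ∀ t ∈ Icc 0 T, ∀ x ∈ K, u t x = w τ γ t x) ∧
        TendstoUniformlyOn
          (fun (h : ℝ) (p : ℝ × Space d) =>
            h⁻¹ • (Φ τ (interpolate γ h) p.1 p.2 - Φ τ μ p.1 p.2))
          (fun p => w τ γ p.1 p.2) (𝓝[>] 0) (Icc 0 T ×ˢ K)) ∧
      -- the estimate on `w`
      (∃ C > 0, ∀ τ ∈ Icc 0 T, ∀ μ ∈ probOn K, ∀ ν ∈ probOn K, ∀ γ ∈ plans μ ν,
        ∀ t ∈ Icc 0 T, ∀ x ∈ K, ‖w τ γ t x‖ ≤ C * planCost 2 γ) ∧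
      -- the Taylor expansion, with a remainder that is uniform given `K`
      (∀ ε > 0, ∃ δ > 0, ∀ τ ∈ Icc 0 T, ∀ μ ∈ probOn K, ∀ ν ∈ probOn K, ∀ γ ∈ plans μ ν,
        planCost 2 γ ≤ δ → ∀ t ∈ Icc 0 T, ∀ x ∈ K,
          ‖Φ τ ν t x - Φ τ μ t x - w τ γ t x‖ ≤ ε * planCost 2 γ) := by
  subst hK
  obtain ⟨R, hR, hflow⟩ := hv.exists_flow hT.le hr
  obtain ⟨l, L, hl, hl0, hL, hL0, hfrozen⟩ := hv.ae_frozenField hR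
  obtain ⟨lam, hweight⟩ := exists_isVolterraWeight (hl.add hL)
  have hfr : Frame T r R lam l L v Dv :=
    ⟨hT.le, hr, hR, hv, hl, hl0, hL, hL0, hfrozen, hweight⟩
  -- Flows are chosen for all parameters, with the irrelevant value `0` outside the admissible
  -- range, so that they form one total function.
  have hflow' (τ : ℝ) (μ : Measure (Space d)) : ∃ Φ : ℝ → Space d → Space d, τ ∈ Icc 0 T →
      μ ∈ probOn (Metric.closedBall (0 : Space d) r) → IsBoundedFlow T r R v τ μ Φ := by
    by_cases hc : τ ∈ Icc 0 T ∧ μ ∈ probOn (Metric.closedBall (0 : Space d) r)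
    · obtain ⟨Φ, h1, h2, h3⟩ := hflow τ hc.1 μ hc.2
      exact ⟨Φ, fun _ _ => ⟨hc.1, hc.2, h1, h2, h3⟩⟩
    · exact ⟨0, fun h1 h2 => absurd ⟨h1, h2⟩ hc⟩
  choose Φ hΦ using hflow'
  have hcpl (τ : ℝ) (hτ : τ ∈ Icc 0 T) (μ ν : Measure (Space d))
      (hμ : μ ∈ probOn (Metric.closedBall (0 : Space d) r))
      (hν : ν ∈ probOn (Metric.closedBall (0 : Space d) r)) (γ : Measure (Space d × Space d))
      (hγ : γ ∈ plans μ ν) : ∃ c : FlowCoupling T r R v,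
        c.τ = τ ∧ c.μ = μ ∧ c.γ = γ ∧ c.Φ = Φ τ μ ∧ c.Ψ = Φ τ ν := by
    obtain ⟨A, hA⟩ := hfr.exists_isVariation (hΦ τ μ hτ hμ)
    exact ⟨⟨τ, μ, ν, γ, Φ τ μ, Φ τ ν, A, hΦ τ μ hτ hμ, hΦ τ ν hτ hν, hA, hγ⟩, rfl, rfl, rfl, rfl, rfl⟩
  -- The solution can be indexed by `τ` and `γ` alone: the first marginal of `γ` recovers the
  -- initial measure and hence the chosen flow, and the linearised problem does not involve the
  -- second flow.
  have hlin (τ : ℝ) (γ : Measure (Space d × Space d)) : ∃ w : ℝ → Space d → Space d,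
      ∀ c : FlowCoupling T r R v, c.τ = τ → c.γ = γ → c.Φ = Φ τ c.μ →
        IsLinearisedSolution T v Dv (Metric.closedBall 0 r) c.τ c.μ c.γ c.Φ w := by
    by_cases hc : ∃ c : FlowCoupling T r R v, c.τ = τ ∧ c.γ = γ ∧ c.Φ = Φ τ c.μ
    · obtain ⟨c, rfl, rfl, hcΦ⟩ := hc
      obtain ⟨w, hw⟩ := hfr.exists_isLinearisedSolution c
      refine ⟨w, fun c' h1 h2 h3 => ?_⟩
      have h4 : c'.μ = c.μ := by rw [← c'.mem_plans.2.1, ← c.mem_plans.2.1, h2]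
      rw [h3, h4, h2, h1, ← hcΦ]
      exact hw
    · exact ⟨0, fun c h1 h2 h3 => absurd ⟨c, h1, h2, h3⟩ hc⟩
  choose w hw using hlin
  refine ⟨Φ, w, fun τ hτ μ hμ => ⟨(hΦ τ μ hτ hμ).flow, fun Ψ hΨ =>
    (hΦ τ μ hτ hμ).flow.eq_of_isNonlocalFlow hv hτ hμ hΨ, fun t ht y hy => ?_⟩,
    fun τ hτ μ hμ ν hν γ hγ => ?_, ?_, fun ε hε => ?_⟩
  · obtain ⟨A, hA⟩ := hfr.exists_isVariation (hΦ τ μ hτ hμ)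
    exact (hfr.hasFDerivWithinAt (hΦ τ μ hτ hμ) hA ht hy).differentiableWithinAt
  · obtain ⟨c, rfl, rfl, rfl, hcΦ, hcΨ⟩ := hcpl τ hτ μ ν hμ hν γ hγ
    have hsol := hw c.τ c.γ c rfl rfl hcΦ
    have hsol' := hsol
    rw [hcΦ] at hsol'
    refine ⟨hsol', fun u hu => ?_, ?_⟩
    · rw [← hcΦ] at hu
      exact hfr.linearisedSolution_unique c hu hsol
    · rw [Metric.tendstoUniformlyOn_iff]
      intro ε hε
      have hW := c.cost_nonneg
      -- The interpolated coupling has cost `h * c.cost`, so after division by `h` the error is at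
      -- most `ε * c.cost / (c.cost + 1)`, strictly below `ε` even when the cost is zero.
      obtain ⟨δ, hδ, H⟩ := hfr.norm_flow_expansion_le (ε / (c.cost + 1)) (by positivity)
      have hev : ∀ᶠ h : ℝ in 𝓝[>] 0, h ≤ min 1 (δ / (c.cost + 1)) :=
        mem_nhdsWithin_of_mem_nhds (Iic_mem_nhds (by positivity))
      filter_upwards [hev, self_mem_nhdsWithin] with h hle hpos p hp
      have h0 : 0 < h := hpos
      have hle1 := hle.trans (min_le_left _ _)
      have hleδ := hle.trans (min_le_right _ _)
      rw [le_div_iff₀ (by positivity)] at hleδ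
      have hΨ := hΦ c.τ _ hτ (c.interpolate_mem_probOn h0.le hle1)
      have hcost := FlowCoupling.cost_interpolated hΨ h0.le
      have key := H (c.interpolated hΨ) _
        (FlowCoupling.isLinearisedSolution_interpolated hfr hΨ hsol)
        (by rw [hcost]; nlinarith) p.1 hp.1 p.2 hp.2
      rw [hcost] at key
      have heq : w c.τ c.γ p.1 p.2 - h⁻¹ • (Φ c.τ (interpolate c.γ h) p.1 p.2 -
          Φ c.τ c.μ p.1 p.2) = -(h⁻¹ • (Φ c.τ (interpolate c.γ h) p.1 p.2 - Φ c.τ c.μ p.1 p.2 -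
            h • w c.τ c.γ p.1 p.2)) := by
        rw [smul_sub h⁻¹ _ (h • _), smul_smul, inv_mul_cancel₀ h0.ne', one_smul]
        abel
      have key' : ‖Φ c.τ (interpolate c.γ h) p.1 p.2 - Φ c.τ c.μ p.1 p.2 -
          h • w c.τ c.γ p.1 p.2‖ ≤ ε / (c.cost + 1) * (h * c.cost) := by
        rw [← hcΦ]
        exact key
      rw [dist_eq_norm, heq, norm_neg, norm_smul, norm_inv, Real.norm_of_nonneg h0.le]
      calc h⁻¹ * ‖Φ c.τ (interpolate c.γ h) p.1 p.2 - Φ c.τ c.μ p.1 p.2 -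
            h • w c.τ c.γ p.1 p.2‖ ≤ h⁻¹ * (ε / (c.cost + 1) * (h * c.cost)) := by gcongr
        _ = ε * c.cost / (c.cost + 1) := by field_simp
        _ < ε := by
          rw [div_lt_iff₀ (by positivity)]
          nlinarith
  · obtain ⟨C, hC, H⟩ := hfr.exists_norm_linearisedSolution_le
    refine ⟨C, hC, fun τ hτ μ hμ ν hν γ hγ t ht x hx => ?_⟩
    obtain ⟨c, rfl, rfl, rfl, hcΦ, hcΨ⟩ := hcpl τ hτ μ ν hμ hν γ hγ
    exact H c _ (hw c.τ c.γ c rfl rfl hcΦ) t ht x hx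
  · obtain ⟨δ, hδ, H⟩ := hfr.norm_flow_expansion_le ε hε
    refine ⟨δ, hδ, fun τ hτ μ hμ ν hν γ hγ hle t ht x hx => ?_⟩
    obtain ⟨c, rfl, rfl, rfl, hcΦ, hcΨ⟩ := hcpl τ hτ μ ν hμ hν γ hγ
    rw [← hcΦ, ← hcΨ]
    exact H c _ (hw c.τ c.γ c rfl rfl hcΦ) hle t ht x hx
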